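/- **Model.** A battery has energy capacity $E>0$, cell replacement price $B>0$, charging and discharging efficiencies $\eta_c,\eta_d>0$, power rating $P>0$ and limits $\underline x,\overline x$ on its state of charge (SoC); the control intervals have length $\tau>0$. Given an initial SoC $x_0\in[\underline x,\overline x]$ and an instruction signal $r_1,\dots,r_T\in[-P,P]$ (positive values ask for charging), an operation is a choice of charging and discharging powers $c_t,d_t$ with $0\le c_t\le\min\{P,[r_t]^+\}$, $0\le d_t\le\min\{P,[-r_t]^+\}$ and $$x_t=x_{t-1}+\frac{\tau\eta_c}{E}c_t-\frac{\tau}{\eta_dE}d_t\in[\underline x,\overline x].$$ Its cost is $$\tau\sum_{t=1}^T\Big(\theta\,[r_t-(c_t-d_t)]^++\pi\,[(c_t-d_t)-r_t]^+\Big)+EB\Big(\sum_i\tfrac12\Phi(v_i)+\sum_j\tfrac12\Phi(w_j)\Big),$$ where $\theta,\pi\ge0$ are penalty prices and $(v_i)$, $(w_j)$ are the depths of the charging and discharging half cycles that the rainflow (four-point) counting method finds in the profile $x_0,x_1,\dots,x_T$ (a full cycle counts as one charging and one discharging half cycle; every leg of the residue is one half cycle). The stress function $\Phi:[0,\infty)\to\mathbb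 R$ is increasing with $\Phi(0)=0$. Let $J^*$ be the infimum of the cost over all operations (offline optimum). Put, for $x\ge0$, $$J_u(x)=EB\,\Phi(x)-E\Big(\frac{\theta}{\eta_c}+\pi\eta_d\Big)x,\qquad J_v(x)=\tfrac12EB\,\Phi(x)-\frac{E}{\eta_c}\theta x,\qquad J_w(x)=\tfrac12EB\,\Phi(x)-E\eta_d\pi x,$$ and suppose that they have minimizers $\hat u,\hat v,\hat w$ on $[0,\infty)$. The threshold policy $g$ is the following online rule. Let $x$ be the current SoC, and let $x^{\max},x^{\min}$ be the largest and smallest SoC since the start, $x_0$ and $x$ included. On reading $r_t$: if $r_t\ge0$, set $c_t=\min\{\frac{E}{\tau\eta_c}(\min\{\overline x,x^{\min}+\hat u\}-x),\,r_t\}$ and $d_t=0$; if $r_t<0$, set $c_t=0$ and $d_t=\min\{\frac{E\eta_d}{\tau}(x-\max\{\underline x,x^{\max}-\hat u\}),\,-r_t\}$. Let $J_g$ be its cost. **Theorem.** Suppose $\Phi$ is strictly convex. Then the worst-case optimality gap of $g$ is $$\epsilon=\begin{cases}J_w(\hat u)+2J_v(\hat u)-J_w(\hat w)-2J_v(\hat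 v)&\text{if }\pi\eta_d>\theta/\eta_c,\\0&\text{if }\pi\eta_d=\theta/\eta_c,\\2J_w(\hat u)+J_v(\hat u)-2J_w(\hat w)-J_v(\hat v)&\text{if }\pi\eta_d<\theta/\eta_c.\end{cases}$$ That is: for all $T$, all $x_0\in[\underline x,\overline x]$ and all $r\in[-P,P]^T$ one has $J_g-J^*\le\epsilon$. Moreover there is a $T_0$ such that, for every $T\ge T_0$ and every $x_0\in[\underline x,\overline x]$ around which the SoC limits leave enough room, namely $x_0+\hat u\le\overline x$ and $\underline x\le x_0+\hat v-\hat w$ if $\pi\eta_d>\theta/\eta_c$, respectively $\underline x\le x_0-\hat u$ and $x_0-\hat w+\hat v\le\overline x$ if $\pi\eta_d<\theta/\eta_c$ (no further condition in the case of equality), the maximum of $J_g-J^*$ over $r\in[-P,P]^T$ exists and equals $\epsilon$. -/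

import Mathlib

noncomputable section

namespace Rainflow

/-- The sequence of local extrema (turning points) of a profile, the first and the last point
included: a point that lies between its two neighbours (in the weak sense) is dropped. -/
def turningPoints : List ℝ → List ℝ
  | a :: b :: c :: l =>
      if (a ≤ b ∧ b ≤ c) ∨ (c ≤ b ∧ b ≤ a) then turningPoints (a :: c :: l)
      else a :: turningPoints (b :: c :: l)
  | [a, b] => if a = b then [a] else [a, b]
  | [a] => [a]
  | [] => []
termination_by l => l.length

/-- Repeated application of the four-point test to the most recent points. The list holds the
points still in play, the most recent one first. If the range between the second and the third of
the last four points is at most both adjacent ranges, that pair is discarded and its range recorded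
as the depth of a full cycle, and the test is repeated. The result consists of the points left and
of the depths of the full cycles extracted. -/
def extract : List ℝ → List ℝ × List ℝ
  | s₄ :: s₃ :: s₂ :: s₁ :: s =>
      if |s₂ - s₃| ≤ |s₁ - s₂| ∧ |s₂ - s₃| ≤ |s₃ - s₄| then
        ((extract (s₄ :: s₁ :: s)).1, |s₂ - s₃| :: (extract (s₄ :: s₁ :: s)).2)
      else (s₄ :: s₃ :: s₂ :: s₁ :: s, [])
  | [s₃, s₂, s₁] => ([s₃, s₂, s₁], [])
  | [s₂, s₁] => ([s₂, s₁], [])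
  | [s₁] => ([s₁], [])
  | [] => ([], [])
termination_by s => s.length

/-- Reads the turning points (second argument) one by one, extracting full cycles whenever this is
possible. The first argument holds the points still in play, the most recent one first. The result
consists of the residue (the most recent point first) and of the depths of all full cycles. -/
def scan : List ℝ → List ℝ → List ℝ × List ℝ
  | s, [] => (s, [])
  | s, p :: l =>
      ((scan (extract (p :: s)).1 l).1, (extract (p :: s)).2 ++ (scan (extract (p :: s)).1 l).2)

/-- The depths of the increasing (charging) legs of a sequence of points in order of time. -/
def upLegs : List ℝ → List ℝ
  | a :: b :: l => if a < b then (b - a) :: upLegs (b :: l) else upLegs (b :: l)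
  | [_] => []
  | [] => []

/-- The depths of the decreasing (discharging) legs of a sequence of points in order of time. -/
def downLegs : List ℝ → List ℝ
  | a :: b :: l => if b < a then (a - b) :: downLegs (b :: l) else downLegs (b :: l)
  | [_] => []
  | [] => []

/-- Rainflow cycle counting: the depths of the charging half cycles and of the discharging half
cycles of a profile. Every full cycle counts as one charging and one discharging half cycle, and
every leg of the residue is one half cycle. -/
def rainflow (x : List ℝ) : List ℝ × List ℝ :=
  ((scan [] (turningPoints x)).2 ++ upLegs (scan [] (turningPoints x)).1.reverse,
    (scan [] (turningPoints x)).2 ++ downLegs (scan [] (turningPoints x)).1.reverse)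

/-- The life loss: half the stress `Φ` of every charging and of every discharging half cycle. -/
def lifeLoss (Φ : ℝ → ℝ) (x : List ℝ) : ℝ :=
  ((rainflow x).1.map fun v => Φ v / 2).sum + ((rainflow x).2.map fun w => Φ w / 2).sum

end Rainflow

/-- The data of the battery and of the market: energy capacity `E`, length `τ` of a control
interval, cell replacement price `B`, charging and discharging efficiencies `ηc` and `ηd`, power
rating `P`, limits `xlo` and `xhi` of the state of charge, price `θ` for surplus injection or
deficient demand, price `π` for deficient injection or surplus demand, and the cycle depth stress
function `Φ`. -/
structure Battery where
  E : ℝ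
  τ : ℝ
  B : ℝ
  ηc : ℝ
  ηd : ℝ
  P : ℝ
  xlo : ℝ
  xhi : ℝ
  θ : ℝ
  π : ℝ
  Φ : ℝ → ℝ

namespace Battery

/-- The state of charge after `t` control intervals. The powers `c t` and `d t` are applied in the
interval that leads from the state at `t` to the state at `t + 1`. -/
def soc (b : Battery) (x₀ : ℝ) (c d : ℕ → ℝ) : ℕ → ℝ
  | 0 => x₀
  | t + 1 => soc b x₀ c d t + b.τ * b.ηc / b.E * c t - b.τ / (b.ηd * b.E) * d t

/-- The operating cost over `T` intervals for the instruction `r` (positive values ask for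
charging): mismatch penalty plus cycle aging cost of the state of charge profile. -/
def cost (b : Battery) (x₀ : ℝ) (T : ℕ) (r c d : ℕ → ℝ) : ℝ :=
  b.τ * ∑ t ∈ Finset.range T,
      (b.θ * max (r t - (c t - d t)) 0 + b.π * max (c t - d t - r t) 0) +
    Rainflow.lifeLoss b.Φ ((List.range (T + 1)).map (b.soc x₀ c d)) * b.B * b.E

/-- Admissible operation over `T` intervals: power limits, limits on the state of charge, and the
battery does not act beyond the instruction. -/
def Feasible (b : Battery) (x₀ : ℝ) (T : ℕ) (r c d : ℕ → ℝ) : Prop :=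
  ∀ t < T,
    (0 ≤ c t ∧ c t ≤ b.P ∧ c t ≤ max (r t) 0) ∧
    (0 ≤ d t ∧ d t ≤ b.P ∧ d t ≤ max (-r t) 0) ∧
    b.xlo ≤ b.soc x₀ c d (t + 1) ∧ b.soc x₀ c d (t + 1) ≤ b.xhi

/-- The offline optimal cost `J*`, all of `r` being known in advance. -/
def offlineCost (b : Battery) (x₀ : ℝ) (T : ℕ) (r : ℕ → ℝ) : ℝ :=
  sInf {J : ℝ | ∃ c d : ℕ → ℝ, b.Feasible x₀ T r c d ∧ J = b.cost x₀ T r c d}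

/-- What the online controller remembers: the current state of charge and the largest and smallest
state of charge since the beginning of the operation. -/
structure PolicyState where
  x : ℝ
  xmax : ℝ
  xmin : ℝ

/-- Charging power chosen by the threshold policy with cycle depth bound `u`. -/
def policyCharge (b : Battery) (u : ℝ) (s : PolicyState) (r : ℝ) : ℝ :=
  if 0 ≤ r then min (b.E / (b.τ * b.ηc) * (min b.xhi (s.xmin + u) - s.x)) r else 0

/-- Discharging power chosen by the threshold policy with cycle depth bound `u`. -/
def policyDischarge (b : Battery) (u : ℝ) (s : PolicyState) (r : ℝ) : ℝ :=
  if 0 ≤ r then 0 else min (b.E * b.ηd / b.τ * (s.x - max b.xlo (s.xmax - u))) (-r)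

/-- The state of charge after one interval under the threshold policy. -/
def policyNext (b : Battery) (u : ℝ) (s : PolicyState) (r : ℝ) : ℝ :=
  s.x + b.τ * b.ηc / b.E * b.policyCharge u s r - b.τ / (b.ηd * b.E) * b.policyDischarge u s r

/-- The controller state after `t` intervals under the threshold policy. -/
def policyState (b : Battery) (u x₀ : ℝ) (r : ℕ → ℝ) : ℕ → PolicyState
  | 0 => ⟨x₀, x₀, x₀⟩
  | t + 1 =>
      ⟨b.policyNext u (policyState b u x₀ r t) (r t),
        max (policyState b u x₀ r t).xmax (b.policyNext u (policyState b u x₀ r t) (r t)),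
        min (policyState b u x₀ r t).xmin (b.policyNext u (policyState b u x₀ r t) (r t))⟩

/-- The cost `J_g` of the threshold policy with cycle depth bound `u`. -/
def policyCost (b : Battery) (u x₀ : ℝ) (T : ℕ) (r : ℕ → ℝ) : ℝ :=
  b.cost x₀ T r (fun t => b.policyCharge u (b.policyState u x₀ r t) (r t))
    (fun t => b.policyDischarge u (b.policyState u x₀ r t) (r t))

/-- The optimality gap `J_g - J*` of the threshold policy with cycle depth bound `u`. -/
def gap (b : Battery) (u x₀ : ℝ) (T : ℕ) (r : ℕ → ℝ) : ℝ :=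
  b.policyCost u x₀ T r - b.offlineCost x₀ T r

/-- Cost of a full cycle. -/
def Ju (b : Battery) (u : ℝ) : ℝ :=
  b.E * b.B * b.Φ u - b.E * (b.θ / b.ηc + b.π * b.ηd) * u

/-- Cost of a charging half cycle. -/
def Jv (b : Battery) (v : ℝ) : ℝ :=
  1 / 2 * b.E * b.B * b.Φ v - b.E / b.ηc * b.θ * v

/-- Cost of a discharging half cycle. -/
def Jw (b : Battery) (w : ℝ) : ℝ :=
  1 / 2 * b.E * b.B * b.Φ w - b.E * b.ηd * b.π * w

open Classical in
/-- The worst-case gap in terms of the optimal depths `u`, `v`, `w` of full cycles, charging half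
cycles and discharging half cycles. -/
def worstGap (b : Battery) (u v w : ℝ) : ℝ :=
  if b.θ / b.ηc < b.π * b.ηd then b.Jw u + 2 * b.Jv u - b.Jw w - 2 * b.Jv v
  else if b.π * b.ηd = b.θ / b.ηc then 0
  else 2 * b.Jw u + b.Jv u - 2 * b.Jw w - b.Jv v

/-- Around `x₀` the limits on the state of charge leave room for the alternating cycles of optimal
depth that make the gap largest (no condition beyond the limits themselves if
`π * ηd = θ / ηc`). -/
def HasRoom (b : Battery) (u v w x₀ : ℝ) : Prop :=
  (b.xlo ≤ x₀ ∧ x₀ ≤ b.xhi) ∧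
  (b.θ / b.ηc < b.π * b.ηd → x₀ + u ≤ b.xhi ∧ b.xlo ≤ x₀ + v - w) ∧
  (b.π * b.ηd < b.θ / b.ηc → b.xlo ≤ x₀ - u ∧ x₀ - w + v ≤ b.xhi)

end Battery

end

noncomputable section

namespace Rainflow

/-! The cost is first written in terms of half cycles alone. The battery never acts beyond the
instruction, so the mismatch penalty is that of idling minus a linear function of the upward and
downward movement of the SoC. The total movement in each direction is the total depth of the half
cycles in that direction. Hence the cost is a constant depending only on `r`, plus `Jv` summed over
the charging and `Jw` summed over the discharging half cycles (`Feasible.cost_eq`).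

Rainflow counting is understood through truncation. Drive a point by the increments of the profile,
but stop it whenever the range it has visited would exceed `s`. Its upward and downward movements
are then the sums of `min d s` over the charging and the discharging half cycles
(`rainflow_min_sum`): an extracted full cycle of depth `d` costs a detour of `min d s` each way, and
each residue leg is traversed up to length `s`. The threshold policy is the greedy motion of range
`u`. Limited further to `s ≤ u`, it is the greedy motion of range `s`, which moves at least as much
in both directions as any admissible path limited to `s` (`move_le_greedyMotion`). So for every `s ≤
u` the policy has the larger truncated depth sums. The other property of rainflow used is balance:
full cycles occur in both directions and the residue alternates, its depths first growing and then
shrinking, so the sums of a monotone function with values in `[0, C]` over charging and over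
discharging half cycles differ by at most `C` (`rainflow_balance`).

Write `Jv d = h d + lam * d` and `Jw d = h d - lam * d`, where `h` is half of `Ju`, and take `lam ≥
0`; the opposite sign follows by exchanging the directions. Depths are split at `u`. Up to `u`, the
function `-h` is concave and nondecreasing, hence on finitely many points a nonnegative combination
of functions `min d s`, so the policy would lose nothing if it were not for the linear terms; these
are controlled by balance and cost at most `2 * (Jv u - Jv v)` (`shallow_gap`). Beyond `u` only the
competitor has half cycles, and balance lets it gain at most `Jw u - Jw w` (`deep_gap`).

The sum of the two bounds is attained by asking for `u` upwards, `w` downwards and `u` upwards: the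
policy moves by `u` each time, while the competitor moves by `v`, `w`, `v`. For the opposite sign of
`lam` the pattern is reflected. -/

/-- A point `z` together with the smallest and the largest value that it has taken so far. -/
@[ext]
structure Band where
  z : ℝ
  lo : ℝ
  hi : ℝ

/-! ### Motion confined to a range `s`, and excursions within it. -/

namespace Band

/-- Move by `δ`, as far as the total range stays within `s`. -/
def step (s : ℝ) (σ : Band) (δ : ℝ) : Band :=
  ⟨max (σ.hi - s) (min (σ.lo + s) (σ.z + δ)),
    min σ.lo (max (σ.hi - s) (min (σ.lo + s) (σ.z + δ))),
    max σ.hi (max (σ.hi - s) (min (σ.lo + s) (σ.z + δ)))⟩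

def Valid (s : ℝ) (σ : Band) : Prop := σ.lo ≤ σ.z ∧ σ.z ≤ σ.hi ∧ σ.hi ≤ σ.lo + s

/-- Upward movement weighted with `α` plus downward movement weighted with `β`. -/
def move (α β : ℝ) (σ σ' : Band) : ℝ := α * max (σ'.z - σ.z) 0 + β * max (σ.z - σ'.z) 0

theorem Valid.step {s : ℝ} {σ : Band} (h : σ.Valid s) (δ : ℝ) :
    (σ.step s δ).Valid s := by
  obtain ⟨z, lo, hi⟩ := σ
  simp only [Valid, Band.step] at *
  grind

theorem step_nonneg {s : ℝ} {σ : Band} (h : σ.Valid s) {δ : ℝ} (hδ : 0 ≤ δ) :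
    σ.step s δ = ⟨min (σ.lo + s) (σ.z + δ), σ.lo, max σ.hi (min (σ.lo + s) (σ.z + δ))⟩ := by
  obtain ⟨z, lo, hi⟩ := σ
  simp only [Valid, Band.step, Band.mk.injEq] at *
  grind

theorem step_nonpos {s : ℝ} {σ : Band} (h : σ.Valid s) {δ : ℝ} (hδ : δ ≤ 0) :
    σ.step s δ = ⟨max (σ.hi - s) (σ.z + δ), min σ.lo (max (σ.hi - s) (σ.z + δ)), σ.hi⟩ := by
  obtain ⟨z, lo, hi⟩ := σ
  simp only [Valid, Band.step, Band.mk.injEq] at *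
  grind

theorem step_z_nonneg {s : ℝ} {σ : Band} (h : σ.Valid s) {δ : ℝ} (hδ : 0 ≤ δ) :
    σ.z ≤ (σ.step s δ).z := by
  rw [step_nonneg h hδ]
  simp only [Valid] at *
  grind

theorem step_z_nonpos {s : ℝ} {σ : Band} (h : σ.Valid s) {δ : ℝ} (hδ : δ ≤ 0) :
    (σ.step s δ).z ≤ σ.z := by
  rw [step_nonpos h hδ]
  simp only [Valid] at *
  grind

theorem move_of_le {α β : ℝ} {σ σ' : Band} (h : σ.z ≤ σ'.z) :
    move α β σ σ' = α * (σ'.z - σ.z) := by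
  simp [move, h]

theorem move_of_ge {α β : ℝ} {σ σ' : Band} (h : σ'.z ≤ σ.z) :
    move α β σ σ' = β * (σ.z - σ'.z) := by
  simp [move, h]

theorem step_add_of_nonneg {s : ℝ} {σ : Band} (h : σ.Valid s) {δ₁ δ₂ : ℝ} (h₁ : 0 ≤ δ₁)
    (h₂ : 0 ≤ δ₂) : (σ.step s δ₁).step s δ₂ = σ.step s (δ₁ + δ₂) := by
  rw [step_nonneg (h.step _) h₂, step_nonneg h h₁, step_nonneg h (by positivity)]
  simp only [Valid, Band.mk.injEq] at *
  grind

theorem step_add_of_nonpos {s : ℝ} {σ : Band} (h : σ.Valid s) {δ₁ δ₂ : ℝ} (h₁ : δ₁ ≤ 0)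
    (h₂ : δ₂ ≤ 0) : (σ.step s δ₁).step s δ₂ = σ.step s (δ₁ + δ₂) := by
  rw [step_nonpos (h.step _) h₂, step_nonpos h h₁, step_nonpos h (by linarith)]
  simp only [Valid, Band.mk.injEq] at *
  grind

theorem move_step_add_of_nonneg {α β s : ℝ} {σ : Band} (h : σ.Valid s) {δ₁ δ₂ : ℝ} (h₁ : 0 ≤ δ₁)
    (h₂ : 0 ≤ δ₂) : move α β σ (σ.step s δ₁) +
      move α β (σ.step s δ₁) ((σ.step s δ₁).step s δ₂) = move α β σ (σ.step s (δ₁ + δ₂)) := by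
  rw [move_of_le (step_z_nonneg h h₁), move_of_le (step_z_nonneg (h.step _) h₂),
    move_of_le (step_z_nonneg h (add_nonneg h₁ h₂)), step_add_of_nonneg h h₁ h₂]
  ring

theorem move_step_add_of_nonpos {α β s : ℝ} {σ : Band} (h : σ.Valid s) {δ₁ δ₂ : ℝ} (h₁ : δ₁ ≤ 0)
    (h₂ : δ₂ ≤ 0) : move α β σ (σ.step s δ₁) +
      move α β (σ.step s δ₁) ((σ.step s δ₁).step s δ₂) = move α β σ (σ.step s (δ₁ + δ₂)) := by
  rw [move_of_ge (step_z_nonpos h h₁), move_of_ge (step_z_nonpos (h.step _) h₂),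
    move_of_ge (step_z_nonpos h (add_nonpos h₁ h₂)), step_add_of_nonpos h h₁ h₂]
  ring

/-- A smaller downward excursion inside an upward move. -/
theorem step_down_excursion {s : ℝ} {σ : Band} (h : σ.Valid s) {e d f : ℝ} (hd : 0 ≤ d)
    (hde : d ≤ e) (hdf : d ≤ f) :
    (((σ.step s e).step s (-d)).step s f = σ.step s (e - d + f)) ∧
    (σ.step s e).z - ((σ.step s e).step s (-d)).z = min d s := by
  rw [step_nonneg ((h.step _).step _) (hd.trans hdf), step_nonpos (h.step _) (by linarith),
    step_nonneg h (hd.trans hde), step_nonneg h (by linarith)]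
  obtain ⟨z, lo, hi⟩ := σ
  simp only [Valid, Band.mk.injEq] at *
  rcases le_total d s with hs | hs
  · have e1 : max (max hi (min (lo + s) (z + e)) - s) (min (lo + s) (z + e) + -d) =
        min (lo + s) (z + e) + -d := by grind
    have e2 : min lo (min (lo + s) (z + e) + -d) = lo := by grind
    rw [e1, e2]
    grind
  -- For `s ≤ d` all three moves saturate: the point reaches `lo + s`, falls to `lo` and returns to
  -- `lo + s`.
  · have e1 : min (lo + s) (z + e) = lo + s := by grind
    have e2 : max hi (lo + s) = lo + s := by grind
    have e3 : max (lo + s - s) (lo + s + -d) = lo := by grind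
    rw [e1, e2, e3]
    grind

theorem step_up_excursion {s : ℝ} {σ : Band} (h : σ.Valid s) {e d f : ℝ} (hd : 0 ≤ d)
    (hde : d ≤ e) (hdf : d ≤ f) :
    (((σ.step s (-e)).step s d).step s (-f) = σ.step s (-e + d - f)) ∧
    ((σ.step s (-e)).step s d).z - (σ.step s (-e)).z = min d s := by
  rw [step_nonpos ((h.step _).step _) (by linarith), step_nonneg (h.step _) hd,
    step_nonpos h (by linarith), step_nonpos h (by linarith)]
  obtain ⟨z, lo, hi⟩ := σ
  simp only [Valid, Band.mk.injEq] at *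
  rcases le_total d s with hs | hs
  · have e1 : min (min lo (max (hi - s) (z + -e)) + s) (max (hi - s) (z + -e) + d) =
        max (hi - s) (z + -e) + d := by grind
    have e2 : max hi (max (hi - s) (z + -e) + d) = hi := by grind
    rw [e1, e2]
    grind
  · have e1 : max (hi - s) (z + -e) = hi - s := by grind
    have e2 : min lo (hi - s) = hi - s := by grind
    have e3 : min (hi - s + s) (hi - s + d) = hi := by grind
    rw [e1, e2, e3]
    grind

/-- The accounting of one full cycle: an excursion no deeper than the moves around it is run through
once down and once up, each time over `min d s`, and leaves no other trace. -/
theorem move_down_excursion {α β s : ℝ} {σ : Band} (h : σ.Valid s) {e d f : ℝ} (hd : 0 ≤ d)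
    (hde : d ≤ e) (hdf : d ≤ f) :
    move α β σ (σ.step s e) + move α β (σ.step s e) ((σ.step s e).step s (-d)) +
      move α β ((σ.step s e).step s (-d)) (((σ.step s e).step s (-d)).step s f) =
    move α β σ (σ.step s (e - d + f)) + (α + β) * min d s := by
  obtain ⟨h1, h2⟩ := step_down_excursion h hd hde hdf
  rw [move_of_le (step_z_nonneg h (hd.trans hde)),
    move_of_ge (step_z_nonpos (h.step _) (by linarith)),
    move_of_le (step_z_nonneg ((h.step _).step _) (hd.trans hdf)),
    move_of_le (step_z_nonneg h (by linarith)), h1, ← h2]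
  ring

theorem move_up_excursion {α β s : ℝ} {σ : Band} (h : σ.Valid s) {e d f : ℝ} (hd : 0 ≤ d)
    (hde : d ≤ e) (hdf : d ≤ f) :
    move α β σ (σ.step s (-e)) + move α β (σ.step s (-e)) ((σ.step s (-e)).step s d) +
      move α β ((σ.step s (-e)).step s d) (((σ.step s (-e)).step s d).step s (-f)) =
    move α β σ (σ.step s (-e + d - f)) + (α + β) * min d s := by
  obtain ⟨h1, h2⟩ := step_up_excursion h hd hde hdf
  rw [move_of_ge (step_z_nonpos h (by linarith)),
    move_of_le (step_z_nonneg (h.step _) hd),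
    move_of_ge (step_z_nonpos ((h.step _).step _) (by linarith)),
    move_of_ge (step_z_nonpos h (by linarith)), h1, ← h2]
  ring

end Band

/-! ### Range-limited motion along a stack of points. -/

/-- The range-limited motion driven by a list of points, the most recent one first. -/
def band (s : ℝ) : List ℝ → Band
  | [] => ⟨0, 0, 0⟩
  | [p] => ⟨p, p, p⟩
  | q :: p :: l => (band s (p :: l)).step s (q - p)

/-- The weighted total movement of the range-limited motion. -/
def totalMove (α β s : ℝ) : List ℝ → ℝ
  | [] => 0
  | [_] => 0
  | q :: p :: l => totalMove α β s (p :: l) +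
      Band.move α β (band s (p :: l)) (band s (q :: p :: l))

theorem band_cons_cons (s q p : ℝ) (l : List ℝ) :
    band s (q :: p :: l) = (band s (p :: l)).step s (q - p) := rfl

theorem totalMove_cons_cons (α β s q p : ℝ) (l : List ℝ) :
    totalMove α β s (q :: p :: l) = totalMove α β s (p :: l) +
      Band.move α β (band s (p :: l)) ((band s (p :: l)).step s (q - p)) := rfl

theorem band_valid {s : ℝ} (hs : 0 ≤ s) : ∀ l : List ℝ, (band s l).Valid s
  | [] => by simp [band, Band.Valid, hs]
  | [p] => by simp [band, Band.Valid, hs]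
  | q :: p :: l => (band_valid hs (p :: l)).step _

/-- Two stacks in the same state of motion, the total movements of which differ by `c`. -/
def SameState (α β s c : ℝ) (l l' : List ℝ) : Prop :=
  l ≠ [] ∧ l' ≠ [] ∧ l.head? = l'.head? ∧ band s l = band s l' ∧
    totalMove α β s l = totalMove α β s l' + c

/-- The next increment depends on the stack only through its top, and the response to it only
through the band. Equality of these two therefore survives all later points, with the same offset
`c`. -/
theorem SameState.cons {α β s c : ℝ} {l l' : List ℝ} (h : SameState α β s c l l') (p : ℝ) :
    SameState α β s c (p :: l) (p :: l') := by
  obtain ⟨h1, h2, h3, h4, h5⟩ := h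
  obtain ⟨a, t, rfl⟩ := List.exists_cons_of_ne_nil h1
  obtain ⟨b, t', rfl⟩ := List.exists_cons_of_ne_nil h2
  simp only [List.head?_cons, Option.some.injEq] at h3
  subst h3
  refine ⟨by simp, by simp, rfl, ?_, ?_⟩
  · rw [band_cons_cons, band_cons_cons, h4]
  · rw [totalMove_cons_cons, totalMove_cons_cons, h4, h5]
    ring

theorem SameState.reverseAux {α β s c : ℝ} (r : List ℝ) : ∀ {l l' : List ℝ},
    SameState α β s c l l' → SameState α β s c (r.reverseAux l) (r.reverseAux l') := by
  induction r with
  | nil => exact fun h => h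
  | cons p r ih => exact fun h => ih (h.cons p)

/-- Consecutive moves in one direction merge into a single move, also when they are stopped at the
range limit. -/
theorem sameState_drop {α β s : ℝ} (hs : 0 ≤ s) {a b c : ℝ}
    (h : (a ≤ b ∧ b ≤ c) ∨ (c ≤ b ∧ b ≤ a)) (l : List ℝ) :
    SameState α β s 0 (c :: b :: a :: l) (c :: a :: l) := by
  have hv := band_valid hs (a :: l)
  refine ⟨by simp, by simp, rfl, ?_, ?_⟩
  · rw [band_cons_cons, band_cons_cons, band_cons_cons]
    rcases h with h | h
    · rw [Band.step_add_of_nonneg hv (by linarith) (by linarith)]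
      congr 1; ring
    · rw [Band.step_add_of_nonpos hv (by linarith) (by linarith)]
      congr 1; ring
  · rw [totalMove_cons_cons, totalMove_cons_cons, totalMove_cons_cons, band_cons_cons]
    have e : c - a = (b - a) + (c - b) := by ring
    rcases h with h | h
    · rw [e, ← Band.move_step_add_of_nonneg hv (by linarith) (by linarith)]
      ring
    · rw [e, ← Band.move_step_add_of_nonpos hv (by linarith) (by linarith)]
      ring

theorem sameState_extract {α β s : ℝ} (hs : 0 ≤ s) {s₁ s₂ s₃ s₄ : ℝ}
    (hz : (s₃ < s₄ ∧ s₃ < s₂ ∧ s₁ < s₂) ∨ (s₄ < s₃ ∧ s₂ < s₃ ∧ s₂ < s₁))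
    (h1 : |s₂ - s₃| ≤ |s₁ - s₂|) (h2 : |s₂ - s₃| ≤ |s₃ - s₄|) (l : List ℝ) :
    SameState α β s ((α + β) * min |s₂ - s₃| s) (s₄ :: s₃ :: s₂ :: s₁ :: l) (s₄ :: s₁ :: l) := by
  have hv := band_valid hs (s₁ :: l)
  refine ⟨by simp, by simp, rfl, ?_, ?_⟩
  · rw [band_cons_cons, band_cons_cons, band_cons_cons, band_cons_cons]
    rcases hz with ⟨ha, hb, hc⟩ | ⟨ha, hb, hc⟩
    · rw [abs_of_pos (by linarith), abs_of_neg (by linarith)] at h1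
      rw [abs_of_pos (by linarith), abs_of_neg (by linarith)] at h2
      have := (Band.step_down_excursion hv (e := s₂ - s₁) (d := s₂ - s₃) (f := s₄ - s₃)
        (by linarith) (by linarith) (by linarith)).1
      rw [show -(s₂ - s₃) = s₃ - s₂ by ring] at this
      rw [this]; congr 1; ring
    · rw [abs_of_neg (by linarith), abs_of_pos (by linarith)] at h1
      rw [abs_of_neg (by linarith), abs_of_pos (by linarith)] at h2
      have := (Band.step_up_excursion hv (e := s₁ - s₂) (d := s₃ - s₂) (f := s₃ - s₄)
        (by linarith) (by linarith) (by linarith)).1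
      rw [show -(s₁ - s₂) = s₂ - s₁ by ring, show -(s₃ - s₄) = s₄ - s₃ by ring] at this
      rw [this]; congr 1; ring
  · simp only [totalMove_cons_cons, band_cons_cons]
    rcases hz with ⟨ha, hb, hc⟩ | ⟨ha, hb, hc⟩
    · rw [abs_of_pos (by linarith), abs_of_neg (by linarith)] at h1
      rw [abs_of_pos (by linarith), abs_of_neg (by linarith)] at h2
      have := Band.move_down_excursion (α := α) (β := β) hv (e := s₂ - s₁) (d := s₂ - s₃)
        (f := s₄ - s₃) (by linarith) (by linarith) (by linarith)
      rw [show -(s₂ - s₃) = s₃ - s₂ by ring,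
        show s₂ - s₁ - (s₂ - s₃) + (s₄ - s₃) = s₄ - s₁ by ring] at this
      rw [abs_of_pos (by linarith : 0 < s₂ - s₃)]
      linarith
    · rw [abs_of_neg (by linarith), abs_of_pos (by linarith)] at h1
      rw [abs_of_neg (by linarith), abs_of_pos (by linarith)] at h2
      have := Band.move_up_excursion (α := α) (β := β) hv (e := s₁ - s₂) (d := s₃ - s₂)
        (f := s₃ - s₄) (by linarith) (by linarith) (by linarith)
      rw [show -(s₁ - s₂) = s₂ - s₁ by ring, show -(s₃ - s₄) = s₄ - s₃ by ring,
        show s₂ - s₁ + (s₃ - s₂) - (s₃ - s₄) = s₄ - s₁ by ring] at this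
      rw [abs_of_neg (by linarith : s₂ - s₃ < 0), show -(s₂ - s₃) = s₃ - s₂ by ring]
      linarith

/-! ### Turning points and extraction of full cycles preserve the motion. -/

/-- A strictly alternating stack, the top of which is a peak (`true`) or a valley (`false`). -/
def Alternating : Bool → List ℝ → Prop
  | _, [] => True
  | _, [_] => True
  | e, q :: p :: l => (if e then p < q else q < p) ∧ Alternating (!e) (p :: l)

/-- A strictly alternating sequence in order of time, starting upwards (`true`) or downwards from
the given point. -/
def AlternatingFrom : Bool → ℝ → List ℝ → Prop
  | _, _, [] => True
  | e, p, q :: l => (if e then p < q else q < p) ∧ AlternatingFrom (!e) q l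

/-- No full cycle can be extracted anywhere in the stack. -/
def Reduced : List ℝ → Prop
  | s₄ :: s₃ :: s₂ :: s₁ :: s =>
      ¬(|s₂ - s₃| ≤ |s₁ - s₂| ∧ |s₂ - s₃| ≤ |s₃ - s₄|) ∧ Reduced (s₃ :: s₂ :: s₁ :: s)
  | [_, _, _] => True
  | [_, _] => True
  | [_] => True
  | [] => True

theorem Reduced.tail {p : ℝ} {l : List ℝ} (h : Reduced (p :: l)) : Reduced l := by
  rcases l with _ | ⟨a, _ | ⟨b, _ | ⟨c, l⟩⟩⟩ <;> simp_all [Reduced]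

/-- The clause on the first direction is what makes the induction work: a point `b` that is kept
lies strictly above or strictly below both neighbours, and the clause for the list starting at `b`
then shows that the direction reverses there. The stack `st` of earlier points is arbitrary because
the recursion restarts at `b` with `a` already passed. -/
theorem turningPoints_cons (l : List ℝ) (a : ℝ) : ∃ e t, turningPoints (a :: l) = a :: t ∧
    AlternatingFrom e a t ∧ (∀ b l', l = b :: l' → (a < b → e = true) ∧ (b < a → e = false)) ∧
    ∀ α β s : ℝ, 0 ≤ s → ∀ st,
      SameState α β s 0 (t.reverseAux (a :: st)) (l.reverseAux (a :: st)) := by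
  have refl : ∀ α β s st, st ≠ [] → SameState α β s 0 st st := fun α β s st h =>
    ⟨h, h, rfl, rfl, by simp⟩
  have refl' : ∀ α β s l a st, SameState α β s 0 (List.reverseAux l (a :: st))
      (l.reverseAux (a :: st)) := fun α β s l a st => (refl α β s (a :: st) (by simp)).reverseAux l
  induction h : l.length using Nat.strong_induction_on generalizing l a with
  | _ n ih =>
  rcases l with _ | ⟨b, _ | ⟨c, l⟩⟩
  · exact ⟨true, [], by simp [turningPoints], trivial, by simp, fun _ _ _ _ st => refl' ..⟩
  · by_cases hab : a = b
    · refine ⟨true, [], by simp [turningPoints, hab], trivial, by simp [hab], ?_⟩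
      intro α β s hs st
      subst hab
      refine ⟨by simp [List.reverseAux], by simp [List.reverseAux], rfl, ?_, ?_⟩
      · have hv := band_valid hs (a :: st)
        simp only [List.reverseAux]
        rw [band_cons_cons, sub_self, Band.step_nonneg hv le_rfl]
        obtain ⟨h1, h2, h3⟩ := hv
        ext <;> simp only <;> grind
      · have hv := band_valid hs (a :: st)
        simp only [List.reverseAux]
        rw [totalMove_cons_cons, sub_self, Band.move_of_le (Band.step_z_nonneg hv le_rfl),
          Band.step_nonneg hv le_rfl]
        obtain ⟨h1, h2, h3⟩ := hv
        have : min ((band s (a :: st)).lo + s) ((band s (a :: st)).z + 0) =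
          (band s (a :: st)).z := by grind
        simp only [this]; ring
    · refine ⟨decide (a < b), [b], by simp [turningPoints, hab], ?_, ?_,
        fun _ _ _ _ st => refl' ..⟩
      · rcases lt_or_gt_of_ne hab with h' | h'
        · simp [AlternatingFrom, h']
        · simp [AlternatingFrom, h', h'.le]
      · rintro b' l' ⟨⟩
        exact ⟨fun h' => by simp [h'], fun h' => by simp [h'.le]⟩
  · simp only [List.length_cons] at h
    by_cases hd : (a ≤ b ∧ b ≤ c) ∨ (c ≤ b ∧ b ≤ a)
    · obtain ⟨e, t, h1, h2, h3, h4⟩ := ih (l.length + 1) (by omega) (c :: l) a (by simp)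
      refine ⟨e, t, ?_, h2, ?_, ?_⟩
      · rw [turningPoints, if_pos hd, h1]
      · rintro b' l' ⟨⟩
        have := h3 c l rfl
        exact ⟨fun h' => this.1 (by grind), fun h' => this.2 (by grind)⟩
      · intro α β s hs st
        have h5 := (sameState_drop (α := α) (β := β) hs hd st).reverseAux l
        have h6 := h4 α β s hs st
        refine ⟨h6.1, h5.1, h6.2.2.1.trans h5.2.2.1.symm, h6.2.2.2.1.trans h5.2.2.2.1.symm, ?_⟩
        have h7 := h5.2.2.2.2
        have h8 := h6.2.2.2.2
        simp only [List.reverseAux] at *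
        linarith
    · obtain ⟨e, t, h1, h2, h3, h4⟩ := ih (l.length + 1) (by omega) (c :: l) b (by simp)
      have h5 := h3 c l rfl
      refine ⟨decide (a < b), b :: t, ?_, ?_, ?_, ?_⟩
      · rw [turningPoints, if_neg hd, h1]
      · rcases lt_trichotomy a b with h' | h' | h'
        · have : e = false := h5.2 (by grind)
          subst this
          simp [AlternatingFrom, h', h2]
        · grind
        · have : e = true := h5.1 (by grind)
          subst this
          have h'' : decide (a < b) = false := by simp [h'.le]
          rw [h'']
          exact ⟨by simpa using h', h2⟩
      · rintro b' l' ⟨⟩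
        exact ⟨fun h' => by simp [h'], fun h' => by simp [h'.le]⟩
      · intro α β s hs st
        exact h4 α β s hs (a :: st)

/-- The invariants of one extraction. -/
theorem extract_spec (e : Bool) (q : ℝ) (l : List ℝ) (ha : Alternating e (q :: l))
    (hr : Reduced l) : ∃ t, (extract (q :: l)).1 = q :: t ∧ Alternating e (q :: t) ∧
      Reduced (q :: t) ∧ ∀ α β s : ℝ, 0 ≤ s → SameState α β s
        (((extract (q :: l)).2.map fun d => (α + β) * min d s).sum) (q :: l) (q :: t) := by
  induction h : l.length using Nat.strong_induction_on generalizing l with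
  | _ n ih =>
  rcases l with _ | ⟨s₃, _ | ⟨s₂, _ | ⟨s₁, l⟩⟩⟩
  · exact ⟨_, by simp [extract], ha, trivial, by simp [extract, SameState]⟩
  · exact ⟨_, by simp [extract], ha, trivial, by simp [extract, SameState]⟩
  · exact ⟨_, by simp [extract], ha, trivial, by simp [extract, SameState]⟩
  · simp only [List.length_cons] at h
    by_cases hd : |s₂ - s₃| ≤ |s₁ - s₂| ∧ |s₂ - s₃| ≤ |s₃ - q|
    · have hz : (s₃ < q ∧ s₃ < s₂ ∧ s₁ < s₂) ∨ (q < s₃ ∧ s₂ < s₃ ∧ s₂ < s₁) := by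
        cases e <;> simp_all [Alternating]
      -- The discarded range is at most the last one, so `q` is level with or beyond `s₂`, hence on
      -- the same side of `s₁` as `s₂`.
      have ha' : Alternating e (q :: s₁ :: l) := by
        have h1 : Alternating (!e) (s₁ :: l) := by
          cases e <;> simp_all [Alternating]
        refine ⟨?_, h1⟩
        obtain ⟨h2, h3⟩ := hd
        cases e
        · simp only [Alternating, Bool.false_eq_true, ↓reduceIte, Bool.not_false,
            Bool.not_true] at ha ⊢
          rw [abs_of_neg (by linarith), abs_of_pos (by linarith)] at h3
          linarith
        · simp only [Alternating, Bool.false_eq_true, ↓reduceIte, Bool.not_false,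
            Bool.not_true] at ha ⊢
          rw [abs_of_pos (by linarith), abs_of_neg (by linarith)] at h3
          linarith
      obtain ⟨t, h1, h2, h3, h4⟩ := ih (l.length + 1) (by omega) (s₁ :: l) ha' hr.tail.tail
        (by simp)
      refine ⟨t, ?_, h2, h3, ?_⟩
      · rw [extract, if_pos hd, h1]
      · intro α β s hs
        have h5 := h4 α β s hs
        have h6 := sameState_extract (α := α) (β := β) hs hz hd.1 hd.2 l
        refine ⟨by simp, by simp, rfl, h6.2.2.2.1.trans h5.2.2.2.1, ?_⟩
        rw [extract, if_pos hd, h6.2.2.2.2, h5.2.2.2.2]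
        simp only [List.map_cons, List.sum_cons]
        ring
    · refine ⟨s₃ :: s₂ :: s₁ :: l, ?_, ha, ⟨hd, hr⟩, ?_⟩
      · rw [extract, if_neg hd]
      · intro α β s hs
        rw [extract, if_neg hd]
        simp [SameState]

theorem scan_spec (l : List ℝ) : ∀ (e : Bool) (p : ℝ) (st : List ℝ), Alternating (!e) (p :: st) →
    Reduced (p :: st) → AlternatingFrom e p l →
    ∃ e' t, (scan (p :: st) l).1 = t ∧ t ≠ [] ∧ Alternating e' t ∧ Reduced t ∧
      ∀ α β s : ℝ, 0 ≤ s → SameState α β s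
        (((scan (p :: st) l).2.map fun d => (α + β) * min d s).sum)
        (l.reverseAux (p :: st)) t := by
  induction l with
  | nil =>
    intro e p st ha hr _
    exact ⟨!e, p :: st, by simp [scan], by simp, ha, hr, by simp [scan, SameState]⟩
  | cons q l ih =>
    intro e p st ha hr hl
    have ha' : Alternating e (q :: p :: st) := ⟨hl.1, ha⟩
    obtain ⟨t, h1, h2, h3, h4⟩ := extract_spec e q (p :: st) ha' hr
    obtain ⟨e', t', h5, h6, h7, h8, h9⟩ := ih (!e) q t (by simpa using h2) h3 hl.2
    refine ⟨e', t', ?_, h6, h7, h8, ?_⟩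
    · rw [scan, h1, h5]
    · intro α β s hs
      have h10 := (h4 α β s hs).reverseAux l
      have h11 := h9 α β s hs
      refine ⟨h10.1, h6, h10.2.2.1.trans h11.2.2.1, h10.2.2.2.1.trans h11.2.2.2.1, ?_⟩
      rw [scan, h1, List.map_append, List.sum_append]
      simp only [List.reverseAux]
      rw [h10.2.2.2.2, h11.2.2.2.2]
      ring

/-- The residue and its total movement. -/
theorem residue_spec (a : ℝ) (l : List ℝ) : ∃ e t, (scan [] (turningPoints (a :: l))).1 = t ∧
    t ≠ [] ∧ Alternating e t ∧ Reduced t ∧ ∀ α β s : ℝ, 0 ≤ s →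
      totalMove α β s (a :: l).reverse =
        totalMove α β s t +
          ((scan [] (turningPoints (a :: l))).2.map fun d => (α + β) * min d s).sum := by
  obtain ⟨e, t, h1, h2, -, h3⟩ := turningPoints_cons l a
  obtain ⟨e', t', h4, h5, h6, h7, h8⟩ := scan_spec t e a [] trivial trivial h2
  have h9 : scan [] (a :: t) = scan [a] t := by
    simp [scan, extract]
  rw [h1, h9]
  refine ⟨e', t', h4, h5, h6, h7, fun α β s hs => ?_⟩
  have h10 := (h3 α β s hs []).2.2.2.2
  have h11 := (h8 α β s hs).2.2.2.2
  have h12 : (a :: l).reverse = l.reverseAux [a] := by simp [List.reverseAux_eq]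
  rw [h12]
  linarith

/-! ### The residue, and truncated depths as movement. -/

/-- The sum over the legs of a stack, rising legs measured by `f` and falling legs by `g`. -/
def legSum (f g : ℝ → ℝ) : List ℝ → ℝ
  | [] => 0
  | [_] => 0
  | q :: p :: l => legSum f g (p :: l) +
      ((if p < q then f (q - p) else 0) + (if q < p then g (p - q) else 0))

/-- Legs are read in order of time whereas a stack grows at the most recent end, so a new stack
entry appends a leg at the end of the reversed list. -/
theorem upLegs_append (L : List ℝ) (p q : ℝ) :
    upLegs (L ++ [p, q]) = upLegs (L ++ [p]) ++ if p < q then [q - p] else [] := by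
  induction L with
  | nil => simp [upLegs]
  | cons a L ih =>
    rcases L with _ | ⟨b, L⟩
    · simp only [upLegs, List.cons_append, List.nil_append]
      split_ifs <;> simp
    · simp only [upLegs, List.cons_append] at ih ⊢
      split_ifs at ih ⊢ <;> simp_all

theorem downLegs_append (L : List ℝ) (p q : ℝ) :
    downLegs (L ++ [p, q]) = downLegs (L ++ [p]) ++ if q < p then [p - q] else [] := by
  induction L with
  | nil => simp [downLegs]
  | cons a L ih =>
    rcases L with _ | ⟨b, L⟩
    · simp only [downLegs, List.cons_append, List.nil_append]
      split_ifs <;> simp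
    · simp only [downLegs, List.cons_append] at ih ⊢
      split_ifs at ih ⊢ <;> simp_all

theorem legSum_eq (f g : ℝ → ℝ) : ∀ t : List ℝ, legSum f g t =
    ((upLegs t.reverse).map f).sum + ((downLegs t.reverse).map g).sum
  | [] => by simp [legSum, upLegs, downLegs]
  | [_] => by simp [legSum, upLegs, downLegs]
  | q :: p :: l => by
    have ih := legSum_eq f g (p :: l)
    have e1 : (q :: p :: l).reverse = l.reverse ++ [p, q] := by simp
    have e2 : (p :: l).reverse = l.reverse ++ [p] := by simp
    rw [legSum, ih, e1, e2, upLegs_append, downLegs_append]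
    split_ifs <;> simp only [List.map_append, List.sum_append, List.map_cons, List.map_nil,
      List.sum_cons, List.sum_nil] <;> ring

/-- Here `f` is the previous leg, `δ` the new one, and `X` says that the previous leg was the
largest so far. If so, the point sits at the lower end of the band. If not, the new leg is shorter
than `f`, and the point is at the lower end or has room `f` above it. Either way the move has length
`min δ s`. The last two conclusions are the reflected invariant, ready for `residue_down`. -/
theorem Band.residue_up {α β s : ℝ} {σ : Band} (hv : σ.Valid s) {f δ : ℝ} (hδ : 0 < δ)
    {X : Prop} (h1 : σ.z = σ.lo ∨ σ.z + f ≤ σ.lo + s)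
    (h2 : X → σ.z = σ.lo ∧ σ.hi - σ.lo ≤ f) (h3 : ¬X → δ < f) :
    move α β σ (σ.step s δ) = α * min δ s ∧
    ((σ.step s δ).z = (σ.step s δ).hi ∨ (σ.step s δ).hi - s ≤ (σ.step s δ).z - δ) ∧
    (f < δ → (σ.step s δ).z = (σ.step s δ).hi ∧ (σ.step s δ).hi - (σ.step s δ).lo ≤ δ) := by
  rw [move_of_le (step_z_nonneg hv hδ.le), step_nonneg hv hδ.le]
  obtain ⟨z, lo, hi⟩ := σ
  simp only [Valid] at *
  by_cases hX : X
  · have h2' := h2 hX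
    refine ⟨?_, by grind, by grind⟩
    congr 1
    grind
  · have h3' := h3 hX
    refine ⟨?_, by grind, by grind⟩
    congr 1
    grind

theorem Band.residue_down {α β s : ℝ} {σ : Band} (hv : σ.Valid s) {f δ : ℝ} (hδ : 0 < δ)
    {X : Prop} (h1 : σ.z = σ.hi ∨ σ.hi - s ≤ σ.z - f)
    (h2 : X → σ.z = σ.hi ∧ σ.hi - σ.lo ≤ f) (h3 : ¬X → δ < f) :
    move α β σ (σ.step s (-δ)) = β * min δ s ∧
    ((σ.step s (-δ)).z = (σ.step s (-δ)).lo ∨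
      (σ.step s (-δ)).z + δ ≤ (σ.step s (-δ)).lo + s) ∧
    (f < δ → (σ.step s (-δ)).z = (σ.step s (-δ)).lo ∧
      (σ.step s (-δ)).hi - (σ.step s (-δ)).lo ≤ δ) := by
  have hδ' : -δ ≤ 0 := by linarith
  rw [move_of_ge (step_z_nonpos hv hδ'), step_nonpos hv hδ']
  obtain ⟨z, lo, hi⟩ := σ
  simp only [Valid] at *
  by_cases hX : X
  · have h2' := h2 hX
    refine ⟨?_, by grind, by grind⟩
    congr 1
    grind
  · have h3' := h3 hX
    refine ⟨?_, by grind, by grind⟩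
    congr 1
    grind

/-- The last leg of the stack is the largest one so far. -/
def Expanding : List ℝ → Prop
  | q :: p :: o :: _ => |p - o| < |q - p|
  | _ => True

/-- No interior leg of a reduced stack is at most both of its neighbours. Once a leg fails to exceed
its predecessor, every later one must be strictly shorter, so the residue first expands and then
contracts. -/
theorem Reduced.lt_of_not_expanding {q p o : ℝ} {l : List ℝ} (hr : Reduced (q :: p :: o :: l))
    (h : ¬Expanding (p :: o :: l)) : |q - p| < |p - o| := by
  rcases l with _ | ⟨o', l⟩
  · simp [Expanding] at h
  · simp only [Expanding, not_lt] at h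
    have := hr.1
    rw [abs_sub_comm p o, abs_sub_comm o o'] at h
    rw [abs_sub_comm q p, abs_sub_comm p o]
    grind

/-- The invariant carried along the legs is that of `Band.residue_up` and `Band.residue_down`:
either the last leg ended at a wall, or there is room to go back by its full length; in the
expanding part it ended at a wall, and the whole band is no wider than this leg. -/
theorem totalMove_residue_aux {α β s : ℝ} (hs : 0 ≤ s) : ∀ (l : List ℝ) (e : Bool) (q p : ℝ),
    Alternating e (q :: p :: l) → Reduced (q :: p :: l) →
    (totalMove α β s (q :: p :: l) =
      legSum (fun d => α * min d s) (fun d => β * min d s) (q :: p :: l)) ∧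
    (if e then
      ((band s (q :: p :: l)).z = (band s (q :: p :: l)).hi ∨
        (band s (q :: p :: l)).hi - s ≤ (band s (q :: p :: l)).z - (q - p)) ∧
      (Expanding (q :: p :: l) → (band s (q :: p :: l)).z = (band s (q :: p :: l)).hi ∧
        (band s (q :: p :: l)).hi - (band s (q :: p :: l)).lo ≤ q - p)
    else
      ((band s (q :: p :: l)).z = (band s (q :: p :: l)).lo ∨
        (band s (q :: p :: l)).z + (p - q) ≤ (band s (q :: p :: l)).lo + s) ∧
      (Expanding (q :: p :: l) → (band s (q :: p :: l)).z = (band s (q :: p :: l)).lo ∧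
        (band s (q :: p :: l)).hi - (band s (q :: p :: l)).lo ≤ p - q)) := by
  intro l
  induction l with
  | nil =>
    intro e q p ha _
    have hv := band_valid hs [p]
    rw [totalMove_cons_cons, band_cons_cons]
    simp only [legSum, totalMove]
    cases e
    · simp only [Alternating, Bool.false_eq_true, ↓reduceIte, and_true] at ha ⊢
      have h := Band.residue_down (α := α) (β := β) hv (f := 0) (δ := p - q) (by linarith)
        (X := True) (by simp [band]) (by simp [band]) (by simp)
      rw [show -(p - q) = q - p by ring] at h
      refine ⟨?_, h.2.1, fun _ => h.2.2 (by linarith)⟩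
      rw [h.1, if_neg (by linarith), if_pos ha]
      ring
    · simp only [Alternating, ↓reduceIte, and_true] at ha ⊢
      have h := Band.residue_up (α := α) (β := β) hv (f := 0) (δ := q - p) (by linarith)
        (X := True) (by simp [band]) (by simp [band]) (by simp)
      refine ⟨?_, h.2.1, fun _ => h.2.2 (by linarith)⟩
      rw [h.1, if_pos ha, if_neg (by linarith)]
      ring
  | cons o l ih =>
    intro e q p ha hr
    have hv := band_valid hs (p :: o :: l)
    obtain ⟨ih1, ih2⟩ := ih (!e) p o ha.2 hr.tail
    have hne := hr.lt_of_not_expanding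
    rw [totalMove_cons_cons, band_cons_cons s q p, legSum, ih1]
    simp only [Expanding]
    cases e
    · simp only [Alternating, Bool.false_eq_true, ↓reduceIte, Bool.not_false, Bool.not_true]
        at ha ih2 ⊢
      rw [abs_of_neg (by linarith), abs_of_pos (by linarith)] at hne
      rw [abs_of_neg (by linarith : q - p < 0), abs_of_pos (by linarith : 0 < p - o)]
      have h := Band.residue_down (α := α) (β := β) hv (f := p - o) (δ := p - q) (by linarith)
        ih2.1 ih2.2 (by simpa using hne)
      rw [show -(p - q) = q - p by ring] at h
      refine ⟨?_, h.2.1, fun hh => h.2.2 (by linarith)⟩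
      rw [h.1, if_neg (by linarith), if_pos ha.1]
      ring
    · simp only [Alternating, Bool.false_eq_true, ↓reduceIte, Bool.not_false, Bool.not_true]
        at ha ih2 ⊢
      rw [abs_of_pos (by linarith), abs_of_neg (by linarith)] at hne
      rw [abs_of_pos (by linarith : 0 < q - p), abs_of_neg (by linarith : p - o < 0)]
      have h := Band.residue_up (α := α) (β := β) hv (f := o - p) (δ := q - p) (by linarith)
        ih2.1 ih2.2 (by simpa using hne)
      refine ⟨?_, h.2.1, fun hh => h.2.2 (by linarith)⟩
      rw [h.1, if_pos ha.1, if_neg (by linarith)]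
      ring

theorem totalMove_residue {α β s : ℝ} (hs : 0 ≤ s) {e : Bool} {t : List ℝ}
    (ha : Alternating e t) (hr : Reduced t) :
    totalMove α β s t = legSum (fun d => α * min d s) (fun d => β * min d s) t := by
  rcases t with _ | ⟨q, _ | ⟨p, l⟩⟩
  · rfl
  · rfl
  · exact (totalMove_residue_aux hs l e q p ha hr).1

/-- The half cycles of a profile, cut off at depth `s`, make up the movement of the profile
when its range is limited to `s`. -/
theorem rainflow_min_sum (α β : ℝ) {s : ℝ} (hs : 0 ≤ s) (a : ℝ) (l : List ℝ) :
    α * ((rainflow (a :: l)).1.map fun d => min d s).sum +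
      β * ((rainflow (a :: l)).2.map fun d => min d s).sum =
    totalMove α β s (a :: l).reverse := by
  obtain ⟨e, t, h1, h2, h3, h4, h5⟩ := residue_spec a l
  have h6 : ∀ (c : ℝ) (L : List ℝ), (L.map fun d => c * min d s).sum =
      c * (L.map fun d => min d s).sum := fun c L => List.sum_map_mul_left ..
  rw [h5 α β s hs, totalMove_residue hs h3 h4, legSum_eq, ← h1]
  simp only [rainflow, List.map_append, List.sum_append, h6]
  ring

/-! ### Balance of charging and discharging half cycles. -/

/-- The alternating sum over the legs of a stack, the last leg counted positively. -/
def altSum (k : ℝ → ℝ) : List ℝ → ℝ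
  | [] => 0
  | [_] => 0
  | q :: p :: l => k |q - p| - altSum k (p :: l)

theorem legSum_neg_eq (k : ℝ → ℝ) : ∀ (t : List ℝ) (e : Bool), Alternating e t →
    legSum k (fun d => -k d) t = if e then altSum k t else -altSum k t
  | [], e, _ => by simp [legSum, altSum]
  | [_], e, _ => by simp [legSum, altSum]
  | q :: p :: l, e, ha => by
    have ih := legSum_neg_eq k (p :: l) (!e) ha.2
    have h := ha.1
    rw [legSum, ih, altSum]
    cases e
    · simp only [Bool.false_eq_true, ↓reduceIte, Bool.not_false] at h ⊢
      rw [if_neg (by linarith), if_pos h, abs_of_neg (by linarith),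
        show -(q - p) = p - q by ring]
      ring
    · simp only [Bool.false_eq_true, ↓reduceIte, Bool.not_true] at h ⊢
      rw [if_pos h, if_neg (by linarith), abs_of_pos (by linarith)]
      ring

/-- An alternating sum of a sequence that rises and then falls. While it rises, the sum stays
between `0` and its last term; when it falls, the difference between the sum and its last term only
needs to be at least `-C`. -/
theorem altSum_aux {k : ℝ → ℝ} {C : ℝ} (hk : MonotoneOn k (Set.Ici 0))
    (h0 : ∀ d, 0 ≤ d → 0 ≤ k d) (hC : ∀ d, 0 ≤ d → k d ≤ C) : ∀ (l : List ℝ) (q p : ℝ),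
    Reduced (q :: p :: l) → altSum k (q :: p :: l) ≤ C ∧ k |q - p| - C ≤ altSum k (q :: p :: l) ∧
      (Expanding (q :: p :: l) → 0 ≤ altSum k (q :: p :: l) ∧
        altSum k (q :: p :: l) ≤ k |q - p|) := by
  intro l
  induction l with
  | nil =>
    intro q p _
    have h1 := h0 _ (abs_nonneg (q - p))
    have h2 := hC _ (abs_nonneg (q - p))
    simp only [altSum]
    grind
  | cons o l ih =>
    intro q p hr
    obtain ⟨ih1, ih2, ih3⟩ := ih p o hr.tail
    have hne := hr.lt_of_not_expanding
    have h1 := h0 _ (abs_nonneg (q - p))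
    have h2 := hC _ (abs_nonneg (q - p))
    have m1 : |p - o| ≤ |q - p| → k |p - o| ≤ k |q - p| := fun h =>
      hk (Set.mem_Ici.2 (abs_nonneg _)) (Set.mem_Ici.2 (abs_nonneg _)) h
    have m2 : |q - p| ≤ |p - o| → k |q - p| ≤ k |p - o| := fun h =>
      hk (Set.mem_Ici.2 (abs_nonneg _)) (Set.mem_Ici.2 (abs_nonneg _)) h
    rw [altSum]
    by_cases hE : Expanding (p :: o :: l)
    · have ih3' := ih3 hE
      refine ⟨by linarith, by linarith, ?_⟩
      intro h
      have := m1 (le_of_lt h)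
      constructor <;> linarith
    · have h3 := hne hE
      have h4 := m2 h3.le
      refine ⟨by linarith, by linarith, ?_⟩
      intro h
      simp only [Expanding] at h
      linarith

/-- Charging and discharging half cycles alternate in the residue, so that they balance up to
one half cycle. -/
theorem rainflow_balance {k : ℝ → ℝ} {C : ℝ} (hk : MonotoneOn k (Set.Ici 0))
    (h0 : ∀ d, 0 ≤ d → 0 ≤ k d) (hC : ∀ d, 0 ≤ d → k d ≤ C) (a : ℝ) (l : List ℝ) :
    |((rainflow (a :: l)).1.map k).sum - ((rainflow (a :: l)).2.map k).sum| ≤ C := by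
  obtain ⟨e, t, h1, h2, h3, h4, -⟩ := residue_spec a l
  -- Full cycles are listed in both directions and cancel, leaving only the residue.
  have h5 : ((rainflow (a :: l)).1.map k).sum - ((rainflow (a :: l)).2.map k).sum =
      legSum k (fun d => -k d) t := by
    have h6 : ∀ L : List ℝ, (L.map fun d => -k d).sum = -(L.map k).sum := fun L => by
      induction L with
      | nil => simp
      | cons a L ih =>
        simp only [List.map_cons, List.sum_cons, ih]
        ring
    rw [legSum_eq, h6, ← h1]
    simp only [rainflow, List.map_append, List.sum_append]
    ring
  have hC0 : 0 ≤ C := (h0 0 le_rfl).trans (hC 0 le_rfl)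
  have h6 : |altSum k t| ≤ C := by
    rcases t with _ | ⟨q, _ | ⟨p, l⟩⟩
    · simpa [altSum]
    · simpa [altSum]
    · have h := altSum_aux hk h0 hC l q p h4
      have h' := h0 _ (abs_nonneg (q - p))
      rw [abs_le]
      constructor <;> linarith
  rw [h5, legSum_neg_eq k t e h3]
  cases e <;> simpa using h6

/-! ### Half-cycle depths are bounded by the range of the profile. -/

theorem turningPoints_subset (l : List ℝ) : turningPoints l ⊆ l := by
  induction l using turningPoints.induct with
  | case1 a b c l h ih =>
    rw [turningPoints, if_pos h]
    intro x hx
    have := ih hx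
    simp only [List.mem_cons] at this ⊢
    tauto
  | case2 a b c l h ih =>
    rw [turningPoints, if_neg h]
    exact List.cons_subset_cons _ ih
  | case3 a => simp [turningPoints]
  | case4 a b h => simp [turningPoints, h]
  | case5 a => simp [turningPoints]
  | case6 => simp [turningPoints]

theorem extract_mem {S : Set ℝ} {K : ℝ} (hK : ∀ x ∈ S, ∀ y ∈ S, |x - y| ≤ K) (l : List ℝ)
    (hl : ∀ x ∈ l, x ∈ S) :
    (∀ x ∈ (extract l).1, x ∈ S) ∧ ∀ d ∈ (extract l).2, 0 ≤ d ∧ d ≤ K := by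
  induction l using extract.induct with
  | case1 s₄ s₃ s₂ s₁ s h ih =>
    rw [extract, if_pos h]
    have ih' := ih (fun x hx => hl x (by simp only [List.mem_cons] at hx ⊢; tauto))
    refine ⟨ih'.1, ?_⟩
    intro d hd
    rcases List.mem_cons.1 hd with rfl | hd
    · exact ⟨abs_nonneg _, hK _ (hl _ (by simp)) _ (hl _ (by simp))⟩
    · exact ih'.2 d hd
  | case2 s₄ s₃ s₂ s₁ s h =>
    rw [extract, if_neg h]
    exact ⟨hl, by simp⟩
  | case3 => simpa [extract] using hl
  | case4 => simpa [extract] using hl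
  | case5 => simpa [extract] using hl
  | case6 => simp [extract]

theorem scan_mem {S : Set ℝ} {K : ℝ} (hK : ∀ x ∈ S, ∀ y ∈ S, |x - y| ≤ K) (l : List ℝ) :
    ∀ st : List ℝ, (∀ x ∈ st, x ∈ S) → (∀ x ∈ l, x ∈ S) →
    (∀ x ∈ (scan st l).1, x ∈ S) ∧ ∀ d ∈ (scan st l).2, 0 ≤ d ∧ d ≤ K := by
  induction l with
  | nil => intro st hst _; simpa [scan] using hst
  | cons p l ih =>
    intro st hst hl
    have h1 := extract_mem hK (p :: st) (by
      intro x hx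
      rcases List.mem_cons.1 hx with rfl | hx
      · exact hl _ (by simp)
      · exact hst x hx)
    have h2 := ih _ h1.1 (fun x hx => hl x (by simp [hx]))
    rw [scan]
    refine ⟨h2.1, ?_⟩
    intro d hd
    rcases List.mem_append.1 hd with hd | hd
    · exact h1.2 d hd
    · exact h2.2 d hd

theorem upLegs_mem {S : Set ℝ} {K : ℝ} (hK : ∀ x ∈ S, ∀ y ∈ S, |x - y| ≤ K) : ∀ l : List ℝ,
    (∀ x ∈ l, x ∈ S) → ∀ d ∈ upLegs l, 0 ≤ d ∧ d ≤ K
  | [], _ => by simp [upLegs]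
  | [_], _ => by simp [upLegs]
  | a :: b :: l, h => by
    have ih := upLegs_mem hK (b :: l) (fun x hx => h x (List.mem_cons_of_mem _ hx))
    have h1 := (abs_le.1 (hK b (h b (by simp)) a (h a (by simp)))).2
    rw [upLegs]
    split_ifs with hab
    · intro d hd
      rcases List.mem_cons.1 hd with rfl | hd
      · exact ⟨by linarith, h1⟩
      · exact ih d hd
    · exact ih

theorem downLegs_mem {S : Set ℝ} {K : ℝ} (hK : ∀ x ∈ S, ∀ y ∈ S, |x - y| ≤ K) : ∀ l : List ℝ,
    (∀ x ∈ l, x ∈ S) → ∀ d ∈ downLegs l, 0 ≤ d ∧ d ≤ K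
  | [], _ => by simp [downLegs]
  | [_], _ => by simp [downLegs]
  | a :: b :: l, h => by
    have ih := downLegs_mem hK (b :: l) (fun x hx => h x (List.mem_cons_of_mem _ hx))
    have h1 := (abs_le.1 (hK a (h a (by simp)) b (h b (by simp)))).2
    rw [downLegs]
    split_ifs with hab
    · intro d hd
      rcases List.mem_cons.1 hd with rfl | hd
      · exact ⟨by linarith, h1⟩
      · exact ih d hd
    · exact ih

/-- The depths of all half cycles are at most the range of the profile. -/
theorem rainflow_depth_le {K : ℝ} (l : List ℝ) (hK : ∀ x ∈ l, ∀ y ∈ l, |x - y| ≤ K) :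
    (∀ d ∈ (rainflow l).1, 0 ≤ d ∧ d ≤ K) ∧ ∀ d ∈ (rainflow l).2, 0 ≤ d ∧ d ≤ K := by
  have hK' : ∀ x ∈ {x | x ∈ l}, ∀ y ∈ {x | x ∈ l}, |x - y| ≤ K := hK
  have h1 := scan_mem hK' (turningPoints l) [] (by simp) (fun x hx => turningPoints_subset l hx)
  have h2 : ∀ x ∈ (scan [] (turningPoints l)).1.reverse, x ∈ {x | x ∈ l} := fun x hx =>
    h1.1 x (List.mem_reverse.1 hx)
  constructor
  · intro d hd
    rcases List.mem_append.1 hd with hd | hd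
    · exact h1.2 d hd
    · exact upLegs_mem hK' _ h2 d hd
  · intro d hd
    rcases List.mem_append.1 hd with hd | hd
    · exact h1.2 d hd
    · exact downLegs_mem hK' _ h2 d hd

/-! ### Greedy motion compared with arbitrary admissible paths. -/

namespace Band

/-- Move to a new point without any limit on the range. -/
def track (σ : Band) (x : ℝ) : Band := ⟨x, min σ.lo x, max σ.hi x⟩

/-- Move by `δ`, as far as the total range stays within `s` and the point within `[a, b]`. -/
def greedy (a b s : ℝ) (σ : Band) (δ : ℝ) : Band :=
  σ.track (max (max a (σ.hi - s)) (min (min b (σ.lo + s)) (σ.z + δ)))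

/-- The band `τ` of the motion limited to the range `s` that follows a path with the band `σ`. -/
def Follows (s : ℝ) (σ τ : Band) : Prop :=
  τ.Valid s ∧ (σ.lo ≤ σ.z ∧ σ.z ≤ σ.hi) ∧
    (σ = τ ∨ (τ.hi - τ.lo = s ∧ σ.lo ≤ τ.lo + (σ.z - τ.z) ∧ τ.hi + (σ.z - τ.z) ≤ σ.hi))

def Within (a b : ℝ) (σ : Band) : Prop := a ≤ σ.lo ∧ σ.hi ≤ b

/-- Until its range reaches `s`, the limited motion coincides with the path. From then on its band
is frozen, and stopping at a wall can only bring the point closer to the ends of its band than the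
path is to its own extremes. -/
theorem Follows.step {s : ℝ} {σ τ : Band} (h : Follows s σ τ) (x : ℝ) :
    Follows s (σ.track x) (τ.step s (x - σ.z)) := by
  obtain ⟨hv, hσ, h⟩ := h
  refine ⟨hv.step _, ?_, ?_⟩
  · simp only [track]; grind
  · rcases le_total σ.z x with hx | hx
    · rw [step_nonneg hv (by linarith)]
      obtain ⟨z, lo, hi⟩ := σ
      obtain ⟨z', lo', hi'⟩ := τ
      simp only [track, Valid, mk.injEq] at *
      rcases h with ⟨rfl, rfl, rfl⟩ | h
      · rcases le_total x (lo + s) with h1 | h1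
        · left; grind
        · right; grind
      · right; grind
    · rw [step_nonpos hv (by linarith)]
      obtain ⟨z, lo, hi⟩ := σ
      obtain ⟨z', lo', hi'⟩ := τ
      simp only [track, Valid, mk.injEq] at *
      rcases h with ⟨rfl, rfl, rfl⟩ | h
      · rcases le_total (hi - s) x with h1 | h1
        · left; grind
        · right; grind
      · right; grind

/-- The limited motion is a translate of the path only in part, so confinement is not immediate. It
holds because the band is taken over from the path while it grows and is frozen once its width is
`s`. -/
theorem Within.step {a b s : ℝ} {σ τ : Band} (h : Follows s σ τ) (hτ : τ.Within a b) {x : ℝ}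
    (ha : a ≤ x) (hb : x ≤ b) : (τ.step s (x - σ.z)).Within a b := by
  obtain ⟨hv, hσ, h⟩ := h
  rcases le_total σ.z x with hx | hx
  · rw [step_nonneg hv (by linarith)]
    obtain ⟨z, lo, hi⟩ := σ
    obtain ⟨z', lo', hi'⟩ := τ
    simp only [Within, Valid, mk.injEq] at *
    grind
  · rw [step_nonpos hv (by linarith)]
    obtain ⟨z, lo, hi⟩ := σ
    obtain ⟨z', lo', hi'⟩ := τ
    simp only [Within, Valid, mk.injEq] at *
    grind

/-- Limiting the range of the greedy motion further yields the greedy motion of smaller range. -/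
theorem Follows.step_greedy {a b s u : ℝ} {σ τ : Band} (h : Follows s σ τ) (hs : s ≤ u)
    (hσ : σ.Valid u) (hσ' : σ.Within a b) (hτ : τ.Within a b) (R : ℝ) :
    τ.step s ((σ.greedy a b u R).z - σ.z) = τ.greedy a b s R := by
  obtain ⟨hv, -, h⟩ := h
  have e : (σ.greedy a b u R).z = max (max a (σ.hi - u)) (min (min b (σ.lo + u)) (σ.z + R)) := rfl
  rcases le_total 0 R with hR | hR
  · have e1 : (σ.greedy a b u R).z = min (min b (σ.lo + u)) (σ.z + R) := by
      rw [e]; simp only [Valid, Within] at *; grind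
    have e2 : max (max a (τ.hi - s)) (min (min b (τ.lo + s)) (τ.z + R)) =
        min (min b (τ.lo + s)) (τ.z + R) := by
      simp only [Valid, Within] at *; grind
    have e3 : σ.z ≤ (σ.greedy a b u R).z := by
      rw [e1]; simp only [Valid, Within] at *; grind
    rw [step_nonneg hv (by linarith), e1, greedy, e2]
    obtain ⟨z, lo, hi⟩ := σ
    obtain ⟨z', lo', hi'⟩ := τ
    simp only [track, Valid, Within, mk.injEq] at *
    rcases h with ⟨rfl, rfl, rfl⟩ | h
    · have e4 : min (lo + s) (z + (min (min b (lo + u)) (z + R) - z)) =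
          min (min b (lo + s)) (z + R) := by grind
      rw [e4]
      grind
    -- The frozen band satisfies `hi' - z' ≤ hi - z`, so the narrow motion is stopped by its own
    -- wall no later than the limits `b` and `lo + u` stop the wide one.
    · have e4 : min (lo' + s) (z' + (min (min b (lo + u)) (z + R) - z)) =
          min (min b (lo' + s)) (z' + R) := by grind
      rw [e4]
      grind
  · have e1 : (σ.greedy a b u R).z = max (max a (σ.hi - u)) (σ.z + R) := by
      rw [e]; simp only [Valid, Within] at *; grind
    have e2 : max (max a (τ.hi - s)) (min (min b (τ.lo + s)) (τ.z + R)) =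
        max (max a (τ.hi - s)) (τ.z + R) := by
      simp only [Valid, Within] at *; grind
    have e3 : (σ.greedy a b u R).z ≤ σ.z := by
      rw [e1]; simp only [Valid, Within] at *; grind
    rw [step_nonpos hv (by linarith), e1, greedy, e2]
    obtain ⟨z, lo, hi⟩ := σ
    obtain ⟨z', lo', hi'⟩ := τ
    simp only [track, Valid, Within, mk.injEq] at *
    rcases h with ⟨rfl, rfl, rfl⟩ | h
    · have e4 : max (hi - s) (z + (max (max a (hi - u)) (z + R) - z)) =
          max (max a (hi - s)) (z + R) := by grind
      rw [e4]
      grind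
    · have e4 : max (hi' - s) (z' + (max (max a (hi - u)) (z + R) - z)) =
          max (max a (hi' - s)) (z' + R) := by grind
      rw [e4]
      grind

theorem Valid.greedy {a b s : ℝ} {σ : Band} (h : σ.Valid s) (h' : σ.Within a b) (R : ℝ) :
    (σ.greedy a b s R).Valid s ∧ (σ.greedy a b s R).Within a b := by
  obtain ⟨z, lo, hi⟩ := σ
  simp only [Valid, Within, Band.greedy, track] at *
  grind

/-- How far the greedy motion `σ` is ahead of the motion `τ`, where `p` and `q` are the surpluses of
upward and of downward movement. -/
def Ahead (σ τ : Band) (p q : ℝ) : Prop :=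
  0 ≤ p ∧ 0 ≤ q ∧ σ.hi - τ.hi ≤ p ∧ τ.lo - σ.lo ≤ q ∧ p - q = σ.z - τ.z

/-- If the upward move of the greedy motion is not stopped, it is at least that of `τ`. If it is
stopped, `p = q + (σ.z - τ.z)` is evaluated at the wall: at `b` because `τ` stays below `b`, and at
`σ.lo + s` because `τ.lo - σ.lo ≤ q`. This is why the invariant must include the extremes. Downward
moves are symmetric. -/
theorem Ahead.step {a b s R δ p q : ℝ} {σ τ : Band} (h : Ahead σ τ p q) (hσ : σ.Valid s)
    (hσ' : σ.Within a b) (hτ : τ.Valid s) (hτ' : (τ.step s δ).Within a b)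
    (hδ : (0 ≤ δ ∧ δ ≤ R) ∨ (R ≤ δ ∧ δ ≤ 0)) :
    Ahead (σ.greedy a b s R) (τ.step s δ)
      (p + (max ((σ.greedy a b s R).z - σ.z) 0 - max ((τ.step s δ).z - τ.z) 0))
      (q + (max (σ.z - (σ.greedy a b s R).z) 0 - max (τ.z - (τ.step s δ).z) 0)) := by
  rcases hδ with hδ | hδ
  · rw [step_nonneg hτ hδ.1] at hτ' ⊢
    have e2 : max (max a (σ.hi - s)) (min (min b (σ.lo + s)) (σ.z + R)) =
        min (min b (σ.lo + s)) (σ.z + R) := by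
      simp only [Valid, Within] at *; grind
    rw [greedy, e2]
    obtain ⟨z, lo, hi⟩ := σ
    obtain ⟨z', lo', hi'⟩ := τ
    simp only [track, Valid, Within, Ahead] at *
    have e3 : min lo (min (min b (lo + s)) (z + R)) = lo := by grind
    have e4 : max (z - min (min b (lo + s)) (z + R)) 0 = 0 := by grind
    have e5 : max (z' - min (lo' + s) (z' + δ)) 0 = 0 := by grind
    have e6 : max (min (min b (lo + s)) (z + R) - z) 0 = min (min b (lo + s)) (z + R) - z := by
      grind
    have e7 : max (min (lo' + s) (z' + δ) - z') 0 = min (lo' + s) (z' + δ) - z' := by grind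
    rw [e3, e4, e5, e6, e7]
    refine ⟨?_, ?_, ?_, ?_, ?_⟩ <;> grind
  · rw [step_nonpos hτ hδ.2] at hτ' ⊢
    have e2 : max (max a (σ.hi - s)) (min (min b (σ.lo + s)) (σ.z + R)) =
        max (max a (σ.hi - s)) (σ.z + R) := by
      simp only [Valid, Within] at *; grind
    rw [greedy, e2]
    obtain ⟨z, lo, hi⟩ := σ
    obtain ⟨z', lo', hi'⟩ := τ
    simp only [track, Valid, Within, Ahead] at *
    have e3 : max hi (max (max a (hi - s)) (z + R)) = hi := by grind
    have e4 : max (max (max a (hi - s)) (z + R) - z) 0 = 0 := by grind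
    have e5 : max (max (hi' - s) (z' + δ) - z') 0 = 0 := by grind
    have e6 : max (z - max (max a (hi - s)) (z + R)) 0 = z - max (max a (hi - s)) (z + R) := by
      grind
    have e7 : max (z' - max (hi' - s) (z' + δ)) 0 = z' - max (hi' - s) (z' + δ) := by grind
    rw [e3, e4, e5, e6, e7]
    refine ⟨?_, ?_, ?_, ?_, ?_⟩ <;> grind

end Band

/-! ### The same motions as sequences in time. -/

/-- The range-limited motion driven by a sequence of points. -/
def motion (s : ℝ) (x : ℕ → ℝ) : ℕ → Band
  | 0 => ⟨x 0, x 0, x 0⟩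
  | t + 1 => (motion s x t).step s (x (t + 1) - x t)

/-- The running point, minimum and maximum of a sequence. -/
def running (x : ℕ → ℝ) : ℕ → Band
  | 0 => ⟨x 0, x 0, x 0⟩
  | t + 1 => (running x t).track (x (t + 1))

/-- The greedy motion within `[a, b]` of range at most `s` that follows the instructions `R`. -/
def greedyMotion (a b s x₀ : ℝ) (R : ℕ → ℝ) : ℕ → Band
  | 0 => ⟨x₀, x₀, x₀⟩
  | t + 1 => (greedyMotion a b s x₀ R t).greedy a b s (R t)

def upMove (σ : ℕ → Band) (T : ℕ) : ℝ := ∑ t ∈ Finset.range T, max ((σ (t + 1)).z - (σ t).z) 0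

def downMove (σ : ℕ → Band) (T : ℕ) : ℝ := ∑ t ∈ Finset.range T, max ((σ t).z - (σ (t + 1)).z) 0

/-- The list of the values up to time `t`, the most recent one first. -/
def history (x : ℕ → ℝ) : ℕ → List ℝ
  | 0 => [x 0]
  | t + 1 => x (t + 1) :: history x t

theorem profile_reverse (x : ℕ → ℝ) (T : ℕ) :
    ((List.range (T + 1)).map x).reverse = history x T := by
  induction T with
  | zero => rfl
  | succ T ih => rw [List.range_succ, List.map_append, List.reverse_append, ih]; rfl

theorem profile_eq_cons (x : ℕ → ℝ) (T : ℕ) :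
    (List.range (T + 1)).map x = x 0 :: (List.range T).map (fun t => x (t + 1)) := by
  rw [List.range_succ_eq_map, List.map_cons, List.map_map]; rfl

theorem history_eq_cons (x : ℕ → ℝ) : ∀ t, ∃ l, history x t = x t :: l
  | 0 => ⟨[], rfl⟩
  | t + 1 => ⟨history x t, rfl⟩

theorem band_history (s : ℝ) (x : ℕ → ℝ) (t : ℕ) : band s (history x t) = motion s x t := by
  induction t with
  | zero => rfl
  | succ t ih =>
    obtain ⟨l, hl⟩ := history_eq_cons x t
    rw [history, motion, ← ih, hl, band_cons_cons]

theorem totalMove_history (α β s : ℝ) (x : ℕ → ℝ) (t : ℕ) :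
    totalMove α β s (history x t) =
      α * upMove (motion s x) t + β * downMove (motion s x) t := by
  induction t with
  | zero => simp [history, totalMove, upMove, downMove]
  | succ t ih =>
    obtain ⟨l, hl⟩ := history_eq_cons x t
    have h : totalMove α β s (history x (t + 1)) = totalMove α β s (history x t) +
        Band.move α β (motion s x t) (motion s x (t + 1)) := by
      rw [← band_history, ← band_history, history, hl, totalMove_cons_cons, band_cons_cons]
    rw [h, ih]
    simp only [upMove, downMove, Finset.sum_range_succ, Band.move]
    ring

theorem follows_motion {s : ℝ} (hs : 0 ≤ s) (x : ℕ → ℝ) (t : ℕ) :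
    Band.Follows s (running x t) (motion s x t) := by
  induction t with
  | zero => simp [running, motion, Band.Follows, Band.Valid, hs]
  | succ t ih =>
    have h := ih.step (x (t + 1))
    have e : (running x t).z = x t := by cases t <;> rfl
    rw [e] at h
    exact h

theorem within_motion {a b s : ℝ} (hs : 0 ≤ s) {x : ℕ → ℝ} {t : ℕ}
    (hx : ∀ i ≤ t, a ≤ x i ∧ x i ≤ b) : (motion s x t).Within a b := by
  induction t with
  | zero => exact hx 0 le_rfl
  | succ t ih =>
    have h := (ih fun i hi => hx i (by omega)).step (follows_motion hs x t) (hx (t + 1) le_rfl).1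
      (hx (t + 1) le_rfl).2
    have e : (running x t).z = x t := by cases t <;> rfl
    rw [e] at h
    exact h

theorem valid_greedyMotion {a b s x₀ : ℝ} (hs : 0 ≤ s) (ha : a ≤ x₀) (hb : x₀ ≤ b) (R : ℕ → ℝ)
    (t : ℕ) : (greedyMotion a b s x₀ R t).Valid s ∧ (greedyMotion a b s x₀ R t).Within a b := by
  induction t with
  | zero => exact ⟨by simp [greedyMotion, Band.Valid, hs], ha, hb⟩
  | succ t ih => exact ih.1.greedy ih.2 _

theorem running_greedyMotion (a b s x₀ : ℝ) (R : ℕ → ℝ) (t : ℕ) :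
    running (fun t => (greedyMotion a b s x₀ R t).z) t = greedyMotion a b s x₀ R t := by
  induction t with
  | zero => rfl
  | succ t ih => rw [running, ih]; rfl

theorem motion_greedyMotion {a b s u x₀ : ℝ} (hs : 0 ≤ s) (hsu : s ≤ u) (ha : a ≤ x₀)
    (hb : x₀ ≤ b) (R : ℕ → ℝ) (t : ℕ) :
    motion s (fun t => (greedyMotion a b u x₀ R t).z) t = greedyMotion a b s x₀ R t := by
  induction t with
  | zero => rfl
  | succ t ih =>
    have h1 := valid_greedyMotion (hs.trans hsu) ha hb R t
    have h2 := valid_greedyMotion hs ha hb R t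
    have h3 := follows_motion hs (fun t => (greedyMotion a b u x₀ R t).z) t
    rw [running_greedyMotion, ih] at h3
    rw [motion, ih]
    exact h3.step_greedy hsu h1.1 h1.2 h2.2 (R t)

/-- A path that goes no further than the instructions `R` and stays within `[a, b]`. -/
def Obeys (a b x₀ : ℝ) (R x : ℕ → ℝ) (T : ℕ) : Prop :=
  x 0 = x₀ ∧ ∀ t < T, ((0 ≤ x (t + 1) - x t ∧ x (t + 1) - x t ≤ R t) ∨
    (R t ≤ x (t + 1) - x t ∧ x (t + 1) - x t ≤ 0)) ∧ a ≤ x (t + 1) ∧ x (t + 1) ≤ b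

theorem Obeys.mem {a b x₀ : ℝ} {R x : ℕ → ℝ} {T : ℕ} (h : Obeys a b x₀ R x T) (ha : a ≤ x₀)
    (hb : x₀ ≤ b) {t : ℕ} (ht : t ≤ T) : a ≤ x t ∧ x t ≤ b := by
  cases t with
  | zero => rw [h.1]; exact ⟨ha, hb⟩
  | succ t => exact (h.2 t (by omega)).2

/-- The greedy motion of larger range has the larger movement in both directions, at every smaller
range to which both paths are limited. -/
theorem move_le_greedyMotion {a b s u x₀ : ℝ} (hs : 0 ≤ s) (hsu : s ≤ u) (ha : a ≤ x₀)
    (hb : x₀ ≤ b) {R x : ℕ → ℝ} {T : ℕ} (hx : Obeys a b x₀ R x T) :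
    upMove (motion s x) T ≤ upMove (motion s fun t => (greedyMotion a b u x₀ R t).z) T ∧
    downMove (motion s x) T ≤ downMove (motion s fun t => (greedyMotion a b u x₀ R t).z) T := by
  have e : (motion s fun t => (greedyMotion a b u x₀ R t).z) = greedyMotion a b s x₀ R :=
    funext (motion_greedyMotion hs hsu ha hb R)
  rw [e]
  have key : ∀ t ≤ T, Band.Ahead (greedyMotion a b s x₀ R t) (motion s x t)
      (upMove (greedyMotion a b s x₀ R) t - upMove (motion s x) t)
      (downMove (greedyMotion a b s x₀ R) t - downMove (motion s x) t) := by
    intro t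
    induction t with
    | zero =>
      intro _
      simp [Band.Ahead, greedyMotion, motion, upMove, downMove, hx.1]
    | succ t ih =>
      intro ht
      have h1 := valid_greedyMotion hs ha hb R t
      have h2 := (ih (by omega)).step (R := R t) (δ := x (t + 1) - x t) h1.1 h1.2
        (follows_motion hs x t).1 (within_motion (x := x) (t := t + 1) hs fun i hi => hx.mem ha hb (by omega))
        (hx.2 t (by omega)).1
      convert h2 using 1
      · rfl
      · rfl
      · simp only [upMove, Finset.sum_range_succ, greedyMotion, motion]; ring
      · simp only [downMove, Finset.sum_range_succ, greedyMotion, motion]; ring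
  have h := key T le_rfl
  exact ⟨by linarith [h.1], by linarith [h.2.1]⟩

/-- The two totals of the half cycles of a profile, cut off at depth `s`. -/
theorem rainflow_min_sum_profile {s : ℝ} (hs : 0 ≤ s) (x : ℕ → ℝ) (T : ℕ) :
    ((rainflow ((List.range (T + 1)).map x)).1.map fun d => min d s).sum =
      upMove (motion s x) T ∧
    ((rainflow ((List.range (T + 1)).map x)).2.map fun d => min d s).sum =
      downMove (motion s x) T := by
  have h1 := rainflow_min_sum 1 0 hs (x 0) ((List.range T).map fun t => x (t + 1))
  have h2 := rainflow_min_sum 0 1 hs (x 0) ((List.range T).map fun t => x (t + 1))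
  rw [← profile_eq_cons, profile_reverse, totalMove_history] at h1 h2
  exact ⟨by linarith, by linarith⟩

theorem motion_of_range_le {s : ℝ} {x : ℕ → ℝ} {T : ℕ}
    (hx : ∀ i ≤ T, ∀ j ≤ T, |x i - x j| ≤ s) : ∀ t ≤ T, (motion s x t).z = x t ∧
      (∃ i ≤ t, (motion s x t).lo = x i) ∧ ∃ i ≤ t, (motion s x t).hi = x i := by
  intro t
  induction t with
  | zero => exact fun _ => ⟨rfl, ⟨0, le_rfl, rfl⟩, 0, le_rfl, rfl⟩
  | succ t ih =>
    intro ht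
    obtain ⟨h1, ⟨i, hi, h2⟩, j, hj, h3⟩ := ih (by omega)
    have h4 := abs_le.1 (hx (t + 1) ht i (by omega))
    have h5 := abs_le.1 (hx (t + 1) ht j (by omega))
    have h6 : max (x j - s) (min (x i + s) (x t + (x (t + 1) - x t))) = x (t + 1) := by grind
    rw [motion]
    simp only [Band.step, h1, h2, h3, h6, true_and]
    constructor
    · rcases min_choice (x i) (x (t + 1)) with h | h
      · exact ⟨i, by omega, h⟩
      · exact ⟨t + 1, le_rfl, h⟩
    · rcases max_choice (x j) (x (t + 1)) with h | h
      · exact ⟨j, by omega, h⟩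
      · exact ⟨t + 1, le_rfl, h⟩

theorem rainflow_profile_depth_le {s : ℝ} {x : ℕ → ℝ} {T : ℕ}
    (hx : ∀ i ≤ T, ∀ j ≤ T, |x i - x j| ≤ s) :
    (∀ d ∈ (rainflow ((List.range (T + 1)).map x)).1, 0 ≤ d ∧ d ≤ s) ∧
      ∀ d ∈ (rainflow ((List.range (T + 1)).map x)).2, 0 ≤ d ∧ d ≤ s := by
  apply rainflow_depth_le
  intro y hy z hz
  obtain ⟨i, hi, rfl⟩ := List.mem_map.1 hy
  obtain ⟨j, hj, rfl⟩ := List.mem_map.1 hz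
  exact hx i (by simpa [Nat.lt_succ_iff] using hi) j (by simpa [Nat.lt_succ_iff] using hj)

theorem exists_range_bound (x : ℕ → ℝ) (T : ℕ) :
    ∃ s, 0 ≤ s ∧ ∀ i ≤ T, ∀ j ≤ T, |x i - x j| ≤ s := by
  refine ⟨∑ i ∈ Finset.range (T + 1), |x i| + ∑ i ∈ Finset.range (T + 1), |x i|,
    by positivity, fun i hi j hj => ?_⟩
  have h : ∀ i ≤ T, |x i| ≤ ∑ i ∈ Finset.range (T + 1), |x i| := fun i hi =>
    Finset.single_le_sum (f := fun i => |x i|) (fun _ _ => abs_nonneg _)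
      (Finset.mem_range.2 (by omega))
  exact (abs_sub _ _).trans (add_le_add (h i hi) (h j hj))

/-- The total depth of the charging half cycles is the total upward movement, and the same for
discharging. -/
theorem rainflow_sum_profile (x : ℕ → ℝ) (T : ℕ) :
    (rainflow ((List.range (T + 1)).map x)).1.sum =
      ∑ t ∈ Finset.range T, max (x (t + 1) - x t) 0 ∧
    (rainflow ((List.range (T + 1)).map x)).2.sum =
      ∑ t ∈ Finset.range T, max (x t - x (t + 1)) 0 := by
  -- With `s` at least the range of the profile, neither the cut-off of the depths nor the limit on
  -- the motion has any effect.
  obtain ⟨s, hs, hx⟩ := exists_range_bound x T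
  obtain ⟨h1, h2⟩ := rainflow_min_sum_profile hs x T
  obtain ⟨h3, h4⟩ := rainflow_profile_depth_le hx
  have h5 := motion_of_range_le hx
  have e : ∀ L : List ℝ, (∀ d ∈ L, 0 ≤ d ∧ d ≤ s) → (L.map fun d => min d s).sum = L.sum := by
    intro L hL
    congr 1
    conv_rhs => rw [← List.map_id L]
    exact List.map_congr_left fun d hd => by simp [(hL d hd).2]
  rw [e _ h3] at h1
  rw [e _ h4] at h2
  rw [h1, h2]
  constructor
  · refine Finset.sum_congr rfl fun t ht => ?_
    have := Finset.mem_range.1 ht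
    rw [(h5 t (by omega)).1, (h5 (t + 1) (by omega)).1]
  · refine Finset.sum_congr rfl fun t ht => ?_
    have := Finset.mem_range.1 ht
    rw [(h5 t (by omega)).1, (h5 (t + 1) (by omega)).1]

/-! ### From truncated sums to sums of concave functions. -/

/-- A concave nondecreasing function is, on finitely many points, a nonnegative combination of
functions `d ↦ min d s`. -/
theorem exists_min_combination (P : Finset ℝ) : (∀ x ∈ P, 0 ≤ x) → ∀ f : ℝ → ℝ,
    ConcaveOn ℝ (Set.Ici 0) f → f 0 = 0 →
    (∀ x ∈ insert 0 P, ∀ y ∈ insert 0 P, x ≤ y → f x ≤ f y) →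
    ∃ C : List (ℝ × ℝ), (∀ c ∈ C, 0 ≤ c.1 ∧ c.2 ∈ P) ∧
      ∀ d ∈ insert 0 P, f d = (C.map fun c => c.1 * min d c.2).sum := by
  induction P using Finset.induction_on_max with
  | empty =>
    intro _ f _ h0 _
    exact ⟨[], by simp, by simpa using h0⟩
  | insert m P hm ih =>
    intro hP f hf h0 hmono
    have hm0 : 0 ≤ m := hP m (by simp)
    have hP' : ∀ x ∈ P, 0 ≤ x := fun x hx => hP x (by simp [hx])
    rcases hm0.eq_or_lt with rfl | hmpos
    · refine ⟨[], by simp, ?_⟩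
      have : P = ∅ := Finset.eq_empty_of_forall_notMem fun x hx =>
        absurd (hm x hx) (not_lt.2 (hP' x hx))
      simpa [this] using h0
    · obtain ⟨m', hm', hmax⟩ := (insert 0 P).exists_max_image id ⟨0, by simp⟩
      simp only [id] at hmax
      have hm'0 : 0 ≤ m' := hmax 0 (by simp)
      have hm'm : m' < m := by
        rcases Finset.mem_insert.1 hm' with rfl | h
        · exact hmpos
        · exact hm _ h
      -- The slope on the last segment is the smallest one. Subtracting `σ * d` keeps `f` concave
      -- and, on the smaller points, nondecreasing; there `min d m` is just `d`. Monotonicity is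
      -- required only on the points because it may fail beyond them.
      set σ := (f m - f m') / (m - m') with hσ
      have hσ0 : 0 ≤ σ := div_nonneg (sub_nonneg.2 (hmono _ (by grind) _ (by grind) hm'm.le))
        (by linarith)
      have hσm : σ * (m - m') = f m - f m' := by
        rw [hσ]; field_simp [(by linarith : m - m' ≠ 0)]
      have hsl : ∀ x ∈ insert 0 P, ∀ y ∈ insert 0 P, x ≤ y → f x - σ * x ≤ f y - σ * y := by
        intro x hx y hy hxy
        rcases hxy.eq_or_lt with rfl | hxy
        · exact le_rfl
        have hx0 : 0 ≤ x := by
          rcases Finset.mem_insert.1 hx with rfl | h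
          · exact le_rfl
          · exact hP' _ h
        have h1 : σ ≤ (f y - f x) / (y - x) := by
          rcases (hmax y hy).eq_or_lt with rfl | hym
          · exact hf.slope_anti_adjacent (Set.mem_Ici.2 hx0) (Set.mem_Ici.2 hm0) hxy hm'm
          · exact (hf.slope_anti_adjacent (Set.mem_Ici.2 (hx0.trans hxy.le)) (Set.mem_Ici.2 hm0)
              hym hm'm).trans
              (hf.slope_anti_adjacent (Set.mem_Ici.2 hx0) (Set.mem_Ici.2 hm'0) hxy hym)
        rw [le_div_iff₀ (by linarith)] at h1
        linarith
      have hf' : ConcaveOn ℝ (Set.Ici 0) (fun x => f x - σ * x) := by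
        refine hf.sub ⟨convex_Ici 0, fun x _ y _ a b _ _ _ => le_of_eq ?_⟩
        simp only [smul_eq_mul]; ring
      obtain ⟨C, hC1, hC2⟩ := ih hP' _ hf' (by simp [h0]) hsl
      refine ⟨(σ, m) :: C, ?_, ?_⟩
      · intro c hc
        rcases List.mem_cons.1 hc with rfl | hc
        · exact ⟨hσ0, by simp⟩
        · exact ⟨(hC1 c hc).1, by simp [(hC1 c hc).2]⟩
      · intro d hd
        rw [List.map_cons, List.sum_cons]
        have hlow : ∀ d ∈ insert 0 P, f d = σ * min d m +
            (C.map fun c => c.1 * min d c.2).sum := by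
          intro d hd
          rw [← hC2 d hd, min_eq_left ((hmax d hd).trans hm'm.le)]
          ring
        rcases Finset.mem_insert.1 hd with rfl | hd
        · exact hlow _ (by simp)
        · rcases Finset.mem_insert.1 hd with rfl | hd
          · have h1 := hC2 m' hm'
            -- All cut-offs from the induction hypothesis are at most `m'`, so those terms are
            -- constant from `m'` on and the new term alone gives the increment up to `m`.
            have h2 : (C.map fun c => c.1 * min d c.2) = C.map fun c => c.1 * min m' c.2 := by
              refine List.map_congr_left fun c hc => ?_
              have h3 := hmax c.2 (by simp [(hC1 c hc).2])
              rw [min_eq_right h3, min_eq_right (h3.trans hm'm.le)]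
            rw [h2, ← h1, min_self]
            linarith
          · exact hlow _ (by simp [hd])

theorem sum_map_list_comm {ι : Type*} (C : List ι) (L : List ℝ) (g : ι → ℝ → ℝ) :
    (L.map fun d => (C.map fun c => g c d).sum).sum =
      (C.map fun c => (L.map fun d => g c d).sum).sum := by
  induction L with
  | nil => simp
  | cons a L ih => simp only [List.map_cons, List.sum_cons, ih, List.sum_map_add]

/-- If the sums of the depths cut off at every level compare, then so do the sums of every concave
nondecreasing function of the depths. -/
theorem sum_le_sum_of_min_sum_le {X Y : List ℝ} (hX : ∀ d ∈ X, 0 ≤ d) (hY : ∀ d ∈ Y, 0 ≤ d)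
    (h : ∀ s, 0 ≤ s → (X.map fun d => min d s).sum ≤ (Y.map fun d => min d s).sum)
    {f : ℝ → ℝ} (hf : ConcaveOn ℝ (Set.Ici 0) f) (h0 : f 0 = 0)
    (hm : MonotoneOn f (Set.Ici 0)) : (X.map f).sum ≤ (Y.map f).sum := by
  have hP : ∀ x ∈ (X ++ Y).toFinset, 0 ≤ x := by
    intro x hx
    rcases List.mem_append.1 (List.mem_toFinset.1 hx) with h | h
    · exact hX x h
    · exact hY x h
  have hP' : ∀ x ∈ insert 0 (X ++ Y).toFinset, 0 ≤ x := by
    intro x hx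
    rcases Finset.mem_insert.1 hx with rfl | h
    · exact le_rfl
    · exact hP x h
  obtain ⟨C, hC1, hC2⟩ := exists_min_combination _ hP f hf h0
    (fun x hx y hy hxy => hm (hP' x hx) (hP' y hy) hxy)
  have e : ∀ L : List ℝ, (∀ d ∈ L, d ∈ insert 0 (X ++ Y).toFinset) →
      (L.map f).sum = (C.map fun c => c.1 * (L.map fun d => min d c.2).sum).sum := by
    intro L hL
    rw [List.map_congr_left (fun d hd => hC2 d (hL d hd)), sum_map_list_comm]
    simp only [List.sum_map_mul_left]
  rw [e X (by intro d hd; simp [hd]), e Y (by intro d hd; simp [hd])]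
  exact List.sum_le_sum fun c hc =>
    mul_le_mul_of_nonneg_left (h c.2 (hP _ (hC1 c hc).2)) (hC1 c hc).1

theorem ConvexOn.antitoneOn_of_isMin {h : ℝ → ℝ} (hh : ConvexOn ℝ (Set.Ici 0) h) {u : ℝ}
    (hu : 0 ≤ u) (hmin : ∀ d, 0 ≤ d → h u ≤ h d) {x y : ℝ} (hx : 0 ≤ x) (hxy : x ≤ y)
    (hy : y ≤ u) : h y ≤ h x := by
  have h1 := hh.le_max_of_mem_Icc (Set.mem_Ici.2 hx) (Set.mem_Ici.2 hu) ⟨hxy, hy⟩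
  rwa [max_eq_left (hmin x hx)] at h1

/-- Truncation at `u` is concave and `h` is convex and nonincreasing on `[0, u]`. This is the test
function for `sum_le_sum_of_min_sum_le`: comparing depths beyond `u` is thereby avoided. -/
theorem concaveOn_neg_min {h : ℝ → ℝ} (hh : ConvexOn ℝ (Set.Ici 0) h) {u : ℝ}
    (hu : 0 ≤ u) (hmin : ∀ d, 0 ≤ d → h u ≤ h d) :
    ConcaveOn ℝ (Set.Ici 0) (fun d => -h (min d u)) := by
  refine ⟨convex_Ici 0, fun x hx y hy a b ha hb hab => ?_⟩
  simp only [smul_eq_mul, Set.mem_Ici] at *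
  have h1 : a * min x u + b * min y u ≤ min (a * x + b * y) u := by
    refine le_min (add_le_add (mul_le_mul_of_nonneg_left (min_le_left _ _) ha)
      (mul_le_mul_of_nonneg_left (min_le_left _ _) hb)) ?_
    calc a * min x u + b * min y u ≤ a * u + b * u :=
          add_le_add (mul_le_mul_of_nonneg_left (min_le_right _ _) ha)
            (mul_le_mul_of_nonneg_left (min_le_right _ _) hb)
      _ = u := by rw [← add_mul, hab, one_mul]
  have hx' : 0 ≤ min x u := le_min hx hu
  have hy' : 0 ≤ min y u := le_min hy hu
  have h2 := ConvexOn.antitoneOn_of_isMin hh hu hmin (by positivity) h1 (min_le_right _ _)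
  have h3 := hh.2 (Set.mem_Ici.2 hx') (Set.mem_Ici.2 hy') ha hb hab
  simp only [smul_eq_mul] at h3
  linarith

/-! ### The gap inequality for two families of half cycles. -/

/-- The half cycles balance up to one half cycle. -/
def Balanced (U D : List ℝ) : Prop :=
  ∀ (k : ℝ → ℝ) (C : ℝ), MonotoneOn k (Set.Ici 0) → (∀ d, 0 ≤ d → 0 ≤ k d) →
    (∀ d, 0 ≤ d → k d ≤ C) → |(U.map k).sum - (D.map k).sum| ≤ C

theorem sum_map_sub' (L : List ℝ) (f g : ℝ → ℝ) :
    (L.map fun d => f d - g d).sum = (L.map f).sum - (L.map g).sum := by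
  induction L with
  | nil => simp
  | cons a L ih => simp only [List.map_cons, List.sum_cons, ih]; ring

theorem sum_map_neg' (L : List ℝ) (f : ℝ → ℝ) :
    (L.map fun d => -f d).sum = -(L.map f).sum := by
  induction L with
  | nil => simp
  | cons a L ih => simp only [List.map_cons, List.sum_cons, ih]; ring

/-- The contribution of the depths up to `u`. -/
theorem shallow_gap {h : ℝ → ℝ} (hh : ConvexOn ℝ (Set.Ici 0) h) (h0 : h 0 = 0) {u v lam : ℝ}
    (hu : 0 ≤ u) (hlam : 0 ≤ lam) (humin : ∀ d, 0 ≤ d → h u ≤ h d)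
    (hvmin : ∀ d, 0 ≤ d → h v + lam * v ≤ h d + lam * d) {Yu Yd Xu Xd : List ℝ}
    (hYu : ∀ d ∈ Yu, 0 ≤ d ∧ d ≤ u) (hYd : ∀ d ∈ Yd, 0 ≤ d ∧ d ≤ u)
    (hXu : ∀ d ∈ Xu, 0 ≤ d) (hXd : ∀ d ∈ Xd, 0 ≤ d)
    (hU : ∀ s, 0 ≤ s → s ≤ u → (Xu.map fun d => min d s).sum ≤ (Yu.map fun d => min d s).sum)
    (hD : ∀ s, 0 ≤ s → s ≤ u → (Xd.map fun d => min d s).sum ≤ (Yd.map fun d => min d s).sum)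
    (hX : Balanced Xu Xd) (hY : Balanced Yu Yd) :
    (Yu.map h).sum + (Yd.map h).sum +
      lam * ((Yu.map fun d => min d u).sum - (Yd.map fun d => min d u).sum -
        (Xu.map fun d => min d u).sum + (Xd.map fun d => min d u).sum) ≤
    (Xu.map fun d => h (min d u)).sum + (Xd.map fun d => h (min d u)).sum +
      2 * (h u + lam * u) - 2 * (h v + lam * v) := by
  set Δ := (Yu.map fun d => min d u).sum - (Yd.map fun d => min d u).sum -
        (Xu.map fun d => min d u).sum + (Xd.map fun d => min d u).sum with hΔ
  -- The layer `min d u - min d s` is monotone in `d` with values in `[0, u - s]`, so balance bounds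
  -- its net contribution.
  have hk : ∀ s, 0 ≤ s → s ≤ u → ∀ A B : List ℝ, Balanced A B →
      |((A.map fun d => min d u).sum - (A.map fun d => min d s).sum) -
        ((B.map fun d => min d u).sum - (B.map fun d => min d s).sum)| ≤ u - s := by
    intro s hs hsu A B hAB
    have := hAB (fun d => min d u - min d s) (u - s) (by
      intro x hx y hy hxy
      simp only [Set.mem_Ici] at *
      grind) (by intro d hd; grind) (by intro d hd; grind)
    rwa [sum_map_sub', sum_map_sub'] at this
  have hz : ∀ A : List ℝ, (∀ d ∈ A, 0 ≤ d) → (A.map fun d => min d 0).sum = 0 := by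
    intro A hA
    rw [List.map_congr_left (g := fun _ => (0 : ℝ)) (fun d hd => min_eq_right (hA d hd))]
    simp
  have hΔu : Δ ≤ 2 * u := by
    have h1 := abs_le.1 (hk 0 le_rfl hu _ _ hX)
    have h2 := abs_le.1 (hk 0 le_rfl hu _ _ hY)
    rw [hz _ hXu, hz _ hXd] at h1
    rw [hz _ (fun d hd => (hYu d hd).1), hz _ (fun d hd => (hYd d hd).1)] at h2
    linarith [h1.1, h2.2]
  -- The depth at which the linear term is paid for exactly: `lam * Δ ≤ 2 * lam * (u - q)`. It lies
  -- in `[0, u]` because balance gives `Δ ≤ 2 * u`.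
  set q := u - max Δ 0 / 2 with hq
  have hq0 : 0 ≤ q := by
    have : max Δ 0 ≤ 2 * u := max_le hΔu (by linarith)
    linarith
  have hqu : q ≤ u := by
    have : 0 ≤ max Δ 0 := le_max_right _ _
    linarith
  -- A positive `Δ` forces surplus movement of `Y`. Passing from level `u` to level `s` changes the
  -- net surplus by at most `2 * (u - s)`, so at least `Δ - 2 * (u - s) = 2 * (s - q)` is left. This
  -- makes room for two extra depths `u` in `X` against two depths `q` in `Y`.
  have hlevel : ∀ s, 0 ≤ s → s ≤ u →
      (Xu.map fun d => min d s).sum + (Xd.map fun d => min d s).sum + 2 * s ≤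
      (Yu.map fun d => min d s).sum + (Yd.map fun d => min d s).sum + 2 * min q s := by
    intro s hs hsu
    have h1 := hU s hs hsu
    have h2 := hD s hs hsu
    rcases le_total s q with hsq | hsq
    · rw [min_eq_right hsq]; linarith
    · rw [min_eq_left hsq]
      have h3 := abs_le.1 (hk s hs hsu _ _ hX)
      have h4 := abs_le.1 (hk s hs hsu _ _ hY)
      rcases le_total Δ 0 with hΔ0 | hΔ0
      · rw [max_eq_right hΔ0] at hq; linarith
      · rw [max_eq_left hΔ0] at hq; linarith [h3.1, h4.2]
  have hcut : ∀ (A : List ℝ) (s : ℝ), ((A.map fun d => min d u).map fun d => min d s).sum =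
      (A.map fun d => min d (min s u)).sum := by
    intro A s
    rw [List.map_map]
    congr 1
    refine List.map_congr_left fun d _ => ?_
    simp only [Function.comp_apply]
    rw [min_assoc, min_comm u s]
  have hcut' : ∀ (A : List ℝ) (s : ℝ), (∀ d ∈ A, 0 ≤ d ∧ d ≤ u) →
      (A.map fun d => min d s).sum = (A.map fun d => min d (min s u)).sum := by
    intro A s hA
    congr 1
    refine List.map_congr_left fun d hd => ?_
    have := (hA d hd).2
    grind
  -- Applied to `-h (min d u)`, the padded comparison bounds the excess of the `h`-cost by `2 * h u
  -- - 2 * h q`; the minimality of `v` for `h d + lam * d` finishes the estimate.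
  have hlayer := sum_le_sum_of_min_sum_le
    (X := (Xu.map fun d => min d u) ++ (Xd.map fun d => min d u) ++ [u, u])
    (Y := Yu ++ Yd ++ [q, q]) (by
      intro d hd
      simp only [List.mem_append, List.mem_map, List.mem_cons, List.not_mem_nil, or_false] at hd
      rcases hd with (⟨x, hx, rfl⟩ | ⟨x, hx, rfl⟩) | rfl | rfl
      · exact le_min (hXu x hx) hu
      · exact le_min (hXd x hx) hu
      · exact hu
      · exact hu) (by
      intro d hd
      simp only [List.mem_append, List.mem_cons, List.not_mem_nil, or_false] at hd
      rcases hd with (hd | hd) | rfl | rfl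
      · exact (hYu d hd).1
      · exact (hYd d hd).1
      · exact hq0
      · exact hq0) (by
      intro s hs
      simp only [List.map_append, List.sum_append]
      rw [hcut, hcut, hcut' _ _ hYu, hcut' _ _ hYd]
      have h1 := hlevel (min s u) (le_min hs hu) (min_le_right _ _)
      have h2 : min q (min s u) = min q s := by grind
      rw [h2] at h1
      simp only [List.map_cons, List.map_nil, List.sum_cons, List.sum_nil]
      rw [min_comm u s]
      linarith)
    (concaveOn_neg_min hh hu humin) (by simp [hu, h0]) (by
      intro x hx y hy hxy
      simp only [Set.mem_Ici] at hx hy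
      simp only [neg_le_neg_iff]
      exact ConvexOn.antitoneOn_of_isMin hh hu humin (le_min hx hu) (min_le_min_right u hxy)
        (min_le_right _ _))
  have hYh : ∀ A : List ℝ, (∀ d ∈ A, 0 ≤ d ∧ d ≤ u) →
      (A.map fun d => -h (min d u)).sum = -(A.map h).sum := by
    intro A hA
    rw [sum_map_neg']
    congr 2
    exact List.map_congr_left fun d hd => by rw [min_eq_left (hA d hd).2]
  have hXh : ∀ A : List ℝ, ((A.map fun d => min d u).map fun d => -h (min d u)).sum =
      -(A.map fun d => h (min d u)).sum := by
    intro A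
    rw [List.map_map, ← sum_map_neg']
    congr 1
    refine List.map_congr_left fun d _ => ?_
    simp
  simp only [List.map_append, List.sum_append, List.map_cons, List.map_nil, List.sum_cons,
    List.sum_nil] at hlayer
  rw [hXh, hXh, hYh _ hYu, hYh _ hYd, min_self, min_eq_left hqu] at hlayer
  have hv := hvmin q hq0
  have hΔq : lam * Δ ≤ lam * (2 * (u - q)) := by
    apply mul_le_mul_of_nonneg_left _ hlam
    have := le_max_left Δ 0
    linarith
  linarith

/-- The contribution of the depths beyond `u`. -/
theorem deep_gap {h : ℝ → ℝ} (hh : ConvexOn ℝ (Set.Ici 0) h) {u w lam : ℝ}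
    (hu : 0 ≤ u) (huw : u ≤ w) (hlam : 0 ≤ lam) (humin : ∀ d, 0 ≤ d → h u ≤ h d)
    (hwmin : ∀ d, 0 ≤ d → h w - lam * w ≤ h d - lam * d) {Xu Xd : List ℝ}
    (hX : Balanced Xu Xd) :
    (h w - lam * w) - (h u - lam * u) ≤
      (Xu.map fun d => h d - h (min d u) + lam * (d - min d u)).sum +
      (Xd.map fun d => h d - h (min d u) - lam * (d - min d u)).sum := by
  have hG : ConvexOn ℝ (Set.Ici 0) (fun d => h d - lam * d) := by
    refine hh.sub ⟨convex_Ici 0, fun x _ y _ a b _ _ _ => le_of_eq ?_⟩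
    simp only [smul_eq_mul]; ring
  have hanti : ∀ x y, 0 ≤ x → x ≤ y → y ≤ w → h y - lam * y ≤ h x - lam * x := fun x y hx hxy hy =>
    ConvexOn.antitoneOn_of_isMin hG (hu.trans huw) hwmin hx hxy hy
  have hm : ∀ d, u ≤ max u (min d w) ∧ max u (min d w) ≤ w := fun d =>
    ⟨le_max_left _ _, max_le huw (min_le_right _ _)⟩
  -- The test function is the drop of `h d - lam * d` below its value at `u`, with `d` clamped to
  -- `[u, w]`. Its negative bounds each discharging term from below, while it itself bounds each
  -- charging term from below, so balance leaves at most one full drop.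
  have hb := hX (fun d => (h u - lam * u) - (h (max u (min d w)) - lam * max u (min d w)))
    ((h u - lam * u) - (h w - lam * w)) (by
      intro x hx y hy hxy
      have := hanti (max u (min x w)) (max u (min y w)) (hu.trans (hm x).1)
        (max_le_max le_rfl (min_le_min_right w hxy)) (hm y).2
      simp only
      linarith) (by
      intro d _
      have := hanti u (max u (min d w)) hu (hm d).1 (hm d).2
      linarith) (by
      intro d _
      have := hwmin (max u (min d w)) (hu.trans (hm d).1)
      linarith)
  have h1 : (Xu.map fun d => (h u - lam * u) -
      (h (max u (min d w)) - lam * max u (min d w))).sum ≤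
      (Xu.map fun d => h d - h (min d u) + lam * (d - min d u)).sum := by
    refine List.sum_le_sum fun d hd => ?_
    rcases le_total d u with hdu | hdu
    · rw [min_eq_left hdu, max_eq_left ((min_le_left _ _).trans hdu)]
      linarith
    · rw [min_eq_right hdu]
      have h2 := humin d (hu.trans hdu)
      have h3 := humin (max u (min d w)) (hu.trans (hm d).1)
      have h4 : lam * max u (min d w) ≤ lam * d :=
        mul_le_mul_of_nonneg_left (max_le hdu (min_le_left _ _)) hlam
      linarith
  have h5 : -(Xd.map fun d => (h u - lam * u) -
      (h (max u (min d w)) - lam * max u (min d w))).sum ≤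
      (Xd.map fun d => h d - h (min d u) - lam * (d - min d u)).sum := by
    rw [← sum_map_neg']
    refine List.sum_le_sum fun d hd => ?_
    rcases le_total d u with hdu | hdu
    · rw [min_eq_left hdu, max_eq_left ((min_le_left _ _).trans hdu)]
      linarith
    · rw [min_eq_right hdu]
      rcases le_total d w with hdw | hdw
      · rw [min_eq_left hdw, max_eq_right hdu]
        linarith
      · rw [min_eq_right hdw, max_eq_right huw]
        have := hwmin d (hu.trans hdu)
        linarith
  have h6 := (abs_le.1 hb).1
  linarith

/-- The cost of the half cycles `Yu`, `Yd` exceeds that of `Xu`, `Xd` by at most the worst-case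
gap, when discharging is worth at least as much as charging. -/
theorem halfCycle_gap_le {f g h : ℝ → ℝ} {lam : ℝ} (hlam : 0 ≤ lam)
    (hh : ConvexOn ℝ (Set.Ici 0) h) (h0 : h 0 = 0)
    (hf : ∀ d, f d = h d + lam * d) (hg : ∀ d, g d = h d - lam * d) {u v w : ℝ}
    (hu : 0 ≤ u) (huw : u ≤ w)
    (humin : ∀ d, 0 ≤ d → f u + g u ≤ f d + g d) (hvmin : ∀ d, 0 ≤ d → f v ≤ f d)
    (hwmin : ∀ d, 0 ≤ d → g w ≤ g d) {Yu Yd Xu Xd : List ℝ}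
    (hYu : ∀ d ∈ Yu, 0 ≤ d ∧ d ≤ u) (hYd : ∀ d ∈ Yd, 0 ≤ d ∧ d ≤ u)
    (hXu : ∀ d ∈ Xu, 0 ≤ d) (hXd : ∀ d ∈ Xd, 0 ≤ d)
    (hU : ∀ s, 0 ≤ s → s ≤ u → (Xu.map fun d => min d s).sum ≤ (Yu.map fun d => min d s).sum)
    (hD : ∀ s, 0 ≤ s → s ≤ u → (Xd.map fun d => min d s).sum ≤ (Yd.map fun d => min d s).sum)
    (hX : Balanced Xu Xd) (hY : Balanced Yu Yd) :
    (Yu.map f).sum + (Yd.map g).sum - ((Xu.map f).sum + (Xd.map g).sum) ≤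
      g u + 2 * f u - g w - 2 * f v := by
  obtain rfl : f = fun d => h d + lam * d := funext hf
  obtain rfl : g = fun d => h d - lam * d := funext hg
  simp only at humin hvmin hwmin ⊢
  have hu' : ∀ d, 0 ≤ d → h u ≤ h d := fun d hd => by linarith [humin d hd]
  -- Every competing depth is split at `u` into `min d u` and the remainder; the policy has no
  -- remainder.
  have h1 := shallow_gap hh h0 hu hlam hu' hvmin hYu hYd hXu hXd hU hD hX hY
  have h2 := deep_gap hh hu huw hlam hu' hwmin hX
  have e1 : ∀ A : List ℝ, (A.map fun d => h d - h (min d u) + lam * (d - min d u)).sum =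
      (A.map h).sum - (A.map fun d => h (min d u)).sum +
        lam * (A.sum - (A.map fun d => min d u).sum) := by
    intro A
    induction A with
    | nil => simp
    | cons a A ih => simp only [List.map_cons, List.sum_cons, ih]; ring
  have e2 : ∀ A : List ℝ, (A.map fun d => h d - h (min d u) - lam * (d - min d u)).sum =
      (A.map h).sum - (A.map fun d => h (min d u)).sum -
        lam * (A.sum - (A.map fun d => min d u).sum) := by
    intro A
    induction A with
    | nil => simp
    | cons a A ih => simp only [List.map_cons, List.sum_cons, ih]; ring
  have e3 : ∀ A : List ℝ, (A.map fun d => h d + lam * d).sum = (A.map h).sum + lam * A.sum := by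
    intro A
    induction A with
    | nil => simp
    | cons a A ih => simp only [List.map_cons, List.sum_cons, ih]; ring
  have e4 : ∀ A : List ℝ, (A.map fun d => h d - lam * d).sum = (A.map h).sum - lam * A.sum := by
    intro A
    induction A with
    | nil => simp
    | cons a A ih => simp only [List.map_cons, List.sum_cons, ih]; ring
  have e5 : ∀ A : List ℝ, (∀ d ∈ A, 0 ≤ d ∧ d ≤ u) → (A.map fun d => min d u).sum = A.sum := by
    intro A hA
    congr 1
    conv_rhs => rw [← List.map_id A]
    exact List.map_congr_left fun d hd => by simp [(hA d hd).2]
  rw [e5 _ hYu, e5 _ hYd] at h1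
  rw [e1, e2] at h2
  rw [e3, e3, e4, e4]
  linarith

theorem greedyMotion_mem {a b s x₀ : ℝ} (R : ℕ → ℝ) (t : ℕ) : ∀ i ≤ t,
    (greedyMotion a b s x₀ R t).lo ≤ (greedyMotion a b s x₀ R i).z ∧
      (greedyMotion a b s x₀ R i).z ≤ (greedyMotion a b s x₀ R t).hi := by
  induction t with
  | zero =>
    intro i hi
    obtain rfl : i = 0 := by omega
    exact ⟨le_rfl, le_rfl⟩
  | succ t ih =>
    intro i hi
    rcases Nat.lt_or_ge t i with h | h
    · obtain rfl : i = t + 1 := by omega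
      exact ⟨min_le_right _ _, le_max_right _ _⟩
    · exact ⟨(min_le_left _ _).trans (ih i h).1, (ih i h).2.trans (le_max_left _ _)⟩

theorem greedyMotion_range_le {a b s x₀ : ℝ} (hs : 0 ≤ s) (ha : a ≤ x₀) (hb : x₀ ≤ b)
    (R : ℕ → ℝ) (T : ℕ) : ∀ i ≤ T, ∀ j ≤ T,
      |(greedyMotion a b s x₀ R i).z - (greedyMotion a b s x₀ R j).z| ≤ s := by
  intro i hi j hj
  have h1 := greedyMotion_mem (a := a) (b := b) (s := s) (x₀ := x₀) R T i hi
  have h2 := greedyMotion_mem (a := a) (b := b) (s := s) (x₀ := x₀) R T j hj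
  have h3 := (valid_greedyMotion hs ha hb R T).1.2.2
  rw [abs_le]
  constructor <;> linarith

theorem balanced_profile (x : ℕ → ℝ) (T : ℕ) :
    Balanced (rainflow ((List.range (T + 1)).map x)).1
      (rainflow ((List.range (T + 1)).map x)).2 := by
  intro k C hk h0 hC
  rw [profile_eq_cons]
  exact rainflow_balance hk h0 hC _ _

theorem Balanced.symm {U D : List ℝ} (h : Balanced U D) : Balanced D U := by
  intro k C hk h0 hC
  rw [abs_sub_comm]
  exact h k C hk h0 hC

end Rainflow

/-! ### The threshold policy as greedy motion, and the upper bound on the gap. -/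

namespace Battery

open Rainflow

/-- The change of the state of charge asked for by an instruction. -/
def disp (b : Battery) (r : ℝ) : ℝ :=
  if 0 ≤ r then b.τ * b.ηc / b.E * r else b.τ / (b.ηd * b.E) * r

/-- The signs of the parameters. -/
structure Regular (b : Battery) : Prop where
  E : 0 < b.E
  τ : 0 < b.τ
  B : 0 < b.B
  ηc : 0 < b.ηc
  ηd : 0 < b.ηd
  P : 0 < b.P

theorem disp_of_nonneg {b : Battery} {r : ℝ} (h : 0 ≤ r) : b.disp r = b.τ * b.ηc / b.E * r :=
  if_pos h

theorem disp_of_neg {b : Battery} {r : ℝ} (h : r < 0) : b.disp r = b.τ / (b.ηd * b.E) * r :=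
  if_neg (not_le.2 h)

section
variable {b : Battery}

theorem Regular.up_pos (hb : b.Regular) : 0 < b.τ * b.ηc / b.E :=
  div_pos (mul_pos hb.τ hb.ηc) hb.E

theorem Regular.down_pos (hb : b.Regular) : 0 < b.τ / (b.ηd * b.E) :=
  div_pos hb.τ (mul_pos hb.ηd hb.E)

theorem Regular.up_inv (hb : b.Regular) (y : ℝ) :
    b.τ * b.ηc / b.E * (b.E / (b.τ * b.ηc) * y) = y := by
  have := hb.E.ne'; have := hb.τ.ne'; have := hb.ηc.ne'
  field_simp

theorem Regular.down_inv (hb : b.Regular) (y : ℝ) :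
    b.τ / (b.ηd * b.E) * (b.E * b.ηd / b.τ * y) = y := by
  have := hb.E.ne'; have := hb.τ.ne'; have := hb.ηd.ne'
  field_simp

theorem policyNext_eq (hb : b.Regular) {u : ℝ} {s : PolicyState} {σ : Band} (hz : s.x = σ.z)
    (hhi : s.xmax = σ.hi) (hlo : s.xmin = σ.lo) (hv : σ.Valid u) (hw : σ.Within b.xlo b.xhi)
    (r : ℝ) : b.policyNext u s r = (σ.greedy b.xlo b.xhi u (b.disp r)).z := by
  have e : (σ.greedy b.xlo b.xhi u (b.disp r)).z =
    max (max b.xlo (σ.hi - u)) (min (min b.xhi (σ.lo + u)) (σ.z + b.disp r)) := rfl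
  rw [e, policyNext, policyCharge, policyDischarge, hz, hhi, hlo]
  simp only [Band.Valid, Band.Within] at hv hw
  rcases le_or_gt 0 r with hr | hr
  · rw [if_pos hr, if_pos hr, mul_min_of_nonneg _ _ hb.up_pos.le, hb.up_inv, ← disp_of_nonneg hr]
    have : 0 ≤ b.disp r := by
      rw [disp_of_nonneg hr]; exact mul_nonneg hb.up_pos.le hr
    grind
  · rw [if_neg (not_le.2 hr), if_neg (not_le.2 hr), mul_min_of_nonneg _ _ hb.down_pos.le,
      hb.down_inv, mul_neg, ← disp_of_neg hr]
    have : b.disp r ≤ 0 := by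
      rw [disp_of_neg hr]; exact mul_nonpos_of_nonneg_of_nonpos hb.down_pos.le hr.le
    grind

/-- The path of the threshold policy. -/
def path (b : Battery) (u x₀ : ℝ) (r : ℕ → ℝ) : ℕ → Band :=
  greedyMotion b.xlo b.xhi u x₀ fun t => b.disp (r t)

theorem policyState_eq (hb : b.Regular) {u x₀ : ℝ} (hu : 0 ≤ u) (hlo : b.xlo ≤ x₀)
    (hhi : x₀ ≤ b.xhi) (r : ℕ → ℝ) (t : ℕ) :
    (b.policyState u x₀ r t).x = (b.path u x₀ r t).z ∧
    (b.policyState u x₀ r t).xmax = (b.path u x₀ r t).hi ∧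
    (b.policyState u x₀ r t).xmin = (b.path u x₀ r t).lo := by
  induction t with
  | zero => exact ⟨rfl, rfl, rfl⟩
  | succ t ih =>
    have h := valid_greedyMotion hu hlo hhi (fun t => b.disp (r t)) t
    have h1 := policyNext_eq hb ih.1 ih.2.1 ih.2.2 h.1 h.2 (r t)
    simp only [policyState]
    rw [h1, ih.2.1, ih.2.2]
    exact ⟨rfl, rfl, rfl⟩

theorem soc_policy (u x₀ : ℝ) (r : ℕ → ℝ) (t : ℕ) :
    b.soc x₀ (fun t => b.policyCharge u (b.policyState u x₀ r t) (r t))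
      (fun t => b.policyDischarge u (b.policyState u x₀ r t) (r t)) t =
    (b.policyState u x₀ r t).x := by
  induction t with
  | zero => rfl
  | succ t ih => rw [soc, ih]; rfl

theorem soc_policy_eq (hb : b.Regular) {u x₀ : ℝ} (hu : 0 ≤ u) (hlo : b.xlo ≤ x₀)
    (hhi : x₀ ≤ b.xhi) (r : ℕ → ℝ) :
    b.soc x₀ (fun t => b.policyCharge u (b.policyState u x₀ r t) (r t))
      (fun t => b.policyDischarge u (b.policyState u x₀ r t) (r t)) =
    fun t => (b.path u x₀ r t).z :=
  funext fun t => by rw [soc_policy, (policyState_eq hb hu hlo hhi r t).1]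

theorem feasible_policy (hb : b.Regular) {u x₀ : ℝ} (hu : 0 ≤ u) (hlo : b.xlo ≤ x₀)
    (hhi : x₀ ≤ b.xhi) {r : ℕ → ℝ} {T : ℕ} (hr : ∀ t < T, |r t| ≤ b.P) :
    b.Feasible x₀ T r (fun t => b.policyCharge u (b.policyState u x₀ r t) (r t))
      (fun t => b.policyDischarge u (b.policyState u x₀ r t) (r t)) := by
  intro t ht
  have hP := abs_le.1 (hr t ht)
  rw [soc_policy_eq hb hu hlo hhi]
  have h' := valid_greedyMotion hu hlo hhi (fun t => b.disp (r t)) (t + 1)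
  have h := valid_greedyMotion hu hlo hhi (fun t => b.disp (r t)) t
  obtain ⟨e1, e2, e3⟩ := policyState_eq hb hu hlo hhi r t
  have hc : 0 < b.E / (b.τ * b.ηc) := div_pos hb.E (mul_pos hb.τ hb.ηc)
  have hd : 0 < b.E * b.ηd / b.τ := div_pos (mul_pos hb.E hb.ηd) hb.τ
  have hP0 := hb.P
  change _ ∧ _ ∧ _ ≤ (greedyMotion b.xlo b.xhi u x₀ (fun t => b.disp (r t)) (t + 1)).z ∧
    (greedyMotion b.xlo b.xhi u x₀ (fun t => b.disp (r t)) (t + 1)).z ≤ _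
  simp only [policyCharge, policyDischarge, e1, e2, e3, path]
  simp only [Band.Valid, Band.Within] at h h'
  refine ⟨?_, ?_, by linarith [h'.1.1, h'.2.1], by linarith [h'.1.2.1, h'.2.2]⟩
  · split_ifs with h0
    · refine ⟨le_min (mul_nonneg hc.le ?_) h0, (min_le_right _ _).trans hP.2,
        (min_le_right _ _).trans (le_max_left _ _)⟩
      grind
    · exact ⟨le_rfl, hP0.le, le_max_right _ _⟩
  · split_ifs with h0
    · exact ⟨le_rfl, hP0.le, le_max_right _ _⟩
    · refine ⟨le_min (mul_nonneg hd.le ?_) (by linarith),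
        (min_le_right _ _).trans (by linarith [hP.1]), (min_le_right _ _).trans (le_max_left _ _)⟩
      grind

theorem Feasible.obeys (hb : b.Regular) {x₀ : ℝ} {T : ℕ} {r c d : ℕ → ℝ}
    (h : b.Feasible x₀ T r c d) :
    Obeys b.xlo b.xhi x₀ (fun t => b.disp (r t)) (b.soc x₀ c d) T := by
  refine ⟨rfl, fun t ht => ⟨?_, (h t ht).2.2⟩⟩
  obtain ⟨⟨h1, -, h2⟩, ⟨h3, -, h4⟩, -⟩ := h t ht
  have e : b.soc x₀ c d (t + 1) - b.soc x₀ c d t =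
      b.τ * b.ηc / b.E * c t - b.τ / (b.ηd * b.E) * d t := by rw [soc]; ring
  rw [e]
  have hu := hb.up_pos
  have hd := hb.down_pos
  rcases le_or_gt 0 (r t) with hr | hr
  · rw [max_eq_right (by linarith)] at h4
    rw [max_eq_left hr] at h2
    have : d t = 0 := le_antisymm h4 h3
    left
    beta_reduce
    rw [disp_of_nonneg hr, this, mul_zero, sub_zero]
    exact ⟨by positivity, mul_le_mul_of_nonneg_left h2 hu.le⟩
  · rw [max_eq_left (by linarith)] at h4
    rw [max_eq_right hr.le] at h2
    have : c t = 0 := le_antisymm h2 h1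
    right
    beta_reduce
    rw [disp_of_neg hr, this, mul_zero, zero_sub]
    have := mul_le_mul_of_nonneg_left h4 hd.le
    exact ⟨by linarith, by linarith [mul_nonneg hd.le h3]⟩

/-- Every path that obeys the instructions is the state of charge of an admissible operation. -/
theorem exists_feasible (hb : b.Regular) {x₀ : ℝ} {T : ℕ} {r x : ℕ → ℝ}
    (hr : ∀ t < T, |r t| ≤ b.P)
    (h : Obeys b.xlo b.xhi x₀ (fun t => b.disp (r t)) x T) :
    ∃ c d, b.Feasible x₀ T r c d ∧ ∀ t ≤ T, b.soc x₀ c d t = x t := by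
  set c : ℕ → ℝ := fun t =>
    if 0 ≤ r t then b.E / (b.τ * b.ηc) * (x (t + 1) - x t) else 0 with hc
  set d : ℕ → ℝ := fun t =>
    if 0 ≤ r t then 0 else b.E * b.ηd / b.τ * (x t - x (t + 1)) with hd
  have hcp : 0 < b.E / (b.τ * b.ηc) := div_pos hb.E (mul_pos hb.τ hb.ηc)
  have hdp : 0 < b.E * b.ηd / b.τ := div_pos (mul_pos hb.E hb.ηd) hb.τ
  have hsoc : ∀ t ≤ T, b.soc x₀ c d t = x t := by
    intro t
    induction t with
    | zero => exact fun _ => h.1.symm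
    | succ t ih =>
      intro ht
      rw [soc, ih (by omega)]
      rcases le_or_gt 0 (r t) with h0 | h0
      · simp only [hc, hd, if_pos h0]
        rw [hb.up_inv]; ring
      · simp only [hc, hd, if_neg (not_le.2 h0)]
        rw [hb.down_inv]; ring
  refine ⟨c, d, fun t ht => ?_, hsoc⟩
  rw [hsoc (t + 1) ht]
  obtain ⟨h1, h2⟩ := h.2 t ht
  have hP := abs_le.1 (hr t ht)
  have hP0 := hb.P
  have hu := hb.up_pos
  have hdn := hb.down_pos
  rcases le_or_gt 0 (r t) with h0 | h0
  · have h3 : 0 ≤ x (t + 1) - x t ∧ x (t + 1) - x t ≤ b.τ * b.ηc / b.E * r t := by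
      beta_reduce at h1
      rw [disp_of_nonneg h0] at h1
      have := mul_nonneg hu.le h0
      rcases h1 with h1 | h1
      · exact h1
      · constructor <;> linarith
    have h4 : b.E / (b.τ * b.ηc) * (x (t + 1) - x t) ≤ r t := by
      refine (mul_le_mul_of_nonneg_left h3.2 hcp.le).trans (le_of_eq ?_)
      have := hb.E.ne'; have := hb.τ.ne'; have := hb.ηc.ne'
      field_simp
    simp only [hc, hd, if_pos h0]
    exact ⟨⟨mul_nonneg hcp.le h3.1, h4.trans hP.2, h4.trans (le_max_left _ _)⟩,
      ⟨le_rfl, hP0.le, le_max_right _ _⟩, h2⟩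
  · have h3 : 0 ≤ x t - x (t + 1) ∧ x t - x (t + 1) ≤ b.τ / (b.ηd * b.E) * (-r t) := by
      beta_reduce at h1
      rw [disp_of_neg h0] at h1
      have := mul_nonneg hdn.le (by linarith : 0 ≤ -r t)
      rcases h1 with h1 | h1
      · constructor <;> linarith
      · constructor <;> linarith
    have h4 : b.E * b.ηd / b.τ * (x t - x (t + 1)) ≤ -r t := by
      refine (mul_le_mul_of_nonneg_left h3.2 hdp.le).trans (le_of_eq ?_)
      have := hb.E.ne'; have := hb.τ.ne'; have := hb.ηd.ne'
      field_simp
    simp only [hc, hd, if_neg (not_le.2 h0)]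
    exact ⟨⟨le_rfl, hP0.le, le_max_right _ _⟩,
      ⟨mul_nonneg hdp.le h3.1, h4.trans (by linarith), h4.trans (le_max_left _ _)⟩, h2⟩

/-- The penalty of doing nothing. -/
def idlePenalty (b : Battery) (T : ℕ) (r : ℕ → ℝ) : ℝ :=
  ∑ t ∈ Finset.range T, b.τ * (b.θ * max (r t) 0 + b.π * max (-r t) 0)

/-- The costs of the half cycles of a profile. -/
def cycleCost (b : Battery) (x : ℕ → ℝ) (T : ℕ) : ℝ :=
  ((rainflow ((List.range (T + 1)).map x)).1.map b.Jv).sum +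
    ((rainflow ((List.range (T + 1)).map x)).2.map b.Jw).sum

theorem cycleCost_congr {x y : ℕ → ℝ} {T : ℕ} (h : ∀ t ≤ T, x t = y t) :
    b.cycleCost x T = b.cycleCost y T := by
  have : (List.range (T + 1)).map x = (List.range (T + 1)).map y :=
    List.map_congr_left fun t ht => h t (by simpa [Nat.lt_succ_iff] using ht)
  rw [cycleCost, cycleCost, this]

/-- At each time only the requested direction is active and the response does not overshoot, so the
penalty falls linearly with the SoC movement. `rainflow_sum_profile` converts total movement into
total depth, and the saving can be credited to the half cycles one by one. -/
theorem Feasible.cost_eq (hb : b.Regular) {x₀ : ℝ} {T : ℕ} {r c d : ℕ → ℝ}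
    (h : b.Feasible x₀ T r c d) :
    b.cost x₀ T r c d = b.idlePenalty T r + b.cycleCost (b.soc x₀ c d) T := by
  have e1 : ∀ L : List ℝ, (L.map b.Jv).sum =
      b.E * b.B * (L.map fun v => b.Φ v / 2).sum - b.E / b.ηc * b.θ * L.sum := by
    intro L
    induction L with
    | nil => simp
    | cons a L ih => simp only [List.map_cons, List.sum_cons, ih, Jv]; ring
  have e2 : ∀ L : List ℝ, (L.map b.Jw).sum =
      b.E * b.B * (L.map fun v => b.Φ v / 2).sum - b.E * b.ηd * b.π * L.sum := by
    intro L
    induction L with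
    | nil => simp
    | cons a L ih => simp only [List.map_cons, List.sum_cons, ih, Jw]; ring
  obtain ⟨h1, h2⟩ := rainflow_sum_profile (b.soc x₀ c d) T
  have h3 : b.τ * ∑ t ∈ Finset.range T,
      (b.θ * max (r t - (c t - d t)) 0 + b.π * max (c t - d t - r t) 0) =
      b.idlePenalty T r - b.E / b.ηc * b.θ *
        (∑ t ∈ Finset.range T, max (b.soc x₀ c d (t + 1) - b.soc x₀ c d t) 0) -
      b.E * b.ηd * b.π *
        (∑ t ∈ Finset.range T, max (b.soc x₀ c d t - b.soc x₀ c d (t + 1)) 0) := by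
    rw [idlePenalty, Finset.mul_sum, Finset.mul_sum, Finset.mul_sum, ← Finset.sum_sub_distrib,
      ← Finset.sum_sub_distrib]
    refine Finset.sum_congr rfl fun t ht => ?_
    obtain ⟨⟨h1, -, h2⟩, ⟨h3, -, h4⟩, -⟩ := h t (Finset.mem_range.1 ht)
    rw [soc, add_sub_assoc, add_sub_cancel_left,
      show ∀ y z : ℝ, y - (y + z) = -z from fun y z => by ring]
    have hu := hb.up_pos
    have hd := hb.down_pos
    have hE := hb.E.ne'; have hτ := hb.τ.ne'; have hηc := hb.ηc.ne'; have hηd := hb.ηd.ne'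
    rcases le_or_gt 0 (r t) with hr | hr
    · rw [max_eq_right (by linarith)] at h4
      rw [max_eq_left hr] at h2
      have hd0 : d t = 0 := le_antisymm h4 h3
      have := mul_nonneg hu.le h1
      rw [hd0, mul_zero, sub_zero, sub_zero, max_eq_left (by linarith : 0 ≤ r t - c t),
        max_eq_right (by linarith : c t - r t ≤ 0), max_eq_left hr,
        max_eq_right (by linarith : -r t ≤ 0), max_eq_left this,
        max_eq_right (by linarith : -(b.τ * b.ηc / b.E * c t) ≤ 0)]
      field_simp
      ring
    · rw [max_eq_left (by linarith)] at h4
      rw [max_eq_right hr.le] at h2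
      have hc0 : c t = 0 := le_antisymm h2 h1
      have := mul_nonneg hd.le h3
      rw [hc0, mul_zero, zero_sub, zero_sub, neg_neg,
        max_eq_right (by linarith : r t - -d t ≤ 0),
        max_eq_left (by linarith : 0 ≤ -d t - r t), max_eq_right hr.le,
        max_eq_left (by linarith : 0 ≤ -r t), max_eq_left this,
        max_eq_right (by linarith : -(b.τ / (b.ηd * b.E) * d t) ≤ 0)]
      field_simp
      ring
  rw [cost, h3, cycleCost, e1, e2, h1, h2, lifeLoss]
  ring

theorem policyCost_eq (hb : b.Regular) {u x₀ : ℝ} (hu : 0 ≤ u) (hlo : b.xlo ≤ x₀)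
    (hhi : x₀ ≤ b.xhi) {r : ℕ → ℝ} {T : ℕ} (hr : ∀ t < T, |r t| ≤ b.P) :
    b.policyCost u x₀ T r =
      b.idlePenalty T r + b.cycleCost (fun t => (b.path u x₀ r t).z) T := by
  rw [policyCost, (feasible_policy hb hu hlo hhi hr).cost_eq hb, soc_policy_eq hb hu hlo hhi]

theorem Ju_eq (b : Battery) (d : ℝ) : b.Ju d = b.Jv d + b.Jw d := by
  simp only [Ju, Jv, Jw]; ring

/-- The threshold policy exceeds the cost of any admissible path by at most the worst-case gap. -/
theorem cycleCost_gap_le (hb : b.Regular) (hΦ : ConvexOn ℝ (Set.Ici 0) b.Φ) (hΦ0 : b.Φ 0 = 0)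
    {u v w : ℝ} (hu : 0 ≤ u) (hv : 0 ≤ v) (hw : 0 ≤ w)
    (hu_min : IsMinOn b.Ju (Set.Ici 0) u) (hv_min : IsMinOn b.Jv (Set.Ici 0) v)
    (hw_min : IsMinOn b.Jw (Set.Ici 0) w) {x₀ : ℝ} (hlo : b.xlo ≤ x₀) (hhi : x₀ ≤ b.xhi)
    {r x : ℕ → ℝ} {T : ℕ} (hx : Obeys b.xlo b.xhi x₀ (fun t => b.disp (r t)) x T) :
    b.cycleCost (fun t => (b.path u x₀ r t).z) T - b.cycleCost x T ≤ b.worstGap u v w := by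
  have hum : ∀ d, 0 ≤ d → b.Jv u + b.Jw u ≤ b.Jv d + b.Jw d := fun d hd => by
    rw [← Ju_eq, ← Ju_eq]; exact hu_min (Set.mem_Ici.2 hd)
  have hvm : ∀ d, 0 ≤ d → b.Jv v ≤ b.Jv d := fun d hd => hv_min (Set.mem_Ici.2 hd)
  have hwm : ∀ d, 0 ≤ d → b.Jw w ≤ b.Jw d := fun d hd => hw_min (Set.mem_Ici.2 hd)
  -- The symmetric part shared by `Jv` and `Jw`; what remains is linear, and the sign of `lam` is
  -- the case distinction of the theorem.
  set h : ℝ → ℝ := fun d => (b.Jv d + b.Jw d) / 2 with hh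
  set lam := (b.E * b.ηd * b.π - b.E / b.ηc * b.θ) / 2 with hlam
  have ef : ∀ d, b.Jv d = h d + lam * d := fun d => by
    simp only [hh, hlam, Jv, Jw]; ring
  have eg : ∀ d, b.Jw d = h d - lam * d := fun d => by
    simp only [hh, hlam, Jv, Jw]; ring
  have hconv : ConvexOn ℝ (Set.Ici 0) h := by
    have h1 : ConvexOn ℝ (Set.Ici 0) fun d => (1 / 2 * b.E * b.B) • b.Φ d :=
      hΦ.smul (mul_nonneg (mul_nonneg (by norm_num) hb.E.le) hb.B.le)
    have h2 : ConcaveOn ℝ (Set.Ici (0 : ℝ)) fun d =>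
        (b.E * b.ηd * b.π + b.E / b.ηc * b.θ) / 2 * d :=
      ⟨convex_Ici 0, fun x _ y _ a b _ _ _ => le_of_eq (by simp only [smul_eq_mul]; ring)⟩
    refine (h1.sub h2).congr fun d _ => ?_
    simp only [Pi.sub_apply, smul_eq_mul, hh, Jv, Jw]; ring
  have h0 : h 0 = 0 := by simp [hh, Jv, Jw, hΦ0]
  have hhu : ∀ d, 0 ≤ d → h u ≤ h d := fun d hd => by
    simp only [hh]; linarith [hum d hd]
  have hlam' : lam = b.E / 2 * (b.π * b.ηd - b.θ / b.ηc) := by rw [hlam]; ring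
  have hE2 : 0 < b.E / 2 := by have := hb.E; positivity
  set y : ℕ → ℝ := fun t => (b.path u x₀ r t).z with hy
  obtain ⟨hYu, hYd⟩ := rainflow_profile_depth_le (x := y)
    (greedyMotion_range_le hu hlo hhi (fun t => b.disp (r t)) T)
  obtain ⟨K, -, hK⟩ := exists_range_bound x T
  obtain ⟨hXu, hXd⟩ := rainflow_profile_depth_le hK
  have hlevel : ∀ s, 0 ≤ s → s ≤ u → _ := fun s hs hsu =>
    move_le_greedyMotion hs hsu hlo hhi hx
  have hU : ∀ s, 0 ≤ s → s ≤ u →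
      ((rainflow ((List.range (T + 1)).map x)).1.map fun d => min d s).sum ≤
      ((rainflow ((List.range (T + 1)).map y)).1.map fun d => min d s).sum := by
    intro s hs hsu
    rw [(rainflow_min_sum_profile hs x T).1, (rainflow_min_sum_profile hs y T).1]
    exact (hlevel s hs hsu).1
  have hD : ∀ s, 0 ≤ s → s ≤ u →
      ((rainflow ((List.range (T + 1)).map x)).2.map fun d => min d s).sum ≤
      ((rainflow ((List.range (T + 1)).map y)).2.map fun d => min d s).sum := by
    intro s hs hsu
    rw [(rainflow_min_sum_profile hs x T).2, (rainflow_min_sum_profile hs y T).2]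
    exact (hlevel s hs hsu).2
  have hXb := balanced_profile x T
  have hYb := balanced_profile y T
  rw [worstGap, cycleCost, cycleCost]
  rcases lt_trichotomy (b.θ / b.ηc) (b.π * b.ηd) with hc | hc | hc
  · have hl : 0 < lam := by rw [hlam']; exact mul_pos hE2 (by linarith)
    have huw : u ≤ w := by
      have h1 := hwm u hu
      have h2 := hhu w hw
      rw [eg, eg] at h1
      exact le_of_mul_le_mul_left (by linarith) hl
    rw [if_pos hc]
    exact halfCycle_gap_le hl.le hconv h0 ef eg hu huw hum hvm hwm hYu hYd
      (fun d hd => (hXu d hd).1) (fun d hd => (hXd d hd).1) hU hD hXb hYb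
  · have hl : lam = 0 := by rw [hlam', hc, sub_self, mul_zero]
    rw [if_neg hc.not_lt, if_pos hc.symm]
    have hfu : ∀ d, 0 ≤ d → b.Jv u ≤ b.Jv d := fun d hd => by
      rw [ef, ef, hl]; linarith [hhu d hd]
    have hgu : ∀ d, 0 ≤ d → b.Jw u ≤ b.Jw d := fun d hd => by
      rw [eg, eg, hl]; linarith [hhu d hd]
    -- For `lam = 0` the depth `u` minimizes `Jv` and `Jw` separately, so it can play the roles of
    -- `v` and `w`, and the bound is zero.
    have := halfCycle_gap_le hl.ge hconv h0 ef eg hu le_rfl hum hfu hgu hYu hYd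
      (fun d hd => (hXu d hd).1) (fun d hd => (hXd d hd).1) hU hD hXb hYb
    linarith
  · have hl : lam < 0 := by rw [hlam']; exact mul_neg_of_pos_of_neg hE2 (by linarith)
    have huv : u ≤ v := by
      have h1 := hvm u hu
      have h2 := hhu v hv
      rw [ef, ef] at h1
      exact le_of_mul_le_mul_left (by linarith : -lam * u ≤ -lam * v) (by linarith)
    rw [if_neg (not_lt.2 hc.le), if_neg hc.ne]
    -- Charging and discharging exchange roles, and with them `v` and `w`.
    have := halfCycle_gap_le (lam := -lam) (by linarith) hconv h0
      (fun d => by rw [eg]; ring) (fun d => by rw [ef]; ring) hu huv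
      (fun d hd => by linarith [hum d hd]) hwm hvm hYd hYu
      (fun d hd => (hXd d hd).1) (fun d hd => (hXu d hd).1) hD hU hXb.symm hYb.symm
    linarith

theorem policyCost_sub_cost_le (hb : b.Regular) (hΦ : ConvexOn ℝ (Set.Ici 0) b.Φ)
    (hΦ0 : b.Φ 0 = 0) {u v w : ℝ} (hu : 0 ≤ u) (hv : 0 ≤ v) (hw : 0 ≤ w)
    (hu_min : IsMinOn b.Ju (Set.Ici 0) u) (hv_min : IsMinOn b.Jv (Set.Ici 0) v)
    (hw_min : IsMinOn b.Jw (Set.Ici 0) w) {x₀ : ℝ} (hlo : b.xlo ≤ x₀) (hhi : x₀ ≤ b.xhi)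
    {r c d : ℕ → ℝ} {T : ℕ} (hr : ∀ t < T, |r t| ≤ b.P) (h : b.Feasible x₀ T r c d) :
    b.policyCost u x₀ T r - b.cost x₀ T r c d ≤ b.worstGap u v w := by
  have := cycleCost_gap_le hb hΦ hΦ0 hu hv hw hu_min hv_min hw_min hlo hhi (h.obeys hb)
  rw [policyCost_eq hb hu hlo hhi hr, h.cost_eq hb]
  linarith

theorem gap_le_worstGap (hb : b.Regular) (hΦ : ConvexOn ℝ (Set.Ici 0) b.Φ)
    (hΦ0 : b.Φ 0 = 0) {u v w : ℝ} (hu : 0 ≤ u) (hv : 0 ≤ v) (hw : 0 ≤ w)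
    (hu_min : IsMinOn b.Ju (Set.Ici 0) u) (hv_min : IsMinOn b.Jv (Set.Ici 0) v)
    (hw_min : IsMinOn b.Jw (Set.Ici 0) w) {x₀ : ℝ} (hlo : b.xlo ≤ x₀) (hhi : x₀ ≤ b.xhi)
    {r : ℕ → ℝ} {T : ℕ} (hr : ∀ t < T, |r t| ≤ b.P) :
    b.gap u x₀ T r ≤ b.worstGap u v w := by
  have h : b.policyCost u x₀ T r - b.worstGap u v w ≤ b.offlineCost x₀ T r := by
    refine le_csInf ⟨_, _, _, feasible_policy hb hu hlo hhi hr, rfl⟩ ?_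
    rintro J ⟨c, d, hcd, rfl⟩
    linarith [policyCost_sub_cost_le hb hΦ hΦ0 hu hv hw hu_min hv_min hw_min hlo hhi hr hcd]
  rw [gap]
  linarith

theorem le_gap (hb : b.Regular) (hΦ : ConvexOn ℝ (Set.Ici 0) b.Φ)
    (hΦ0 : b.Φ 0 = 0) {u v w : ℝ} (hu : 0 ≤ u) (hv : 0 ≤ v) (hw : 0 ≤ w)
    (hu_min : IsMinOn b.Ju (Set.Ici 0) u) (hv_min : IsMinOn b.Jv (Set.Ici 0) v)
    (hw_min : IsMinOn b.Jw (Set.Ici 0) w) {x₀ : ℝ} (hlo : b.xlo ≤ x₀) (hhi : x₀ ≤ b.xhi)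
    {r x : ℕ → ℝ} {T : ℕ} (hr : ∀ t < T, |r t| ≤ b.P)
    (hx : Obeys b.xlo b.xhi x₀ (fun t => b.disp (r t)) x T) :
    b.cycleCost (fun t => (b.path u x₀ r t).z) T - b.cycleCost x T ≤ b.gap u x₀ T r := by
  obtain ⟨c, d, hcd, hsoc⟩ := exists_feasible hb hr hx
  have h : b.offlineCost x₀ T r ≤ b.cost x₀ T r c d := by
    -- The upper bound on the gap also shows that the admissible costs are bounded below, as needed
    -- for the real infimum to be meaningful.
    refine csInf_le ⟨b.policyCost u x₀ T r - b.worstGap u v w, ?_⟩ ⟨c, d, hcd, rfl⟩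
    rintro J ⟨c, d, hcd, rfl⟩
    linarith [policyCost_sub_cost_le hb hΦ hΦ0 hu hv hw hu_min hv_min hw_min hlo hhi hr hcd]
  rw [hcd.cost_eq hb, cycleCost_congr hsoc] at h
  rw [gap, policyCost_eq hb hu hlo hhi hr]
  linarith

end

end Battery

/-! ### Rainflow counting of three-phase profiles. -/

namespace Rainflow

theorem turningPoints_drop (pre : List ℝ) {x y z : ℝ} (h : (x ≤ y ∧ y ≤ z) ∨ (z ≤ y ∧ y ≤ x))
    (l : List ℝ) :
    turningPoints (pre ++ x :: y :: z :: l) = turningPoints (pre ++ x :: z :: l) := by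
  induction hn : pre.length using Nat.strong_induction_on generalizing pre with
  | _ n ih =>
  rcases pre with _ | ⟨a, _ | ⟨a', pre⟩⟩
  · rw [List.nil_append, List.nil_append, turningPoints, if_pos h]
  · simp only [List.cons_append, List.nil_append]
    have ih0 := ih 0 (by simp at hn; omega) [] rfl
    simp only [List.nil_append] at ih0
    by_cases h1 : (a ≤ x ∧ x ≤ y) ∨ (y ≤ x ∧ x ≤ a)
    · rw [turningPoints, if_pos h1]
      by_cases h2 : (a ≤ x ∧ x ≤ z) ∨ (z ≤ x ∧ x ≤ a)
      · rw [turningPoints.eq_1 a x z, if_pos h2]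
        by_cases h3 : (a ≤ y ∧ y ≤ z) ∨ (z ≤ y ∧ y ≤ a)
        · rw [turningPoints, if_pos h3]
        · exact absurd h3 (by grind)
      · obtain rfl : x = y := by grind
        rfl
    · by_cases h2 : (a ≤ x ∧ x ≤ z) ∨ (z ≤ x ∧ x ≤ a)
      · exfalso; grind
      · rw [turningPoints, if_neg h1, turningPoints.eq_1 a x z, if_neg h2, ih0]
  · simp only [List.length_cons] at hn
    have ih1 := ih (pre.length + 1) (by omega) (a' :: pre) rfl
    have ih2 := ih (pre.length + 1) (by omega) (a :: pre) rfl
    rcases pre with _ | ⟨a'', pre⟩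
    · simp only [List.cons_append, List.nil_append] at *
      rw [turningPoints, turningPoints.eq_1 a a' x, ih1, ih2]
    · simp only [List.cons_append] at *
      rw [turningPoints, turningPoints.eq_1 a a' a'', ih1, ih2]

/-- `m` values of a sequence, the first one at time `i`. -/
def segment (f : ℕ → ℝ) : ℕ → ℕ → List ℝ
  | _, 0 => []
  | i, m + 1 => f i :: segment f (i + 1) m

theorem segment_eq_map (f : ℕ → ℝ) (m : ℕ) : ∀ i,
    segment f i m = (List.range m).map fun k => f (i + k) := by
  induction m with
  | zero => intro i; rfl
  | succ m ih =>
    intro i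
    rw [segment, ih, List.range_succ_eq_map, List.map_cons, List.map_map]
    simp [Function.comp_def, Nat.add_assoc, Nat.add_comm 1]

theorem turningPoints_run (f : ℕ → ℝ) (pre : List ℝ) (m : ℕ) : ∀ (k i : ℕ),
    (f i ≤ f (i + 1) ∧ (∀ t, i + 1 ≤ t → t < i + 1 + k → f t ≤ f (t + 1))) ∨
    (f (i + 1) ≤ f i ∧ (∀ t, i + 1 ≤ t → t < i + 1 + k → f (t + 1) ≤ f t)) →
    turningPoints (pre ++ f i :: segment f (i + 1) (k + 1 + m)) =
      turningPoints (pre ++ f i :: f (i + 1 + k) :: segment f (i + 1 + k + 1) m) := by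
  -- The left anchor `a` is kept general: after `f j` is dropped, it becomes the neighbour of `f (j
  -- + 1)`.
  have aux : ∀ (k j : ℕ) (a : ℝ),
      (a ≤ f j ∧ (∀ t, j ≤ t → t < j + k → f t ≤ f (t + 1))) ∨
      (f j ≤ a ∧ (∀ t, j ≤ t → t < j + k → f (t + 1) ≤ f t)) →
      turningPoints (pre ++ a :: segment f j (k + 1 + m)) =
        turningPoints (pre ++ a :: f (j + k) :: segment f (j + k + 1) m) := by
    intro k
    induction k with
    | zero => intro j a _; rw [Nat.zero_add, Nat.add_comm 1 m, segment]; rfl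
    | succ k ih =>
      intro j a h
      have e : k + 1 + 1 + m = (k + 1 + m) + 1 := by omega
      have e' : k + 1 + m = (k + m) + 1 := by omega
      have hd : (a ≤ f j ∧ f j ≤ f (j + 1)) ∨ (f (j + 1) ≤ f j ∧ f j ≤ a) := by
        rcases h with h | h
        · exact Or.inl ⟨h.1, h.2 j le_rfl (by omega)⟩
        · exact Or.inr ⟨h.2 j le_rfl (by omega), h.1⟩
      have h2 := ih (j + 1) a (by
        rcases h with h | h
        · exact Or.inl ⟨h.1.trans (h.2 j le_rfl (by omega)),
            fun t h1 h2 => h.2 t (by omega) (by omega)⟩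
        · exact Or.inr ⟨(h.2 j le_rfl (by omega)).trans h.1,
            fun t h1 h2 => h.2 t (by omega) (by omega)⟩)
      have hs : segment f (j + 1) (k + 1 + m) = f (j + 1) :: segment f (j + 1 + 1) (k + m) := by
        rw [e', segment]
      rw [e, segment, hs, turningPoints_drop pre hd, ← hs, h2,
        show j + 1 + k = j + (k + 1) by omega]
  intro k i h
  exact aux k (i + 1) (f i) h

/-- A profile that is monotone during three phases of length `n` and constant from then on. -/
theorem rainflow_three_phases {f : ℕ → ℝ} {n T : ℕ} (hn : 0 < n) (hT : 3 * n + 1 ≤ T)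
    (h1 : (∀ t, t < n → f t ≤ f (t + 1)) ∨ (∀ t, t < n → f (t + 1) ≤ f t))
    (h2 : (∀ t, n ≤ t → t < 2 * n → f t ≤ f (t + 1)) ∨
      (∀ t, n ≤ t → t < 2 * n → f (t + 1) ≤ f t))
    (h3 : (∀ t, 2 * n ≤ t → t < 3 * n → f t ≤ f (t + 1)) ∨
      (∀ t, 2 * n ≤ t → t < 3 * n → f (t + 1) ≤ f t))
    (h4 : ∀ t, 3 * n ≤ t → f (t + 1) = f t) :
    rainflow ((List.range (T + 1)).map f) =
      rainflow [f 0, f n, f (2 * n), f (3 * n), f (3 * n)] := by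
  obtain ⟨k, rfl⟩ : ∃ k, n = k + 1 := ⟨n - 1, by omega⟩
  obtain ⟨m, rfl⟩ : ∃ m, T = 3 * (k + 1) + 1 + m := ⟨T - (3 * (k + 1) + 1), by omega⟩
  have hconst : ∀ j, f (3 * (k + 1) + j) = f (3 * (k + 1)) := by
    intro j
    induction j with
    | zero => rfl
    | succ j ih => rw [← Nat.add_assoc, h4 _ (by omega), ih]
  have e0 : (List.range (3 * (k + 1) + 1 + m + 1)).map f =
      f 0 :: segment f 1 (k + 1 + (k + 1 + (k + 1 + (m + 1 + 0)))) := by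
    have h := segment_eq_map f (3 * (k + 1) + 1 + m + 1) 0
    simp only [Nat.zero_add] at h
    rw [← h, segment]
    congr 2
    omega
  have r1 := turningPoints_run f [] (k + 1 + (k + 1 + (m + 1 + 0))) k 0 (by
    rcases h1 with h | h
    · exact Or.inl ⟨h 0 (by omega), fun t _ _ => h t (by omega)⟩
    · exact Or.inr ⟨h 0 (by omega), fun t _ _ => h t (by omega)⟩)
  have r2 := turningPoints_run f [f 0] (k + 1 + (m + 1 + 0)) k (k + 1) (by
    rcases h2 with h | h
    · exact Or.inl ⟨h _ (by omega) (by omega), fun t _ _ => h t (by omega) (by omega)⟩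
    · exact Or.inr ⟨h _ (by omega) (by omega), fun t _ _ => h t (by omega) (by omega)⟩)
  have r3 := turningPoints_run f [f 0, f (k + 1)] (m + 1 + 0) k (2 * (k + 1)) (by
    rcases h3 with h | h
    · exact Or.inl ⟨h _ (by omega) (by omega), fun t _ _ => h t (by omega) (by omega)⟩
    · exact Or.inr ⟨h _ (by omega) (by omega), fun t _ _ => h t (by omega) (by omega)⟩)
  -- The idle tail is treated as a fourth monotone run, which must contain at least one step; hence
  -- `3 * n + 1 ≤ T` and the repeated last point.
  have r4 := turningPoints_run f [f 0, f (k + 1), f (2 * (k + 1))] 0 m (3 * (k + 1))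
    (Or.inl ⟨(h4 _ le_rfl).ge, fun t _ _ => (h4 t (by omega)).ge⟩)
  simp only [List.nil_append, List.cons_append, Nat.zero_add] at r1 r2 r3 r4
  rw [show 1 + k = k + 1 by omega, show k + 1 + 1 = (k + 1) + 1 from rfl] at r1
  rw [show k + 1 + 1 + k = 2 * (k + 1) by omega] at r2
  rw [show 2 * (k + 1) + 1 + k = 3 * (k + 1) by omega] at r3
  rw [show 3 * (k + 1) + 1 + m = 3 * (k + 1) + (1 + m) by omega, hconst, segment.eq_1] at r4
  have r : turningPoints ((List.range (3 * (k + 1) + 1 + m + 1)).map f) =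
      turningPoints [f 0, f (k + 1), f (2 * (k + 1)), f (3 * (k + 1)), f (3 * (k + 1))] := by
    rw [e0, r1, r2, r3, r4]
  rw [rainflow, rainflow, r]

/-- For `0 < A < B` nothing is extracted and all three legs are residue. For `A = B > 0` the
non-strict four-point test extracts a full cycle and leaves one rising leg, with the same total.
Legs of depth zero are not counted, which is harmless as `k` and `l` vanish there. -/
theorem rainflow_up_down_up {k l : ℝ → ℝ} (hk : k 0 = 0) (hl : l 0 = 0) {p A B : ℝ} (hA : 0 ≤ A)
    (hAB : A ≤ B) :
    ((rainflow [p, p + A, p + A - B, p + A - B + A, p + A - B + A]).1.map k).sum +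
      ((rainflow [p, p + A, p + A - B, p + A - B + A, p + A - B + A]).2.map l).sum =
    2 * k A + l B := by
  rcases hA.eq_or_lt with rfl | hA
  · rcases hAB.eq_or_lt with rfl | hB
    · simp [rainflow, turningPoints, scan, extract, upLegs, downLegs, hk, hl]
    · have h1 : ¬ p = p - B := by linarith
      have h2 : ¬ p < p - B := by linarith
      simp [rainflow, turningPoints, scan, extract, upLegs, downLegs, hk, hB, hB.le, h1, h2]
  · have hB : 0 < B := hA.trans_le hAB
    have e : turningPoints [p, p + A, p + A - B, p + A - B + A, p + A - B + A] =
        [p, p + A, p + A - B, p + A - B + A] := by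
      rw [turningPoints, if_neg (by grind), turningPoints, if_neg (by grind), turningPoints,
        if_pos (by grind), turningPoints, if_neg (by grind)]
    have e1 : p + A - (p + A - B) = B := by ring
    have e2 : p - (p + A) = -A := by ring
    have e3 : p + A - B - (p + A - B + A) = -A := by ring
    rcases hAB.eq_or_lt with rfl | hlt
    · simp only [rainflow, e, scan, extract, e1, e2, e3, abs_neg, le_refl, and_self, if_true,
        List.nil_append, List.append_nil, List.reverse_cons, List.reverse_nil, upLegs, downLegs,
        List.cons_append]
      rw [if_pos (by linarith), if_neg (by linarith)]
      simp only [List.map_cons, List.map_nil, List.sum_cons, List.sum_nil, abs_of_pos hA]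
      rw [show p + A - A + A - p = A by ring]
      ring
    · simp only [rainflow, e, scan, extract, e1, e2, e3, abs_neg, abs_of_pos hA, abs_of_pos hB]
      rw [if_neg (by grind)]
      simp only [List.nil_append, List.append_nil, List.reverse_cons, List.reverse_nil,
        List.cons_append, upLegs, downLegs]
      rw [if_pos (by linarith), if_neg (by linarith), if_pos (by linarith), if_neg (by linarith),
        if_pos (by linarith), if_neg (by linarith)]
      simp only [List.map_cons, List.map_nil, List.sum_cons, List.sum_nil]
      rw [show p + A - B + A - (p + A - B) = A by ring, show p + A - p = A by ring, e1]
      ring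

theorem rainflow_down_up_down {k l : ℝ → ℝ} (hk : k 0 = 0) (hl : l 0 = 0) {p A B : ℝ}
    (hA : 0 ≤ A) (hAB : A ≤ B) :
    ((rainflow [p, p - A, p - A + B, p - A + B - A, p - A + B - A]).1.map k).sum +
      ((rainflow [p, p - A, p - A + B, p - A + B - A, p - A + B - A]).2.map l).sum =
    k B + 2 * l A := by
  rcases hA.eq_or_lt with rfl | hA
  · rcases hAB.eq_or_lt with rfl | hB
    · simp [rainflow, turningPoints, scan, extract, upLegs, downLegs, hk, hl]
    · simp [rainflow, turningPoints, scan, extract, upLegs, downLegs, hl, hB, hB.ne', hB.le,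
        not_lt.2 hB.le]
  · have hB : 0 < B := hA.trans_le hAB
    have e : turningPoints [p, p - A, p - A + B, p - A + B - A, p - A + B - A] =
        [p, p - A, p - A + B, p - A + B - A] := by
      rw [turningPoints, if_neg (by grind), turningPoints, if_neg (by grind), turningPoints,
        if_pos (by grind), turningPoints, if_neg (by grind)]
    have e1 : p - A - (p - A + B) = -B := by ring
    have e2 : p - (p - A) = A := by ring
    have e3 : p - A + B - (p - A + B - A) = A := by ring
    rcases hAB.eq_or_lt with rfl | hlt
    · simp only [rainflow, e, scan, extract, e1, e2, e3, abs_neg, le_refl, and_self, if_true,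
        List.nil_append, List.append_nil, List.reverse_cons, List.reverse_nil, upLegs, downLegs,
        List.cons_append]
      rw [if_neg (by linarith), if_pos (by linarith)]
      simp only [List.map_cons, List.map_nil, List.sum_cons, List.sum_nil, abs_of_pos hA]
      rw [show p - (p - A + A - A) = A by ring]
      ring
    · simp only [rainflow, e, scan, extract, e1, e2, e3, abs_neg, abs_of_pos hA, abs_of_pos hB]
      rw [if_neg (by grind)]
      simp only [List.nil_append, List.append_nil, List.reverse_cons, List.reverse_nil,
        List.cons_append, upLegs, downLegs]
      rw [if_neg (by linarith), if_pos (by linarith), if_neg (by linarith), if_pos (by linarith),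
        if_neg (by linarith), if_pos (by linarith)]
      simp only [List.map_cons, List.map_nil, List.sum_cons, List.sum_nil]
      rw [show p - A + B - (p - A) = B by ring, e2, e3]
      ring

/-- Increments that add up to `α`, `-β` and `α` during three phases of length `n`. -/
def phases (n : ℕ) (α β : ℝ) (t : ℕ) : ℝ :=
  if t < n then α / n else if t < 2 * n then -β / n else if t < 3 * n then α / n else 0

theorem phases_first {n t : ℕ} (α β : ℝ) (h : t < n) : phases n α β t = α / n := if_pos h

theorem phases_second {n t : ℕ} (α β : ℝ) (h : n ≤ t) (h' : t < 2 * n) :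
    phases n α β t = -β / n := by
  rw [phases, if_neg (by omega), if_pos h']

theorem phases_third {n t : ℕ} (α β : ℝ) (h : 2 * n ≤ t) (h' : t < 3 * n) :
    phases n α β t = α / n := by
  rw [phases, if_neg (by omega), if_neg (by omega), if_pos h']

theorem phases_rest {n t : ℕ} (α β : ℝ) (h : 3 * n ≤ t) : phases n α β t = 0 := by
  rw [phases, if_neg (by omega), if_neg (by omega), if_neg (by omega)]

theorem abs_phases_le (n : ℕ) (α β : ℝ) (t : ℕ) : |phases n α β t| ≤ (|α| + |β|) / n := by
  have hn : (0 : ℝ) ≤ n := Nat.cast_nonneg n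
  have h1 : |α / n| ≤ (|α| + |β|) / n := by
    rw [abs_div, abs_of_nonneg hn]
    exact div_le_div_of_nonneg_right (by linarith [abs_nonneg β]) hn
  have h2 : |-β / n| ≤ (|α| + |β|) / n := by
    rw [abs_div, abs_neg, abs_of_nonneg hn]
    exact div_le_div_of_nonneg_right (by linarith [abs_nonneg α]) hn
  rw [phases]
  split_ifs
  · exact h1
  · exact h2
  · exact h1
  · rw [abs_zero]; positivity

/-- The path with the increments `phases n α β`. -/
def phasePath (n : ℕ) (α β x₀ : ℝ) (t : ℕ) : ℝ :=
  x₀ + ∑ i ∈ Finset.range t, phases n α β i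

theorem phasePath_succ (n : ℕ) (α β x₀ : ℝ) (t : ℕ) :
    phasePath n α β x₀ (t + 1) = phasePath n α β x₀ t + phases n α β t := by
  rw [phasePath, phasePath, Finset.sum_range_succ]; ring

theorem eq_add_mul_of_step {f : ℕ → ℝ} {ρ : ℝ} {i : ℕ} : ∀ {k : ℕ},
    (∀ j < k, f (i + j + 1) = f (i + j) + ρ) → f (i + k) = f i + k * ρ
  | 0, _ => by simp
  | k + 1, h => by
    rw [← Nat.add_assoc, h k (by omega), eq_add_mul_of_step fun j hj => h j (by omega)]
    push_cast; ring

section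
variable {n : ℕ} (hn : 0 < n) (α β x₀ : ℝ)

theorem phasePath_first {k : ℕ} (hk : k ≤ n) : phasePath n α β x₀ k = x₀ + k * (α / n) := by
  have h := eq_add_mul_of_step (f := phasePath n α β x₀) (i := 0) (k := k) (ρ := α / n)
    (fun j hj => by rw [phasePath_succ, phases_first _ _ (by omega)])
  rw [Nat.zero_add] at h
  rw [h]; simp [phasePath]

include hn in
theorem phasePath_n : phasePath n α β x₀ n = x₀ + α := by
  have : (n : ℝ) ≠ 0 := Nat.cast_ne_zero.2 hn.ne'
  rw [phasePath_first α β x₀ le_rfl]; field_simp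

include hn in
theorem phasePath_second {k : ℕ} (hk : k ≤ n) :
    phasePath n α β x₀ (n + k) = x₀ + α + k * (-β / n) := by
  rw [← phasePath_n hn α β x₀]
  exact eq_add_mul_of_step fun j hj => by
    rw [phasePath_succ, phases_second _ _ (by omega) (by omega)]

include hn in
theorem phasePath_two : phasePath n α β x₀ (2 * n) = x₀ + α - β := by
  have : (n : ℝ) ≠ 0 := Nat.cast_ne_zero.2 hn.ne'
  rw [two_mul, phasePath_second hn α β x₀ le_rfl]; field_simp; ring

include hn in
theorem phasePath_third {k : ℕ} (hk : k ≤ n) :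
    phasePath n α β x₀ (2 * n + k) = x₀ + α - β + k * (α / n) := by
  rw [← phasePath_two hn α β x₀]
  exact eq_add_mul_of_step fun j hj => by
    rw [phasePath_succ, phases_third _ _ (by omega) (by omega)]

include hn in
theorem phasePath_three : phasePath n α β x₀ (3 * n) = x₀ + α - β + α := by
  have : (n : ℝ) ≠ 0 := Nat.cast_ne_zero.2 hn.ne'
  rw [show 3 * n = 2 * n + n by ring, phasePath_third hn α β x₀ le_rfl]; field_simp

include hn in
theorem phasePath_rest (k : ℕ) : phasePath n α β x₀ (3 * n + k) = x₀ + α - β + α := by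
  have h := eq_add_mul_of_step (f := phasePath n α β x₀) (i := 3 * n) (k := k) (ρ := 0)
    (fun j _ => by rw [phasePath_succ, phases_rest _ _ (by omega)])
  rw [h, phasePath_three hn, mul_zero, add_zero]

theorem mem_of_endpoints {a b p c : ℝ} {k n : ℕ} (hk : k ≤ n) (hn : 0 < n) (h1 : a ≤ p)
    (h2 : p ≤ b) (h3 : a ≤ p + c) (h4 : p + c ≤ b) :
    a ≤ p + k * (c / n) ∧ p + k * (c / n) ≤ b := by
  have hn' : (0 : ℝ) < n := Nat.cast_pos.2 hn
  have e : p + k * (c / n) = (1 - k / n) * p + k / n * (p + c) := by field_simp; ring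
  have h5 : (0 : ℝ) ≤ k / n := by positivity
  have h6 : (k : ℝ) / n ≤ 1 := by
    rw [div_le_one hn']; exact_mod_cast hk
  rw [e]
  constructor <;> nlinarith

include hn in
theorem phasePath_mem {a b : ℝ} (h0 : a ≤ x₀ ∧ x₀ ≤ b) (h1 : a ≤ x₀ + α ∧ x₀ + α ≤ b)
    (h2 : a ≤ x₀ + α - β ∧ x₀ + α - β ≤ b) (h3 : a ≤ x₀ + α - β + α ∧ x₀ + α - β + α ≤ b)
    (t : ℕ) : a ≤ phasePath n α β x₀ t ∧ phasePath n α β x₀ t ≤ b := by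
  rcases Nat.lt_or_ge t n with h | h
  · rw [phasePath_first α β x₀ h.le]
    exact mem_of_endpoints h.le hn h0.1 h0.2 h1.1 h1.2
  obtain ⟨k, rfl⟩ := Nat.exists_eq_add_of_le h
  rcases Nat.lt_or_ge k n with h' | h'
  · rw [phasePath_second hn α β x₀ h'.le]
    exact mem_of_endpoints h'.le hn h1.1 h1.2 (by linarith) (by linarith)
  obtain ⟨k, rfl⟩ := Nat.exists_eq_add_of_le h'
  rw [← Nat.add_assoc, ← two_mul]
  rcases Nat.lt_or_ge k n with h' | h'
  · rw [phasePath_third hn α β x₀ h'.le]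
    exact mem_of_endpoints h'.le hn h2.1 h2.2 h3.1 h3.2
  obtain ⟨k, rfl⟩ := Nat.exists_eq_add_of_le h'
  rw [← Nat.add_assoc, show 2 * n + n = 3 * n by ring, phasePath_rest hn]
  exact h3

include hn in
theorem obeys_phasePath {a b α' β' : ℝ} (h0 : a ≤ x₀ ∧ x₀ ≤ b)
    (h1 : a ≤ x₀ + α ∧ x₀ + α ≤ b)
    (h2 : a ≤ x₀ + α - β ∧ x₀ + α - β ≤ b) (h3 : a ≤ x₀ + α - β + α ∧ x₀ + α - β + α ≤ b)
    (hα : (0 ≤ α ∧ α ≤ α') ∨ (α' ≤ α ∧ α ≤ 0)) (hβ : (0 ≤ β ∧ β ≤ β') ∨ (β' ≤ β ∧ β ≤ 0)) (T : ℕ) :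
    Obeys a b x₀ (phases n α' β') (phasePath n α β x₀) T := by
  have hn' : (0 : ℝ) ≤ n := Nat.cast_nonneg n
  have key : ∀ c c' : ℝ, (0 ≤ c ∧ c ≤ c') ∨ (c' ≤ c ∧ c ≤ 0) →
      (0 ≤ c / n ∧ c / n ≤ c' / n) ∨ (c' / n ≤ c / n ∧ c / n ≤ 0) := by
    rintro c c' (h | h)
    · exact Or.inl ⟨div_nonneg h.1 hn', div_le_div_of_nonneg_right h.2 hn'⟩
    · exact Or.inr ⟨div_le_div_of_nonneg_right h.1 hn', div_nonpos_of_nonpos_of_nonneg h.2 hn'⟩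
  refine ⟨by simp [phasePath], fun t _ => ⟨?_, phasePath_mem hn α β x₀ h0 h1 h2 h3 _⟩⟩
  rw [phasePath_succ, add_sub_cancel_left, phases, phases]
  split_ifs
  · exact key _ _ hα
  · refine key _ _ ?_
    rcases hβ with h | h
    · right; constructor <;> linarith
    · left; constructor <;> linarith
  · exact key _ _ hα
  · simp

include hn in
/-- A path that moves by at most `phases n α β` in the prescribed directions and is idle in the
end has the cycles of its corner points. -/
theorem rainflow_of_phases {f : ℕ → ℝ} {T : ℕ} (hT : 3 * n + 1 ≤ T)
    (hf : ∀ t, (0 ≤ f (t + 1) - f t ∧ f (t + 1) - f t ≤ phases n α β t) ∨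
      (phases n α β t ≤ f (t + 1) - f t ∧ f (t + 1) - f t ≤ 0)) :
    rainflow ((List.range (T + 1)).map f) =
      rainflow [f 0, f n, f (2 * n), f (3 * n), f (3 * n)] := by
  have key : ∀ (S : Set ℕ) (c : ℝ), (∀ t ∈ S, phases n α β t = c) →
      (∀ t ∈ S, f t ≤ f (t + 1)) ∨ (∀ t ∈ S, f (t + 1) ≤ f t) := by
    intro S c hS
    rcases le_total 0 c with hc | hc
    · left
      intro t ht
      have := hf t
      rw [hS t ht] at this
      rcases this with h | h <;> linarith
    · right
      intro t ht
      have := hf t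
      rw [hS t ht] at this
      rcases this with h | h <;> linarith
  refine rainflow_three_phases hn hT ?_ ?_ ?_ ?_
  · exact key {t | t < n} _ fun t ht => phases_first α β ht
  · rcases key {t | n ≤ t ∧ t < 2 * n} _ fun t ht => phases_second α β ht.1 ht.2 with h | h
    · exact Or.inl fun t h1 h2 => h t ⟨h1, h2⟩
    · exact Or.inr fun t h1 h2 => h t ⟨h1, h2⟩
  · rcases key {t | 2 * n ≤ t ∧ t < 3 * n} _ fun t ht => phases_third α β ht.1 ht.2 with h | h
    · exact Or.inl fun t h1 h2 => h t ⟨h1, h2⟩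
    · exact Or.inr fun t h1 h2 => h t ⟨h1, h2⟩
  · intro t ht
    have := hf t
    rw [phases_rest α β ht] at this
    rcases this with h | h <;> linarith

end

/-! ### The greedy motion under constant instructions. -/

theorem Band.greedy_mem {a b s : ℝ} {σ : Band} (h : σ.Valid s) (h' : σ.Within a b) (R : ℝ) :
    (0 ≤ (σ.greedy a b s R).z - σ.z ∧ (σ.greedy a b s R).z - σ.z ≤ R) ∨
      (R ≤ (σ.greedy a b s R).z - σ.z ∧ (σ.greedy a b s R).z - σ.z ≤ 0) := by
  obtain ⟨z, lo, hi⟩ := σ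
  simp only [Valid, Within, greedy, track] at *
  rcases le_total 0 R with hR | hR
  · left; grind
  · right; grind

section
variable {a b s x₀ : ℝ} (hs : 0 ≤ s) (ha : a ≤ x₀) (hb : x₀ ≤ b) {R : ℕ → ℝ} {ρ : ℝ} {i : ℕ}

include hs ha hb

/-- Equal upward steps merge into one clamped move, because `lo` and hence the ceiling stay fixed
while moving up. -/
theorem greedyMotion_up (hρ : 0 ≤ ρ) : ∀ {k : ℕ}, (∀ j < k, R (i + j) = ρ) →
    greedyMotion a b s x₀ R (i + k) =
      (greedyMotion a b s x₀ R i).track (min (min b ((greedyMotion a b s x₀ R i).lo + s))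
        ((greedyMotion a b s x₀ R i).z + k * ρ))
  | 0, _ => by
    obtain ⟨h1, h2⟩ := valid_greedyMotion hs ha hb R i
    generalize greedyMotion a b s x₀ R i = σ at *
    obtain ⟨z, lo, hi⟩ := σ
    simp only [Band.Valid, Band.Within, Band.track, Nat.cast_zero, zero_mul,
      add_zero, Band.mk.injEq] at *
    grind
  | k + 1, h => by
    have hstep := greedyMotion_up hρ (k := k) fun j hj => h j (by omega)
    have hk : (0 : ℝ) ≤ k * ρ := by positivity
    obtain ⟨h1, h2⟩ := valid_greedyMotion hs ha hb R i
    rw [← Nat.add_assoc, greedyMotion, hstep, h k (by omega)]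
    push_cast
    rw [add_mul, one_mul]
    generalize (k : ℝ) * ρ = y at *
    generalize greedyMotion a b s x₀ R i = σ at *
    obtain ⟨z, lo, hi⟩ := σ
    simp only [Band.Valid, Band.Within, Band.greedy, Band.track, Band.mk.injEq] at *
    have e1 : min lo (min (min b (lo + s)) (z + y)) = lo := by grind
    rw [e1]
    have e2 : max (max a (max hi (min (min b (lo + s)) (z + y)) - s))
        (min (min b (lo + s)) (min (min b (lo + s)) (z + y) + ρ)) =
        min (min b (lo + s)) (z + (y + ρ)) := by grind
    rw [e2]
    refine ⟨rfl, rfl, ?_⟩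
    grind

theorem greedyMotion_down (hρ : ρ ≤ 0) : ∀ {k : ℕ}, (∀ j < k, R (i + j) = ρ) →
    greedyMotion a b s x₀ R (i + k) =
      (greedyMotion a b s x₀ R i).track (max (max a ((greedyMotion a b s x₀ R i).hi - s))
        ((greedyMotion a b s x₀ R i).z + k * ρ))
  | 0, _ => by
    obtain ⟨h1, h2⟩ := valid_greedyMotion hs ha hb R i
    generalize greedyMotion a b s x₀ R i = σ at *
    obtain ⟨z, lo, hi⟩ := σ
    simp only [Band.Valid, Band.Within, Band.track, Nat.cast_zero, zero_mul,
      add_zero, Band.mk.injEq] at *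
    grind
  | k + 1, h => by
    have hstep := greedyMotion_down hρ (k := k) fun j hj => h j (by omega)
    have hk : (k : ℝ) * ρ ≤ 0 := mul_nonpos_of_nonneg_of_nonpos (Nat.cast_nonneg k) hρ
    obtain ⟨h1, h2⟩ := valid_greedyMotion hs ha hb R i
    rw [← Nat.add_assoc, greedyMotion, hstep, h k (by omega)]
    push_cast
    rw [add_mul, one_mul]
    generalize (k : ℝ) * ρ = y at *
    generalize greedyMotion a b s x₀ R i = σ at *
    obtain ⟨z, lo, hi⟩ := σ
    simp only [Band.Valid, Band.Within, Band.greedy, Band.track, Band.mk.injEq] at *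
    have e1 : max hi (max (max a (hi - s)) (z + y)) = hi := by grind
    rw [e1]
    have e2 : max (max a (hi - s)) (min (min b (min lo (max (max a (hi - s)) (z + y)) + s))
        (max (max a (hi - s)) (z + y) + ρ)) =
        max (max a (hi - s)) (z + (y + ρ)) := by grind
    rw [e2]
    refine ⟨rfl, ?_, rfl⟩
    grind

end

/-- The greedy motion goes up and down by its full range if it has the room. -/
theorem greedyMotion_up_down_up {a b s w x₀ : ℝ} (hs : 0 ≤ s) (hsw : s ≤ w) (ha : a ≤ x₀)
    (hb : x₀ + s ≤ b) {n : ℕ} (hn : 0 < n) :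
    (greedyMotion a b s x₀ (phases n s w) n).z = x₀ + s ∧
    (greedyMotion a b s x₀ (phases n s w) (2 * n)).z = x₀ + s - s ∧
    (greedyMotion a b s x₀ (phases n s w) (3 * n)).z = x₀ + s - s + s := by
  have hn' : (n : ℝ) ≠ 0 := Nat.cast_ne_zero.2 hn.ne'
  have hn0 : (0 : ℝ) ≤ n := Nat.cast_nonneg n
  have hb' : x₀ ≤ b := by linarith
  have e1 : (n : ℝ) * (s / n) = s := by field_simp
  have e2 : (n : ℝ) * (-w / n) = -w := by field_simp
  have h1 := greedyMotion_up (i := 0) (k := n) (R := phases n s w) hs ha hb'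
    (div_nonneg hs hn0) (fun j hj => by rw [Nat.zero_add]; exact phases_first _ _ hj)
  -- After the first phase `hi = x₀ + s`, so the floor is `x₀`, and the request of `w ≥ s` is cut
  -- off there.
  have h2 := greedyMotion_down (i := n) (k := n) (R := phases n s w) hs ha hb'
    (div_nonpos_of_nonpos_of_nonneg (by linarith : -w ≤ 0) hn0)
    (fun j hj => phases_second _ _ (by omega) (by omega))
  have h3 := greedyMotion_up (i := 2 * n) (k := n) (R := phases n s w) hs ha hb'
    (div_nonneg hs hn0) (fun j hj => phases_third _ _ (by omega) (by omega))
  rw [Nat.zero_add, e1] at h1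
  rw [← two_mul, h1, e2] at h2
  rw [show 2 * n + n = 3 * n by ring, h2, e1] at h3
  rw [h3, h2, h1]
  simp only [greedyMotion, Band.track]
  refine ⟨?_, ?_, ?_⟩ <;> grind

theorem greedyMotion_down_up_down {a b s w x₀ : ℝ} (hs : 0 ≤ s) (hsw : s ≤ w) (ha : a ≤ x₀ - s)
    (hb : x₀ ≤ b) {n : ℕ} (hn : 0 < n) :
    (greedyMotion a b s x₀ (phases n (-s) (-w)) n).z = x₀ - s ∧
    (greedyMotion a b s x₀ (phases n (-s) (-w)) (2 * n)).z = x₀ - s + s ∧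
    (greedyMotion a b s x₀ (phases n (-s) (-w)) (3 * n)).z = x₀ - s + s - s := by
  have hn' : (n : ℝ) ≠ 0 := Nat.cast_ne_zero.2 hn.ne'
  have hn0 : (0 : ℝ) ≤ n := Nat.cast_nonneg n
  have ha' : a ≤ x₀ := by linarith
  have e1 : (n : ℝ) * (-s / n) = -s := by field_simp
  have e2 : (n : ℝ) * (- -w / n) = w := by field_simp
  have h1 := greedyMotion_down (i := 0) (k := n) (R := phases n (-s) (-w)) hs ha' hb
    (div_nonpos_of_nonpos_of_nonneg (by linarith : -s ≤ 0) hn0)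
    (fun j hj => by rw [Nat.zero_add]; exact phases_first _ _ hj)
  have h2 := greedyMotion_up (i := n) (k := n) (R := phases n (-s) (-w)) hs ha' hb
    (div_nonneg (by linarith : 0 ≤ - -w) hn0)
    (fun j hj => phases_second _ _ (by omega) (by omega))
  have h3 := greedyMotion_down (i := 2 * n) (k := n) (R := phases n (-s) (-w)) hs ha' hb
    (div_nonpos_of_nonpos_of_nonneg (by linarith : -s ≤ 0) hn0)
    (fun j hj => phases_third _ _ (by omega) (by omega))
  rw [Nat.zero_add, e1] at h1
  rw [← two_mul, h1, e2] at h2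
  rw [show 2 * n + n = 3 * n by ring, h2, e1] at h3
  rw [h3, h2, h1]
  simp only [greedyMotion, Band.track]
  refine ⟨?_, ?_, ?_⟩ <;> grind

end Rainflow

/-! ### The instruction that attains the gap. -/

namespace Battery

open Rainflow

section
variable {b : Battery}

/-- The instruction that asks for a given change of the state of charge. -/
def instruction (b : Battery) (δ : ℝ) : ℝ :=
  if 0 ≤ δ then b.E / (b.τ * b.ηc) * δ else b.E * b.ηd / b.τ * δ

theorem disp_instruction (hb : b.Regular) (δ : ℝ) : b.disp (b.instruction δ) = δ := by
  have hcp : 0 < b.E / (b.τ * b.ηc) := div_pos hb.E (mul_pos hb.τ hb.ηc)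
  have hdp : 0 < b.E * b.ηd / b.τ := div_pos (mul_pos hb.E hb.ηd) hb.τ
  rcases le_or_gt 0 δ with h | h
  · rw [instruction, if_pos h, disp_of_nonneg (mul_nonneg hcp.le h), hb.up_inv]
  · rw [instruction, if_neg (not_le.2 h), disp_of_neg (mul_neg_of_pos_of_neg hdp h), hb.down_inv]

theorem abs_instruction_le (hb : b.Regular) (δ : ℝ) :
    |b.instruction δ| ≤ (b.E / (b.τ * b.ηc) + b.E * b.ηd / b.τ) * |δ| := by
  have hcp : 0 < b.E / (b.τ * b.ηc) := div_pos hb.E (mul_pos hb.τ hb.ηc)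
  have hdp : 0 < b.E * b.ηd / b.τ := div_pos (mul_pos hb.E hb.ηd) hb.τ
  rw [instruction]
  split_ifs
  · rw [abs_mul, abs_of_pos hcp]
    exact mul_le_mul_of_nonneg_right (by linarith) (abs_nonneg _)
  · rw [abs_mul, abs_of_pos hdp]
    exact mul_le_mul_of_nonneg_right (by linarith) (abs_nonneg _)

/-- Spreading a move over many intervals makes the power small. The length `n` does not involve the
initial SoC, so that one `T₀` serves all of them. -/
theorem exists_phase_length (hb : b.Regular) (α β : ℝ) :
    ∃ n : ℕ, 0 < n ∧ ∀ t, |b.instruction (phases n α β t)| ≤ b.P := by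
  set K := b.E / (b.τ * b.ηc) + b.E * b.ηd / b.τ with hK
  have hK0 : 0 ≤ K := add_nonneg (div_pos hb.E (mul_pos hb.τ hb.ηc)).le
    (div_pos (mul_pos hb.E hb.ηd) hb.τ).le
  obtain ⟨n, hn⟩ := exists_nat_gt (K * (|α| + |β|) / b.P)
  have hn0 : (0 : ℝ) < n := lt_of_le_of_lt (div_nonneg (by positivity) hb.P.le) hn
  refine ⟨n, Nat.cast_pos.1 hn0, fun t => ?_⟩
  refine (abs_instruction_le hb _).trans
    ((mul_le_mul_of_nonneg_left (abs_phases_le n α β t) hK0).trans ?_)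
  rw [div_lt_iff₀ hb.P] at hn
  rw [← mul_div_assoc, div_le_iff₀ hn0]
  linarith

theorem path_instruction (hb : b.Regular) (u x₀ : ℝ) (R : ℕ → ℝ) :
    b.path u x₀ (fun t => b.instruction (R t)) = greedyMotion b.xlo b.xhi u x₀ R := by
  simp only [path, disp_instruction hb]

theorem Jv_zero (hΦ0 : b.Φ 0 = 0) : b.Jv 0 = 0 := by simp [Jv, hΦ0]

theorem Jw_zero (hΦ0 : b.Φ 0 = 0) : b.Jw 0 = 0 := by simp [Jw, hΦ0]

theorem cycleCost_phases_up (hΦ0 : b.Φ 0 = 0) {n T : ℕ} (hn : 0 < n) (hT : 3 * n + 1 ≤ T)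
    {α β p A B : ℝ} (hA : 0 ≤ A) (hAB : A ≤ B) {f : ℕ → ℝ} (hf0 : f 0 = p) (hf1 : f n = p + A)
    (hf2 : f (2 * n) = p + A - B) (hf3 : f (3 * n) = p + A - B + A)
    (hf : ∀ t, (0 ≤ f (t + 1) - f t ∧ f (t + 1) - f t ≤ phases n α β t) ∨
      (phases n α β t ≤ f (t + 1) - f t ∧ f (t + 1) - f t ≤ 0)) :
    b.cycleCost f T = 2 * b.Jv A + b.Jw B := by
  rw [cycleCost, rainflow_of_phases hn α β hT hf, hf0, hf1, hf2, hf3]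
  exact rainflow_up_down_up (Jv_zero hΦ0) (Jw_zero hΦ0) hA hAB

theorem cycleCost_phases_down (hΦ0 : b.Φ 0 = 0) {n T : ℕ} (hn : 0 < n) (hT : 3 * n + 1 ≤ T)
    {α β p A B : ℝ} (hA : 0 ≤ A) (hAB : A ≤ B) {f : ℕ → ℝ} (hf0 : f 0 = p) (hf1 : f n = p - A)
    (hf2 : f (2 * n) = p - A + B) (hf3 : f (3 * n) = p - A + B - A)
    (hf : ∀ t, (0 ≤ f (t + 1) - f t ∧ f (t + 1) - f t ≤ phases n α β t) ∨
      (phases n α β t ≤ f (t + 1) - f t ∧ f (t + 1) - f t ≤ 0)) :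
    b.cycleCost f T = b.Jv B + 2 * b.Jw A := by
  rw [cycleCost, rainflow_of_phases hn α β hT hf, hf0, hf1, hf2, hf3]
  exact rainflow_down_up_down (Jv_zero hΦ0) (Jw_zero hΦ0) hA hAB

theorem greedyMotion_move {u x₀ : ℝ} (hu : 0 ≤ u) (hlo : b.xlo ≤ x₀) (hhi : x₀ ≤ b.xhi)
    (R : ℕ → ℝ) (t : ℕ) :
    (0 ≤ (greedyMotion b.xlo b.xhi u x₀ R (t + 1)).z - (greedyMotion b.xlo b.xhi u x₀ R t).z ∧
      (greedyMotion b.xlo b.xhi u x₀ R (t + 1)).z - (greedyMotion b.xlo b.xhi u x₀ R t).z ≤ R t) ∨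
    (R t ≤ (greedyMotion b.xlo b.xhi u x₀ R (t + 1)).z - (greedyMotion b.xlo b.xhi u x₀ R t).z ∧
      (greedyMotion b.xlo b.xhi u x₀ R (t + 1)).z - (greedyMotion b.xlo b.xhi u x₀ R t).z ≤ 0) := by
  have h := valid_greedyMotion hu hlo hhi R t
  exact Band.greedy_mem h.1 h.2 (R t)

/-- The alternating instruction for which the worst-case gap is attained. -/
theorem worst_case_up (hb : b.Regular) (hΦ0 : b.Φ 0 = 0) {u v w x₀ : ℝ} (hv : 0 ≤ v)
    (hvu : v ≤ u) (huw : u ≤ w) (hlo : b.xlo ≤ x₀) (hroom : x₀ + u ≤ b.xhi)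
    (hroom' : b.xlo ≤ x₀ + v - w) {n T : ℕ} (hn : 0 < n) (hT : 3 * n + 1 ≤ T) :
    Obeys b.xlo b.xhi x₀ (fun t => b.disp (b.instruction (phases n u w t)))
      (phasePath n v w x₀) T ∧
    b.cycleCost (fun t => (b.path u x₀ (fun t => b.instruction (phases n u w t)) t).z) T -
      b.cycleCost (phasePath n v w x₀) T = b.Jw u + 2 * b.Jv u - b.Jw w - 2 * b.Jv v := by
  have hu : 0 ≤ u := hv.trans hvu
  have hhi : x₀ ≤ b.xhi := by linarith
  -- The competitor takes only `v` of the `u` offered in the outer phases but the whole of `w` in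
  -- the middle one.
  have hobeys : ∀ T, Obeys b.xlo b.xhi x₀ (phases n u w) (phasePath n v w x₀) T :=
    obeys_phasePath hn v w x₀ ⟨hlo, hhi⟩ ⟨by linarith, by linarith⟩ ⟨hroom', by linarith⟩
      ⟨by linarith, by linarith⟩ (Or.inl ⟨hv, hvu⟩) (Or.inl ⟨by linarith, le_rfl⟩)
  obtain ⟨g1, g2, g3⟩ := greedyMotion_up_down_up hu huw hlo hroom hn
  rw [path_instruction hb,
    cycleCost_phases_up hΦ0 hn hT hu le_rfl (f := fun t =>
      (greedyMotion b.xlo b.xhi u x₀ (phases n u w) t).z) rfl g1 g2 g3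
      (greedyMotion_move hu hlo hhi (phases n u w)),
    cycleCost_phases_up hΦ0 hn hT hv (hvu.trans huw) (by simp [phasePath])
      (phasePath_n hn v w x₀) (phasePath_two hn v w x₀) (phasePath_three hn v w x₀)
      (fun t => ((hobeys (t + 1)).2 t (by omega)).1)]
  simp only [disp_instruction hb]
  exact ⟨hobeys T, by ring⟩

theorem worst_case_down (hb : b.Regular) (hΦ0 : b.Φ 0 = 0) {u v w x₀ : ℝ} (hw : 0 ≤ w)
    (hwu : w ≤ u) (huv : u ≤ v) (hhi : x₀ ≤ b.xhi) (hroom : b.xlo ≤ x₀ - u)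
    (hroom' : x₀ - w + v ≤ b.xhi) {n T : ℕ} (hn : 0 < n) (hT : 3 * n + 1 ≤ T) :
    Obeys b.xlo b.xhi x₀ (fun t => b.disp (b.instruction (phases n (-u) (-v) t)))
      (phasePath n (-w) (-v) x₀) T ∧
    b.cycleCost (fun t => (b.path u x₀ (fun t => b.instruction (phases n (-u) (-v) t)) t).z) T -
      b.cycleCost (phasePath n (-w) (-v) x₀) T =
        2 * b.Jw u + b.Jv u - 2 * b.Jw w - b.Jv v := by
  have hu : 0 ≤ u := hw.trans hwu
  have hlo : b.xlo ≤ x₀ := by linarith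
  have hobeys : ∀ T, Obeys b.xlo b.xhi x₀ (phases n (-u) (-v)) (phasePath n (-w) (-v) x₀) T :=
    obeys_phasePath hn (-w) (-v) x₀ ⟨hlo, hhi⟩ ⟨by linarith, by linarith⟩
      ⟨by linarith, by linarith⟩ ⟨by linarith, by linarith⟩
      (Or.inr ⟨by linarith, by linarith⟩) (Or.inr ⟨le_rfl, by linarith⟩)
  obtain ⟨g1, g2, g3⟩ := greedyMotion_down_up_down hu huv hroom hhi hn
  rw [path_instruction hb,
    cycleCost_phases_down hΦ0 hn hT hu le_rfl (f := fun t =>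
      (greedyMotion b.xlo b.xhi u x₀ (phases n (-u) (-v)) t).z) rfl g1 g2 g3
      (greedyMotion_move hu hlo hhi (phases n (-u) (-v))),
    cycleCost_phases_down hΦ0 hn hT (p := x₀) (A := w) (B := v) hw (hwu.trans huv)
      (by simp [phasePath])
      ((phasePath_n hn (-w) (-v) x₀).trans (by ring))
      ((phasePath_two hn (-w) (-v) x₀).trans (by ring))
      ((phasePath_three hn (-w) (-v) x₀).trans (by ring))
      (fun t => ((hobeys (t + 1)).2 t (by omega)).1)]
  simp only [disp_instruction hb]
  exact ⟨hobeys T, by ring⟩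

/-- The order of the optimal depths if discharging is worth more than charging. -/
theorem depth_order (hb : b.Regular) {u v w : ℝ} (hu : 0 ≤ u) (hv : 0 ≤ v) (hw : 0 ≤ w)
    (hu_min : IsMinOn b.Ju (Set.Ici 0) u) (hv_min : IsMinOn b.Jv (Set.Ici 0) v)
    (hw_min : IsMinOn b.Jw (Set.Ici 0) w) :
    (b.θ / b.ηc < b.π * b.ηd → v ≤ u ∧ u ≤ w) ∧ (b.π * b.ηd < b.θ / b.ηc → w ≤ u ∧ u ≤ v) := by
  -- The difference is linear, so adding the optimality inequalities of two minimizers leaves a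
  -- comparison of the depths themselves.
  have e : ∀ d, b.Jv d - b.Jw d = b.E * (b.π * b.ηd - b.θ / b.ηc) * d := fun d => by
    simp only [Jv, Jw]; ring
  have huv : b.Jv u + b.Jw u ≤ b.Jv v + b.Jw v := by
    rw [← Ju_eq, ← Ju_eq]; exact hu_min (Set.mem_Ici.2 hv)
  have huw : b.Jv u + b.Jw u ≤ b.Jv w + b.Jw w := by
    rw [← Ju_eq, ← Ju_eq]; exact hu_min (Set.mem_Ici.2 hw)
  have hvu : b.Jv v ≤ b.Jv u := hv_min (Set.mem_Ici.2 hu)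
  have hwu : b.Jw w ≤ b.Jw u := hw_min (Set.mem_Ici.2 hu)
  have eu := e u
  have ev := e v
  have ew := e w
  constructor
  · intro h
    have hl : 0 < b.E * (b.π * b.ηd - b.θ / b.ηc) := mul_pos hb.E (by linarith)
    exact ⟨le_of_mul_le_mul_left (by linarith) hl, le_of_mul_le_mul_left (by linarith) hl⟩
  · intro h
    have hl : b.E * (b.π * b.ηd - b.θ / b.ηc) < 0 := mul_neg_of_pos_of_neg hb.E (by linarith)
    exact ⟨(mul_le_mul_left_of_neg hl).1 (by linarith), (mul_le_mul_left_of_neg hl).1 (by linarith)⟩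

end

end Battery

end

theorem theorem3 (b : Battery)
    (hE : 0 < b.E) (hτ : 0 < b.τ) (hB : 0 < b.B) (hηc : 0 < b.ηc) (hηd : 0 < b.ηd)
    (hP : 0 < b.P) (hθ : 0 ≤ b.θ) (hπ : 0 ≤ b.π)
    (hΦ : StrictConvexOn ℝ (Set.Ici 0) b.Φ) (hΦ_mono : MonotoneOn b.Φ (Set.Ici 0))
    (hΦ_zero : b.Φ 0 = 0)
    (u v w : ℝ) (hu : 0 ≤ u) (hv : 0 ≤ v) (hw : 0 ≤ w)
    (hu_min : IsMinOn b.Ju (Set.Ici 0) u)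
    (hv_min : IsMinOn b.Jv (Set.Ici 0) v)
    (hw_min : IsMinOn b.Jw (Set.Ici 0) w) :
    (∀ (T : ℕ) (x₀ : ℝ), b.xlo ≤ x₀ → x₀ ≤ b.xhi →
      ∀ r : ℕ → ℝ, (∀ t < T, |r t| ≤ b.P) → b.gap u x₀ T r ≤ b.worstGap u v w) ∧
    (∃ T₀ : ℕ, ∀ T ≥ T₀, ∀ x₀ : ℝ, b.HasRoom u v w x₀ →
      IsGreatest {g : ℝ | ∃ r : ℕ → ℝ, (∀ t < T, |r t| ≤ b.P) ∧ g = b.gap u x₀ T r}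
        (b.worstGap u v w)) := by
  have hb : b.Regular := ⟨hE, hτ, hB, hηc, hηd, hP⟩
  have hle : ∀ (T : ℕ) (x₀ : ℝ), b.xlo ≤ x₀ → x₀ ≤ b.xhi →
      ∀ r : ℕ → ℝ, (∀ t < T, |r t| ≤ b.P) → b.gap u x₀ T r ≤ b.worstGap u v w :=
    fun T x₀ hlo hhi r hr => Battery.gap_le_worstGap hb hΦ.convexOn hΦ_zero hu hv hw hu_min hv_min
      hw_min hlo hhi hr
  -- One competing path with the right cost difference suffices: it bounds the gap from below, and
  -- `hle` bounds it from above. The offline optimum need not be identified beforehand.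
  have hattained : ∀ (T : ℕ) (x₀ : ℝ), b.xlo ≤ x₀ → x₀ ≤ b.xhi →
      (∃ r x : ℕ → ℝ, (∀ t < T, |r t| ≤ b.P) ∧
        Rainflow.Obeys b.xlo b.xhi x₀ (fun t => b.disp (r t)) x T ∧
        b.cycleCost (fun t => (b.path u x₀ r t).z) T - b.cycleCost x T = b.worstGap u v w) →
      IsGreatest {g : ℝ | ∃ r : ℕ → ℝ, (∀ t < T, |r t| ≤ b.P) ∧ g = b.gap u x₀ T r}
        (b.worstGap u v w) := by
    rintro T x₀ hlo hhi ⟨r, x, hr, hx, he⟩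
    refine ⟨⟨r, hr, le_antisymm ?_ (hle T x₀ hlo hhi r hr)⟩, ?_⟩
    · rw [← he]
      exact Battery.le_gap hb hΦ.convexOn hΦ_zero hu hv hw hu_min hv_min hw_min hlo hhi hr hx
    · rintro g ⟨r, hr, rfl⟩
      exact hle T x₀ hlo hhi r hr
  have hord := Battery.depth_order hb hu hv hw hu_min hv_min hw_min
  refine ⟨hle, ?_⟩
  rcases lt_trichotomy (b.θ / b.ηc) (b.π * b.ηd) with hc | hc | hc
  · obtain ⟨n, hn, hP'⟩ := Battery.exists_phase_length hb u w
    refine ⟨3 * n + 1, fun T hT x₀ hroom => ?_⟩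
    obtain ⟨⟨hlo, hhi⟩, hr, -⟩ := hroom
    obtain ⟨h1, h2⟩ := Battery.worst_case_up hb hΦ_zero hv (hord.1 hc).1 (hord.1 hc).2 hlo (hr hc).1
      (hr hc).2 hn hT
    refine hattained T x₀ hlo hhi ⟨_, _, fun t _ => hP' t, h1, ?_⟩
    rw [h2, Battery.worstGap, if_pos hc]
  -- In the case of equality the bound is zero, so the policy's own path serves as competitor, here
  -- for the zero instruction.
  · refine ⟨0, fun T _ x₀ hroom => hattained T x₀ hroom.1.1 hroom.1.2
      ⟨fun _ => 0, fun t => (b.path u x₀ (fun _ => 0) t).z, fun t _ => by simpa using hP.le, ?_, ?_⟩⟩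
    · refine ⟨rfl, fun t _ => ⟨?_, ?_⟩⟩
      · exact Battery.greedyMotion_move hu hroom.1.1 hroom.1.2 (fun _ => b.disp 0) t
      · have h := Rainflow.valid_greedyMotion hu hroom.1.1 hroom.1.2 (fun _ => b.disp 0) (t + 1)
        exact ⟨h.2.1.trans h.1.1, h.1.2.1.trans h.2.2⟩
    · rw [sub_self, Battery.worstGap, if_neg hc.not_lt, if_pos hc.symm]
  · obtain ⟨n, hn, hP'⟩ := Battery.exists_phase_length hb (-u) (-v)
    refine ⟨3 * n + 1, fun T hT x₀ hroom => ?_⟩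
    obtain ⟨⟨hlo, hhi⟩, -, hr⟩ := hroom
    obtain ⟨h1, h2⟩ := Battery.worst_case_down hb hΦ_zero hw (hord.2 hc).1 (hord.2 hc).2 hhi
      (hr hc).1 (hr hc).2 hn hT
    refine hattained T x₀ hlo hhi ⟨_, _, fun t _ => hP' t, h1, ?_⟩
    rw [h2, Battery.worstGap, if_neg (not_lt.2 hc.le), if_neg hc.ne]
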